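/- Let $n\ge 1$, let $dV$ be Lebesgue measure on $\mathbb C^n$ normalized so that $\int e^{-|z|^2}\,dV(z)=1$, and let $H(\mathbb C^n)$ be the space of entire functions. For real $\alpha$ and $0<p<\infty$, $L^p_\alpha$ is the space of Lebesgue measurable $\psi$ with $\|\psi\|_{L^p_\alpha}=\big(\int |\psi(z)e^{-|z|^2/2}|^p\,(1+|z|)^{-\alpha}dV(z)\big)^{1/p}<\infty$, and $L^\infty_\alpha$ is the space of those with $\|\psi\|_{L^\infty_\alpha}=\operatorname{ess\,sup}_z |\psi(z)|e^{-|z|^2/2}(1+|z|)^{-\alpha}<\infty$. Put $F^p_\alpha=L^p_\alpha\cap H(\mathbb C^n)$ with the norm of $L^p_\alpha$, for $0<p\le\infty$. For $f\in H(\mathbb C^n)$ with homogeneous expansion $f=\sum_{k\ge0}f_k$ and real $s$, put $f_s^-=\sum_{k\le|s|}f_k$, $f_s^+=f-f_s^-$, and $$\mathcal D^sf=\sum_{k}\frac{\Gamma(n+s+k)}{\Gamma(n+k)}f_k,\qquad \mathcal R^sf(z)=(1+|z|)^{-s}\,\mathcal D^sf(z),$$ where the sum is over all $k\ge0$ if $s\ge0$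 and over all $k>|s|$ if $s<0$. The weighted Fock–Sobolev space $F^p_{\alpha,s}$ consists of all $f\in H(\mathbb C^n)$ with $\mathcal R^sf\in L^p_\alpha$, with (quasi-)norm $\|f\|_{F^p_{\alpha,s}}=\|\mathcal R^sf\|_{L^p_\alpha}$ if $s\ge0$ and $\|f\|_{F^p_{\alpha,s}}=\|\mathcal R^sf\|_{L^p_\alpha}+\|f_s^-\|_{L^p_\alpha}$ if $s<0$. For real $\sigma$ put $(\psi,\varphi)_\sigma=\int\psi(z)\overline{\varphi(z)}e^{-|z|^2}|z|^{-\sigma}dV(z)$ and $$\langle f,g\rangle_\sigma=\begin{cases}(f,g)_\sigma&\text{if }\sigma<2n,\\ (f_{\sigma/2}^-,g_{\sigma/2}^-)_0+(f_{\sigma/2}^+,g_{\sigma/2}^+)_\sigma&\text{if }\sigma\ge2n.\end{cases}$$ For a space $F$ with (quasi-)norm $\|\cdot\|_F$, $F^*$ denotes the space of bounded linear functionals $\nu$ on $F$, with $\|\nu\|$ the least $C\ge0$ such that $|\nu(f)|\le C\|f\|_F$ for all $f\in F$. We say that $F^*=G$ with equivalent norms under $\langle\cdot,\cdot\rangle_\sigma$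 if the integrals defining $\langle f,g\rangle_\sigma$ converge absolutely for all $f\in F$, $g\in G$, the map $g\mapsto\langle\cdot,g\rangle_\sigma$ is a conjugate-linear bijection of $G$ onto $F^*$, and there is a constant $C>0$ with $C^{-1}\|g\|_G\le\|\langle\cdot,g\rangle_\sigma\|\le C\|g\|_G$ for all $g\in G$. **Corollary 5.9.** Let $s,t,\alpha,\beta$ be real numbers. Then the following dualities hold with equivalent norms: (1) if $1<p<\infty$ and $1/p+1/q=1$, then $(F^p_{\alpha,s})^*=F^q_{\beta,t}$ under the pairing $\langle\cdot,\cdot\rangle_\sigma$ with $\sigma=\alpha/p+\beta/q-s-t$; (2) if $0<p\le1$, then $(F^p_{\alpha,s})^*=F^\infty_\beta$ under the pairing $\langle\cdot,\cdot\rangle_\sigma$ with $\sigma=\alpha/p+\beta-s$. -/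

import Mathlib

open MeasureTheory
open scoped ENNReal ComplexConjugate

/-- Complex `n`-space with the norm `|z| = (∑ |z_j|²)^{1/2}`. -/
abbrev Cn (n : ℕ) : Type := EuclideanSpace ℂ (Fin n)

/-- The measure `dV`: Lebesgue measure on `ℂⁿ`, scaled so that `∫ e^{-|z|²} dV(z) = 1`
(this is `integral_gaussian_fockV` below). -/
noncomputable def fockV (n : ℕ) : Measure (Cn n) :=
  (ENNReal.ofReal (Real.pi ^ n))⁻¹ • (volume : Measure (Cn n))

theorem integral_gaussian_fockV (n : ℕ) :
    ∫ z : Cn n, Real.exp (-‖z‖ ^ 2) ∂(fockV n) = 1 := by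
  have h := GaussianFourier.integral_rexp_neg_mul_sq_norm (V := Cn n) (b := 1) one_pos
  have hd : Module.finrank ℝ (Cn n) = 2 * n := by
    rw [← Module.finrank_mul_finrank ℝ ℂ (Cn n)]
    simp
  have h2 : ∫ z : Cn n, Real.exp (-‖z‖ ^ 2) = Real.pi ^ n := by
    have : (((2 * n : ℕ) : ℝ) / 2) = (n : ℝ) := by push_cast; ring
    rw [hd, this] at h
    simpa using h
  have hp : (0 : ℝ) < Real.pi ^ n := by positivity
  rw [fockV, integral_smul_measure, h2, ENNReal.toReal_inv, ENNReal.toReal_ofReal hp.le,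
    smul_eq_mul, inv_mul_cancel₀ hp.ne']

/-- `dV_α(z) = dV(z) / (1 + |z|)^α`. -/
noncomputable def fockVw (n : ℕ) (α : ℝ) : Measure (Cn n) :=
  (fockV n).withDensity fun z => ENNReal.ofReal (1 / (1 + ‖z‖) ^ α)

/-- `dW_α(z) = dV(z) / |z|^α`. -/
noncomputable def fockW (n : ℕ) (α : ℝ) : Measure (Cn n) :=
  (fockV n).withDensity fun z => ENNReal.ofReal (1 / ‖z‖ ^ α)

/-- `ψ(z) e^{-|z|²/2}`. -/
noncomputable def gaussMul {n : ℕ} (ψ : Cn n → ℂ) (z : Cn n) : ℂ :=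
  ((Real.exp (-‖z‖ ^ 2 / 2) : ℝ) : ℂ) * ψ z

/-- `ψ(z) e^{-|z|²/2} / (1 + |z|)^α`. -/
noncomputable def gaussMulInfty {n : ℕ} (α : ℝ) (ψ : Cn n → ℂ) (z : Cn n) : ℂ :=
  ((Real.exp (-‖z‖ ^ 2 / 2) / (1 + ‖z‖) ^ α : ℝ) : ℂ) * ψ z

/-- Membership in `L^p_α`, `0 < p ≤ ∞`. -/
def MemLw {n : ℕ} (p : ℝ≥0∞) (α : ℝ) (ψ : Cn n → ℂ) : Prop :=
  (p ≠ ∞ ∧ MemLp (gaussMul ψ) p (fockVw n α)) ∨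
    (p = ∞ ∧ MemLp (gaussMulInfty α ψ) ∞ (fockV n))

open Classical in
/-- The (quasi-)norm of `L^p_α`: for `p < ∞` it is `(∫ |ψ e^{-|z|²/2}|^p dV_α)^{1/p}`, and for
`p = ∞` it is the essential supremum of `|ψ(z)| e^{-|z|²/2} / (1 + |z|)^α`. -/
noncomputable def normLw {n : ℕ} (p : ℝ≥0∞) (α : ℝ) (ψ : Cn n → ℂ) : ℝ :=
  if p = ∞ then (eLpNorm (gaussMulInfty α ψ) ∞ (fockV n)).toReal
  else (eLpNorm (gaussMul ψ) p (fockVw n α)).toReal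

/-- The homogeneous part `f_k` of degree `k` in the expansion `f = ∑ f_k` of an entire function:
`f_k(z)` is the coefficient of `t^k` in the Taylor series of `t ↦ f(tz)` at `t = 0`. -/
noncomputable def homPart {n : ℕ} (k : ℕ) (f : Cn n → ℂ) (z : Cn n) : ℂ :=
  iteratedDeriv k (fun t : ℂ => f (t • z)) 0 / (k.factorial : ℂ)

open Classical in
/-- The multipliers of the fractional derivative of order `s`: `Γ(n+s+k)/Γ(n+k)` for every `k`
if `s ≥ 0`, and only for `k > |s|` if `s < 0`. -/
noncomputable def fracCoeff (n : ℕ) (s : ℝ) (k : ℕ) : ℝ :=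
  if 0 ≤ s ∨ |s| < (k : ℝ) then Real.Gamma (n + s + k) / Real.Gamma (n + k) else 0

/-- The fractional derivative `𝒟^s f`. -/
noncomputable def fracD {n : ℕ} (s : ℝ) (f : Cn n → ℂ) (z : Cn n) : ℂ :=
  ∑' k : ℕ, (fracCoeff n s k : ℂ) * homPart k f z

/-- The fractional radial derivative `ℛ^s f(z) = (1 + |z|)^{-s} 𝒟^s f(z)`. -/
noncomputable def fracR {n : ℕ} (s : ℝ) (f : Cn n → ℂ) (z : Cn n) : ℂ :=
  ((1 / (1 + ‖z‖) ^ s : ℝ) : ℂ) * fracD s f z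

/-- `f_s^-`, the sum of the homogeneous parts of degree `k ≤ |s|`. -/
noncomputable def lowPart {n : ℕ} (s : ℝ) (f : Cn n → ℂ) (z : Cn n) : ℂ :=
  ∑ k ∈ Finset.range (⌊|s|⌋₊ + 1), homPart k f z

/-- `f_s^+ = f - f_s^-`, the tail of degree bigger than `|s|`. -/
noncomputable def highPart {n : ℕ} (s : ℝ) (f : Cn n → ℂ) (z : Cn n) : ℂ :=
  f z - lowPart s f z

section Linearity

variable {n : ℕ}

theorem gaussMul_add (ψ χ : Cn n → ℂ) : gaussMul (ψ + χ) = gaussMul ψ + gaussMul χ := by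
  funext z; simp only [gaussMul, Pi.add_apply]; ring

theorem gaussMul_smul (c : ℂ) (ψ : Cn n → ℂ) : gaussMul (c • ψ) = c • gaussMul ψ := by
  funext z; simp only [gaussMul, Pi.smul_apply, smul_eq_mul]; ring

theorem gaussMulInfty_add (α : ℝ) (ψ χ : Cn n → ℂ) :
    gaussMulInfty α (ψ + χ) = gaussMulInfty α ψ + gaussMulInfty α χ := by
  funext z; simp only [gaussMulInfty, Pi.add_apply]; ring

theorem gaussMulInfty_smul (α : ℝ) (c : ℂ) (ψ : Cn n → ℂ) :
    gaussMulInfty α (c • ψ) = c • gaussMulInfty α ψ := by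
  funext z; simp only [gaussMulInfty, Pi.smul_apply, smul_eq_mul]; ring

theorem MemLw.add {p : ℝ≥0∞} {α : ℝ} {ψ χ : Cn n → ℂ} (h : MemLw p α ψ) (h' : MemLw p α χ) :
    MemLw p α (ψ + χ) := by
  rcases h with ⟨hp, h⟩ | ⟨hp, h⟩ <;> rcases h' with ⟨hp', h'⟩ | ⟨hp', h'⟩
  · exact Or.inl ⟨hp, by rw [gaussMul_add]; exact MemLp.add h h'⟩
  · exact absurd hp' hp
  · exact absurd hp hp'
  · exact Or.inr ⟨hp, by rw [gaussMulInfty_add]; exact MemLp.add h h'⟩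

theorem MemLw.const_smul {p : ℝ≥0∞} {α : ℝ} {ψ : Cn n → ℂ} (c : ℂ) (h : MemLw p α ψ) :
    MemLw p α (c • ψ) := by
  rcases h with ⟨hp, h⟩ | ⟨hp, h⟩
  · exact Or.inl ⟨hp, by rw [gaussMul_smul]; exact MemLp.const_smul h c⟩
  · exact Or.inr ⟨hp, by rw [gaussMulInfty_smul]; exact MemLp.const_smul h c⟩

theorem memLw_zero (p : ℝ≥0∞) (α : ℝ) : MemLw p α (0 : Cn n → ℂ) := by
  have h1 : gaussMul (0 : Cn n → ℂ) = 0 := by funext z; simp [gaussMul]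
  have h2 : gaussMulInfty α (0 : Cn n → ℂ) = 0 := by funext z; simp [gaussMulInfty]
  by_cases hp : p = ∞
  · exact Or.inr ⟨hp, by rw [h2]; exact MemLp.zero⟩
  · exact Or.inl ⟨hp, by rw [h1]; exact MemLp.zero⟩

theorem differentiable_line {f : Cn n → ℂ} (hf : Differentiable ℂ f) (z : Cn n) :
    Differentiable ℂ (fun t : ℂ => f (t • z)) :=
  hf.comp (differentiable_id.smul_const z)

theorem homPart_add {f g : Cn n → ℂ} (hf : Differentiable ℂ f) (hg : Differentiable ℂ g)
    (k : ℕ) (z : Cn n) : homPart k (f + g) z = homPart k f z + homPart k g z := by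
  have h1 : ContDiffAt ℂ (k : ℕ) (fun t : ℂ => f (t • z)) 0 :=
    (differentiable_line hf z).contDiff.contDiffAt
  have h2 : ContDiffAt ℂ (k : ℕ) (fun t : ℂ => g (t • z)) 0 :=
    (differentiable_line hg z).contDiff.contDiffAt
  have h3 := iteratedDeriv_add h1 h2
  have h4 : (fun t : ℂ => (f + g) (t • z))
      = (fun t : ℂ => f (t • z)) + (fun t : ℂ => g (t • z)) := rfl
  rw [homPart, h4, h3, homPart, homPart, add_div]

theorem homPart_smul (c : ℂ) (f : Cn n → ℂ) (k : ℕ) (z : Cn n) :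
    homPart k (c • f) z = c * homPart k f z := by
  have h4 : (fun t : ℂ => (c • f) (t • z)) = (fun t : ℂ => c * f (t • z)) := rfl
  rw [homPart, h4, iteratedDeriv_const_mul_field, homPart, mul_div_assoc]

theorem hasSum_homPart {f : Cn n → ℂ} (hf : Differentiable ℂ f) (z : Cn n) :
    HasSum (fun k => homPart k f z) (f z) := by
  have h := Complex.hasSum_taylorSeries_of_entire (differentiable_line hf z) 0 1
  simp only [sub_zero, one_pow, one_smul, smul_eq_mul, one_mul] at h
  refine h.congr_fun ?_
  intro k
  simp [homPart, div_eq_inv_mul]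

theorem homPart_two_smul {f : Cn n → ℂ} (hf : Differentiable ℂ f) (k : ℕ) (z : Cn n) :
    homPart k f ((2 : ℂ) • z) = 2 ^ k * homPart k f z := by
  have h1 : ContDiff ℂ (k : ℕ) (fun t : ℂ => f (t • z)) := (differentiable_line hf z).contDiff
  have h2 := congrFun (iteratedDeriv_comp_const_mul h1 (2 : ℂ)) 0
  have h4 : (fun t : ℂ => f (t • (2 : ℂ) • z)) = (fun t : ℂ => f ((2 * t) • z)) := by
    funext t; rw [smul_smul, mul_comm]
  rw [homPart, h4, h2, homPart]
  simp [mul_div_assoc]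

theorem summable_fracCoeff (s : ℝ) :
    Summable fun k => fracCoeff n s k * (1 / 2 : ℝ) ^ k := by
  have hev : ∀ᶠ k : ℕ in Filter.atTop, |s| < (k : ℝ) ∧ 1 ≤ k :=
    (tendsto_natCast_atTop_atTop.eventually_gt_atTop |s|).and (Filter.eventually_ge_atTop 1)
  have hpos : ∀ k : ℕ, |s| < (k : ℝ) → 0 < (n : ℝ) + s + k := fun k hk => by
    have h1 := neg_abs_le s
    have h2 : (0 : ℝ) ≤ n := n.cast_nonneg
    linarith
  have hpos' : ∀ k : ℕ, 1 ≤ k → 0 < (n : ℝ) + k := fun k hk => by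
    have h1 : (1 : ℝ) ≤ k := by exact_mod_cast hk
    have h2 : (0 : ℝ) ≤ n := n.cast_nonneg
    linarith
  refine summable_of_ratio_test_tendsto_lt_one (l := 1 / 2) (by norm_num) ?_ ?_
  · filter_upwards [hev] with k hk
    rw [fracCoeff, if_pos (Or.inr hk.1)]
    have h1 := Real.Gamma_pos_of_pos (hpos k hk.1)
    have h2 := Real.Gamma_pos_of_pos (hpos' k hk.2)
    positivity
  · have hlim : Filter.Tendsto (fun k : ℕ => (1 + s / ((n : ℝ) + k)) * (1 / 2)) Filter.atTop
        (nhds ((1 + 0) * (1 / 2))) := by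
      refine Filter.Tendsto.mul_const _ (Filter.Tendsto.const_add _ ?_)
      exact Filter.Tendsto.const_div_atTop
        (Filter.tendsto_atTop_add_const_left _ _ tendsto_natCast_atTop_atTop) _
    rw [add_zero, one_mul] at hlim
    refine hlim.congr' ?_
    filter_upwards [hev] with k hk
    have hk1 : |s| < ((k + 1 : ℕ) : ℝ) := by push_cast; linarith [hk.1]
    have e1 := hpos k hk.1
    have e2 := hpos' k hk.2
    have h1 := Real.Gamma_pos_of_pos e1
    have h2 := Real.Gamma_pos_of_pos e2
    have g1 : Real.Gamma ((n : ℝ) + s + (k + 1 : ℕ))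
        = ((n : ℝ) + s + k) * Real.Gamma ((n : ℝ) + s + k) := by
      rw [← Real.Gamma_add_one e1.ne']; congr 1; push_cast; ring
    have g2 : Real.Gamma ((n : ℝ) + (k + 1 : ℕ))
        = ((n : ℝ) + k) * Real.Gamma ((n : ℝ) + k) := by
      rw [← Real.Gamma_add_one e2.ne']; congr 1; push_cast; ring
    rw [fracCoeff, fracCoeff, if_pos (Or.inr hk.1), if_pos (Or.inr hk1), g1, g2,
      Real.norm_of_nonneg (by positivity), Real.norm_of_nonneg (by positivity)]
    field_simp
    ring

/-- The series defining `𝒟^s f` converges for every entire `f`. -/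
theorem summable_fracD {f : Cn n → ℂ} (hf : Differentiable ℂ f) (s : ℝ) (z : Cn n) :
    Summable fun k : ℕ => (fracCoeff n s k : ℂ) * homPart k f z := by
  obtain ⟨C, hC⟩ := (hasSum_homPart hf ((2 : ℂ) • z)).summable.tendsto_atTop_zero.norm.bddAbove_range
  refine Summable.of_norm_bounded ((summable_fracCoeff (n := n) s).norm.mul_right C) fun k => ?_
  have h1 : ‖homPart k f ((2 : ℂ) • z)‖ ≤ C := hC ⟨k, rfl⟩
  have h2 : homPart k f z = (1 / 2 : ℂ) ^ k * homPart k f ((2 : ℂ) • z) := by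
    rw [homPart_two_smul hf, ← mul_assoc, ← mul_pow]; norm_num
  rw [h2, ← mul_assoc, norm_mul]
  refine mul_le_mul (le_of_eq ?_) h1 (norm_nonneg _) (norm_nonneg _)
  simp

theorem fracR_add {f g : Cn n → ℂ} (hf : Differentiable ℂ f) (hg : Differentiable ℂ g) (s : ℝ) :
    fracR s (f + g) = fracR s f + fracR s g := by
  funext z
  have h : fracD s (f + g) z = fracD s f z + fracD s g z := by
    rw [fracD, fracD, fracD, ← (summable_fracD hf s z).tsum_add (summable_fracD hg s z)]
    refine tsum_congr fun k => ?_
    rw [homPart_add hf hg, mul_add]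
  rw [Pi.add_apply, fracR, fracR, fracR, h, mul_add]

theorem fracR_smul (c : ℂ) (f : Cn n → ℂ) (s : ℝ) : fracR s (c • f) = c • fracR s f := by
  funext z
  have h : fracD s (c • f) z = c * fracD s f z := by
    rw [fracD, fracD, ← tsum_mul_left]
    refine tsum_congr fun k => ?_
    rw [homPart_smul]; ring
  rw [Pi.smul_apply, fracR, fracR, h, smul_eq_mul]; ring

end Linearity

/-- The weighted Fock space `F^p_α = L^p_α ∩ H(ℂⁿ)`. -/
def fockSpace (n : ℕ) (p : ℝ≥0∞) (α : ℝ) : Submodule ℂ (Cn n → ℂ) where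
  carrier := {f | Differentiable ℂ f ∧ MemLw p α f}
  zero_mem' := ⟨differentiable_const 0, memLw_zero p α⟩
  add_mem' := fun hf hg => ⟨hf.1.add hg.1, hf.2.add hg.2⟩
  smul_mem' := fun c _ hf => ⟨hf.1.const_smul c, hf.2.const_smul c⟩

/-- The weighted Fock-Sobolev space `F^p_{α,s}`: entire functions `f` with `ℛ^s f ∈ L^p_α`. -/
def fockSobolev (n : ℕ) (p : ℝ≥0∞) (α s : ℝ) : Submodule ℂ (Cn n → ℂ) where
  carrier := {f | Differentiable ℂ f ∧ MemLw p α (fracR s f)}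
  zero_mem' := by
    refine ⟨differentiable_const 0, ?_⟩
    have h := fracR_smul (n := n) 0 0 s
    rw [zero_smul, zero_smul] at h
    rw [h]
    exact memLw_zero p α
  add_mem' := fun hf hg => ⟨hf.1.add hg.1, by
    rw [fracR_add hf.1 hg.1]; exact hf.2.add hg.2⟩
  smul_mem' := fun c f hf => ⟨hf.1.const_smul c, by
    rw [fracR_smul]; exact hf.2.const_smul c⟩

open Classical in
/-- The (quasi-)norm of `F^p_{α,s}`. -/
noncomputable def fockSobolevNorm {n : ℕ} (p : ℝ≥0∞) (α s : ℝ) (f : Cn n → ℂ) : ℝ :=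
  if 0 ≤ s then normLw p α (fracR s f)
  else normLw p α (fracR s f) + normLw p α (lowPart s f)

/-- The integrand `ψ(z) conj(χ(z)) e^{-|z|²}`. -/
noncomputable def pairInt {n : ℕ} (ψ χ : Cn n → ℂ) (z : Cn n) : ℂ :=
  ψ z * conj (χ z) * ((Real.exp (-‖z‖ ^ 2) : ℝ) : ℂ)

/-- `(ψ, χ)_σ = ∫ ψ(z) conj(χ(z)) e^{-|z|²} dW_σ(z)`. -/
noncomputable def rawPairing {n : ℕ} (σ : ℝ) (ψ χ : Cn n → ℂ) : ℂ :=
  ∫ z, pairInt ψ χ z ∂(fockW n σ)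

open Classical in
/-- The pairing `⟨f, g⟩_σ`. -/
noncomputable def fockPairing {n : ℕ} (σ : ℝ) (f g : Cn n → ℂ) : ℂ :=
  if σ < 2 * n then rawPairing σ f g
  else rawPairing 0 (lowPart (σ / 2) f) (lowPart (σ / 2) g)
    + rawPairing σ (highPart (σ / 2) f) (highPart (σ / 2) g)

/-- All integrals in the definition of `⟨f, g⟩_σ` converge absolutely. -/
def FockPairingConverges {n : ℕ} (σ : ℝ) (f g : Cn n → ℂ) : Prop :=
  (σ < 2 * n → Integrable (pairInt f g) (fockW n σ)) ∧
  (2 * n ≤ σ →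
    Integrable (pairInt (lowPart (σ / 2) f) (lowPart (σ / 2) g)) (fockW n 0) ∧
    Integrable (pairInt (highPart (σ / 2) f) (highPart (σ / 2) g)) (fockW n σ))

/-- The dual `F^*` of a space `F` with (quasi-)norm `N`: the bounded linear functionals. -/
def boundedDual {n : ℕ} (F : Submodule ℂ (Cn n → ℂ)) (N : (Cn n → ℂ) → ℝ) :
    Submodule ℂ (F →ₗ[ℂ] ℂ) where
  carrier := {ν | ∃ C : ℝ, ∀ f : F, ‖ν f‖ ≤ C * N f}
  zero_mem' := ⟨0, fun f => by simp⟩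
  add_mem' := by
    rintro ν μ ⟨C, hC⟩ ⟨D, hD⟩
    refine ⟨C + D, fun f => ?_⟩
    rw [LinearMap.add_apply, add_mul]
    exact (norm_add_le _ _).trans (add_le_add (hC f) (hD f))
  smul_mem' := by
    rintro c ν ⟨C, hC⟩
    refine ⟨‖c‖ * C, fun f => ?_⟩
    rw [LinearMap.smul_apply, norm_smul, mul_assoc]
    exact mul_le_mul_of_nonneg_left (hC f) (norm_nonneg c)

/-- The norm of a bounded linear functional: the least `C ≥ 0` with `|ν(f)| ≤ C N(f)`. -/
noncomputable def dualNorm {n : ℕ} {F : Submodule ℂ (Cn n → ℂ)} (N : (Cn n → ℂ) → ℝ)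
    (ν : F →ₗ[ℂ] ℂ) : ℝ :=
  sInf {C : ℝ | 0 ≤ C ∧ ∀ f : F, ‖ν f‖ ≤ C * N f}

/-- `F^* = G` with equivalent norms under the pairing `⟨·, ·⟩_σ`: the pairing converges on
`F × G`, and `g ↦ ⟨·, g⟩_σ` is a conjugate-linear bijection of `G` onto `F^*` under which the
norm `NG` and the dual norm are comparable. -/
def IsDualUnderPairing {n : ℕ} (σ : ℝ) (F G : Submodule ℂ (Cn n → ℂ))
    (NF NG : (Cn n → ℂ) → ℝ) : Prop :=
  (∀ f ∈ F, ∀ g ∈ G, FockPairingConverges σ f g) ∧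
  ∃ Φ : G ≃ₛₗ[starRingEnd ℂ] boundedDual F NF,
    (∀ (g : G) (f : F), (Φ g : F →ₗ[ℂ] ℂ) f = fockPairing σ (f : Cn n → ℂ) (g : Cn n → ℂ)) ∧
    ∃ C : ℝ, 0 < C ∧ ∀ g : G,
      C⁻¹ * NG g ≤ dualNorm NF (Φ g : F →ₗ[ℂ] ℂ) ∧
      dualNorm NF (Φ g : F →ₗ[ℂ] ℂ) ≤ C * NG g

/-! Up to equivalent norms, every space involved is a plain weighted Fock space `fockA n p b`: the
entire f with f e^{-|z|²/2}(1+|z|)^b in L^p(dV). The exponent is b = s - α/p for F^p_{α,s} and b =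
-β for F^∞_β, and in both parts of the theorem σ = -(b + b'). So it suffices to show that `fockA n q
b'` is the dual of `fockA n p b` under the pairing whenever σ = -(b + b')
(`isDualUnderPairing_fockA`).

The reduction rests on a calculus of multipliers f ↦ ∑ m_k f_k. Such a map has order s (`MulOrd`) if
it sends weight b to weight b - 2s with a sup estimate that tolerates an error e^{|z-w|}. This
localized form is stable under composition. It also yields L^p bounds for all 0 < p ≤ ∞ at once,
because the sub-mean value property of |f|^p turns an L^p function into a pointwise majorant of the
same L^p size (`exists_fockN_le_of_dom`). The quotient Γ(a+k)/Γ(b+k) has order a - b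
(`mulOrd_gamma_div`): multiplication by k has order 1 by Cauchy's estimate on a disc of radius
(1+|z|)^{-2}, and negative orders come from Euler's beta integral, an average over dilations of f.
Hence 𝒟^s has order s and is inverted, off low degrees, by a multiplier of order -s
(`fockSobolev_eq`).

The pairing is bounded by Hölder's inequality away from 0. For p ≤ 1 this is the embedding of the
p-space into the 1-space. Near 0 the high parts vanish to order exceeding σ/2, which cancels the
singularity |z|^{-σ} (`exists_fockPairing_bound`). Polar coordinates show that on degree k the
pairing is a positive quotient of Gamma functions (or 1) times the Gaussian pairing
(`fockPairing_homPart`), so passing from one pairing to the other is a multiplier of order σ/2.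

For surjectivity, a functional ν is restricted to a smaller weighted L² space and represented there.
Its symbol g, given by conj g(w) = ν(e^{⟨w,·⟩}), is entire and represents ν on homogeneous
polynomials through the Gaussian pairing. Its norm is bounded by testing on the kernels themselves
if p ≤ 1, and on Bargmann projections of extremal functions if p > 1 (`exists_dual_representation`).
Density of polynomials, by dilation and Taylor truncation, extends the representation to the whole
space. Uniqueness follows by pairing the homogeneous parts of g with themselves. -/

/-! ### Holomorphic dependence of integrals on a parameter. -/

theorem norm_fderiv_le_of_forall_closedBall {E : Type*} [NormedAddCommGroup E] [NormedSpace ℂ E]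
    {f : E → ℂ} (hf : Differentiable ℂ f) {w : E} {C : ℝ} (hC0 : 0 ≤ C)
    (hC : ∀ v, ‖v - w‖ ≤ 1 → ‖f v‖ ≤ C) : ‖fderiv ℂ f w‖ ≤ C := by
  refine ContinuousLinearMap.opNorm_le_bound _ hC0 fun v => ?_
  rcases eq_or_ne v 0 with rfl | hv
  · simp
  have hv' : 0 < ‖v‖ := norm_pos_iff.2 hv
  have hline : Differentiable ℂ fun t : ℂ => f (w + t • v) :=
    hf.comp ((differentiable_id.smul_const v).const_add w)
  have hd : deriv (fun t : ℂ => f (w + t • v)) 0 = fderiv ℂ f w v := by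
    have h1 : HasDerivAt (fun t : ℂ => w + t • v) v 0 := by
      simpa using ((hasDerivAt_id (0 : ℂ)).smul_const v).const_add w
    have h2 : HasFDerivAt f (fderiv ℂ f w) (w + (0 : ℂ) • v) := by
      simpa using (hf w).hasFDerivAt
    exact (h2.comp_hasDerivAt (0 : ℂ) h1).deriv
  -- On the circle |t| = 1/‖v‖ the point w + tv is at distance exactly 1 from w.
  have h := Complex.norm_deriv_le_of_forall_mem_sphere_norm_le (c := 0) (R := ‖v‖⁻¹)
    (f := fun t : ℂ => f (w + t • v)) (C := C) (by positivity) hline.diffContOnCl ?_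
  · rw [hd] at h
    simpa using h
  · intro t ht
    refine hC _ ?_
    have : ‖t‖ = ‖v‖⁻¹ := by simpa using ht
    rw [add_sub_cancel_left, norm_smul, this, inv_mul_cancel₀ hv'.ne']

/-- An integral of entire functions depending on a parameter is entire, under locally uniform
domination. -/
theorem differentiable_integral_of_dominated {E : Type*} [NormedAddCommGroup E] [NormedSpace ℂ E]
    [FiniteDimensional ℂ E]
    {A : Type*} [TopologicalSpace A] [SecondCountableTopology A] [MeasurableSpace A]
    [OpensMeasurableSpace A] {μ : Measure A} {ψ : A → ℂ}
    {e : A → E → ℂ} (hψ : AEStronglyMeasurable ψ μ) (he : Continuous e.uncurry)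
    (hd : ∀ a, Differentiable ℂ (e a)) (B : ℝ → A → ℝ) (hB : ∀ R, Integrable (B R) μ)
    (hle : ∀ R a w, ‖w‖ ≤ R → ‖ψ a‖ * ‖e a w‖ ≤ B R a) :
    Differentiable ℂ fun w => ∫ a, ψ a * e a w ∂μ := by
  intro w
  borelize E
  have : ProperSpace E := FiniteDimensional.proper ℂ E
  have hmeas : ∀ v, AEStronglyMeasurable (fun a => ψ a * e a v) μ := fun v =>
    hψ.mul (he.comp (by fun_prop : Continuous fun a => (a, v))).aestronglyMeasurable
  have hm : Measurable fun a => fderiv ℂ (e a) w :=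
    (measurable_fderiv_with_param ℂ he).comp (by fun_prop : Measurable fun a => (a, w))
  -- Radius ‖w‖ + 2: one unit for v in the ball about w, one more for Cauchy's estimate of the
  -- derivative at v.
  refine (hasFDerivAt_integral_of_dominated_of_fderiv_le (𝕜 := ℂ) (s := Metric.ball w 1)
    (F' := fun v a => ψ a • fderiv ℂ (e a) v) (bound := B (‖w‖ + 2))
    (Metric.ball_mem_nhds w one_pos) (.of_forall hmeas) ?_ ?_ ?_ (hB _) ?_).differentiableAt
  · refine (hB ‖w‖).mono' (hmeas w) (.of_forall fun a => ?_)
    rw [norm_mul]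
    exact hle _ a w le_rfl
  · exact hψ.smul hm.aestronglyMeasurable
  · refine .of_forall fun a v hv => ?_
    have hv' : ‖v - w‖ < 1 := by simpa [dist_eq_norm] using hv
    have hvn : ‖v‖ ≤ ‖w‖ + 1 := by
      have := norm_sub_norm_le v w
      linarith
    have hbound : ∀ u, ‖u - v‖ ≤ 1 → ‖ψ a * e a u‖ ≤ B (‖w‖ + 2) a := fun u hu => by
      rw [norm_mul]
      have := norm_sub_norm_le u v
      exact hle _ a u (by linarith)
    have h0 : 0 ≤ B (‖w‖ + 2) a := (norm_nonneg _).trans (hbound v (by simp))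
    have h := norm_fderiv_le_of_forall_closedBall ((hd a).const_mul (ψ a)) h0 hbound
    rwa [fderiv_const_mul ((hd a) v)] at h
  · exact .of_forall fun a v _ => ((hd a) v).hasFDerivAt.const_mul (ψ a)

/-! ### Homogeneous expansions and multipliers acting on the degree. -/

section Homogeneous

variable {n : ℕ}

theorem homPart_smul_arg {f : Cn n → ℂ} (hf : Differentiable ℂ f) (k : ℕ) (c : ℂ) (z : Cn n) :
    homPart k f (c • z) = c ^ k * homPart k f z := by
  have h1 : ContDiff ℂ (k : ℕ) (fun t : ℂ => f (t • z)) := (differentiable_line hf z).contDiff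
  have h2 := congrFun (iteratedDeriv_comp_const_mul h1 c) 0
  have h4 : (fun t : ℂ => f (t • c • z)) = (fun t : ℂ => f ((c * t) • z)) := by
    funext t; rw [smul_smul, mul_comm]
  rw [homPart, h4, h2, homPart]
  simp [mul_div_assoc]

theorem norm_homPart_le {f : Cn n → ℂ} (hf : Differentiable ℂ f) (k : ℕ) (z : Cn n) {R C : ℝ}
    (hR : 0 < R) (hC : ∀ t : ℂ, ‖t‖ = R → ‖f (t • z)‖ ≤ C) : ‖homPart k f z‖ ≤ C / R ^ k := by
  have h := Complex.norm_iteratedDeriv_le_of_forall_mem_sphere_norm_le (c := 0) k hR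
    (differentiable_line hf z).diffContOnCl (C := C) fun t ht => hC t (by simpa using ht)
  rw [homPart, norm_div, Complex.norm_natCast]
  rw [div_le_iff₀ (by positivity)]
  calc _ ≤ _ := h
    _ = _ := by ring

/-- Uniqueness of the power series of f restricted to the complex line through z. -/
theorem homPart_eq_of_hasSum {f : Cn n → ℂ} {z : Cn n}
    {a : ℕ → ℂ} (ha : ∀ t : ℂ, HasSum (fun k => t ^ k * a k) (f (t • z))) (k : ℕ) :
    homPart k f z = a k := by
  have hps : HasFPowerSeriesAt (fun t : ℂ => f (t • z)) (FormalMultilinearSeries.ofScalars ℂ a)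
      0 := by
    rw [hasFPowerSeriesAt_iff]
    refine .of_forall fun t => ?_
    simpa [FormalMultilinearSeries.coeff_ofScalars] using ha t
  have han : AnalyticAt ℂ (fun t : ℂ => f (t • z)) 0 := hps.analyticAt
  have h2 := han.hasFPowerSeriesAt
  have h3 := hps.eq_formalMultilinearSeries h2
  have h4 := congrArg (fun p => FormalMultilinearSeries.coeff p k) h3
  simp only [FormalMultilinearSeries.coeff_ofScalars] at h4
  rw [h4, homPart]

/-- `∑ m_k f_k`. -/
noncomputable def homMul (m : ℕ → ℝ) (f : Cn n → ℂ) (z : Cn n) : ℂ :=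
  ∑' k : ℕ, (m k : ℂ) * homPart k f z

theorem fracD_eq_homMul (s : ℝ) (f : Cn n → ℂ) : fracD s f = homMul (fracCoeff n s) f := rfl

/-- At most geometric growth. -/
def GeomBdd (m : ℕ → ℝ) : Prop := ∃ C R : ℝ, 0 ≤ C ∧ 1 ≤ R ∧ ∀ k, |m k| ≤ C * R ^ k

theorem GeomBdd.mul {m m' : ℕ → ℝ} (h : GeomBdd m) (h' : GeomBdd m') : GeomBdd (m * m') := by
  obtain ⟨C, R, hC, hR, hm⟩ := h
  obtain ⟨C', R', hC', hR', hm'⟩ := h'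
  refine ⟨C * C', R * R', by positivity, by nlinarith, fun k => ?_⟩
  rw [Pi.mul_apply, abs_mul, mul_pow]
  calc |m k| * |m' k| ≤ (C * R ^ k) * (C' * R' ^ k) :=
        mul_le_mul (hm k) (hm' k) (abs_nonneg _) (by positivity)
    _ = _ := by ring

theorem GeomBdd.add {m m' : ℕ → ℝ} (h : GeomBdd m) (h' : GeomBdd m') : GeomBdd (m + m') := by
  obtain ⟨C, R, hC, hR, hm⟩ := h
  obtain ⟨C', R', hC', hR', hm'⟩ := h'
  refine ⟨C + C', max R R', by positivity, le_max_of_le_left hR, fun k => ?_⟩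
  rw [Pi.add_apply]
  calc |m k + m' k| ≤ |m k| + |m' k| := abs_add_le _ _
    _ ≤ C * R ^ k + C' * R' ^ k := add_le_add (hm k) (hm' k)
    _ ≤ C * (max R R') ^ k + C' * (max R R') ^ k := by
        gcongr
        · exact le_max_left _ _
        · exact le_max_right _ _
    _ = _ := by ring

theorem geomBdd_of_bdd {m : ℕ → ℝ} {C : ℝ} (h : ∀ k, |m k| ≤ C) : GeomBdd m :=
  ⟨C, 1, (abs_nonneg _).trans (h 0), le_rfl, fun k => by simpa using h k⟩

theorem geomBdd_of_support {m : ℕ → ℝ} {K : ℕ} (h : ∀ k, K ≤ k → m k = 0) : GeomBdd m := by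
  refine geomBdd_of_bdd (C := ∑ j ∈ Finset.range K, |m j|) fun k => ?_
  rcases lt_or_ge k K with hk | hk
  · exact Finset.single_le_sum (f := fun j => |m j|) (fun j _ => abs_nonneg _)
      (Finset.mem_range.2 hk)
  · rw [h k hk, abs_zero]
    exact Finset.sum_nonneg fun j _ => abs_nonneg _

theorem exists_bound_line {f : Cn n → ℂ} (hf : Differentiable ℂ f) (z : Cn n) (R : ℝ) :
    ∃ C, ∀ t : ℂ, ‖t‖ ≤ R → ‖f (t • z)‖ ≤ C := by
  obtain ⟨C, hC⟩ := (isCompact_closedBall (0 : ℂ) R).exists_bound_of_continuousOn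
    (differentiable_line hf z).continuous.continuousOn
  exact ⟨C, fun t ht => hC t (by simpa using ht)⟩

/-- Cauchy's estimate on the circle of radius 2R beats the growth R^k of the multiplier and leaves a
geometric series of ratio 1/2. -/
theorem summable_norm_homMul {m : ℕ → ℝ} (hm : GeomBdd m) {f : Cn n → ℂ}
    (hf : Differentiable ℂ f) (z : Cn n) : Summable fun k => ‖(m k : ℂ) * homPart k f z‖ := by
  obtain ⟨C, R, hC, hR, hm⟩ := hm
  obtain ⟨D, hD⟩ := exists_bound_line hf z (2 * R)
  refine Summable.of_nonneg_of_le (fun k => norm_nonneg _) (fun k => ?_)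
    ((summable_geometric_two).mul_left (C * D))
  have hR0 : 0 < R := by linarith
  have h1 := norm_homPart_le hf k z (R := 2 * R) (by positivity) fun t ht => hD t ht.le
  rw [norm_mul, Complex.norm_real, Real.norm_eq_abs]
  calc |m k| * ‖homPart k f z‖ ≤ (C * R ^ k) * (D / (2 * R) ^ k) :=
        mul_le_mul (hm k) h1 (norm_nonneg _) (by positivity)
    _ = _ := by
        rw [mul_pow, one_div, inv_pow]
        field_simp

theorem hasSum_homMul {m : ℕ → ℝ} (hm : GeomBdd m) {f : Cn n → ℂ}
    (hf : Differentiable ℂ f) (z : Cn n) :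
    HasSum (fun k => (m k : ℂ) * homPart k f z) (homMul m f z) :=
  (summable_norm_homMul hm hf z).of_norm.hasSum

theorem homPart_homMul {m : ℕ → ℝ} (hm : GeomBdd m) {f : Cn n → ℂ}
    (hf : Differentiable ℂ f) (k : ℕ) (z : Cn n) :
    homPart k (homMul m f) z = m k * homPart k f z := by
  refine homPart_eq_of_hasSum (a := fun k => (m k : ℂ) * homPart k f z) (fun t => ?_) k
  have h := hasSum_homMul hm hf (t • z)
  simp only [homPart_smul_arg hf] at h
  convert h using 2
  ring

theorem homPart_eq_circleIntegral {f : Cn n → ℂ} (hf : Differentiable ℂ f) (k : ℕ) (z : Cn n)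
    {R : ℝ} (hR : 0 < R) :
    homPart k f z = (2 * Real.pi)⁻¹ * ∫ θ in (0 : ℝ)..2 * Real.pi,
      (((R : ℂ) * Complex.exp (θ * Complex.I)) ^ k)⁻¹ *
        f (((R : ℂ) * Complex.exp (θ * Complex.I)) • z) := by
  have h := DiffContOnCl.circleIntegral_one_div_sub_center_pow_smul (c := (0 : ℂ)) hR k
    (differentiable_line hf z).diffContOnCl
  have hpi : (Real.pi : ℂ) ≠ 0 := by exact_mod_cast Real.pi_ne_zero
  have h2 : (∮ w in C((0 : ℂ), R), (1 / (w - 0) ^ (k + 1)) • f (w • z)) =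
      Complex.I * ∫ θ in (0 : ℝ)..2 * Real.pi, (((R : ℂ) * Complex.exp (θ * Complex.I)) ^ k)⁻¹ *
        f (((R : ℂ) * Complex.exp (θ * Complex.I)) • z) := by
    rw [circleIntegral, ← intervalIntegral.integral_const_mul]
    refine intervalIntegral.integral_congr fun θ _ => ?_
    have hne : (R : ℂ) * Complex.exp (θ * Complex.I) ≠ 0 :=
      mul_ne_zero (by exact_mod_cast hR.ne') (Complex.exp_ne_zero _)
    simp only [deriv_circleMap, circleMap, zero_add, sub_zero, smul_eq_mul]
    have hR0 : (R : ℂ) ≠ 0 := by exact_mod_cast hR.ne'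
    rw [pow_succ]
    field_simp
  rw [h2] at h
  rw [homPart, ← mul_right_inj' Complex.I_ne_zero, mul_left_comm, h, smul_eq_mul]
  push_cast
  field_simp

/-- The multiplier is a circle average: with |ξ| = R larger than the growth rate of m, the kernel κ
= ∑ m_k ξ^{-k} converges uniformly, and ∑ m_k f_k(z) is the mean of κ f(ξz) over the circle.
Differentiation under the integral then applies. -/
theorem differentiable_homMul {m : ℕ → ℝ} (hm : GeomBdd m) {f : Cn n → ℂ}
    (hf : Differentiable ℂ f) : Differentiable ℂ (homMul m f) := by
  obtain ⟨C, R₀, hC, hR₀, hm'⟩ := id hm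
  set R : ℝ := 2 * R₀ with hRdef
  have hR : 0 < R := by positivity
  set ξ : ℝ → ℂ := fun θ => (R : ℂ) * Complex.exp (θ * Complex.I) with hξ
  have hξc : Continuous ξ := by fun_prop
  have hξn : ∀ θ, ‖ξ θ‖ = R := fun θ => by
    simp [hξ, Complex.norm_exp_ofReal_mul_I, abs_of_pos hR]
  have hterm : ∀ k θ, ‖(m k : ℂ) * (ξ θ ^ k)⁻¹‖ ≤ C * (1 / 2) ^ k := fun k θ => by
    rw [norm_mul, norm_inv, norm_pow, hξn, Complex.norm_real, Real.norm_eq_abs, hRdef,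
      mul_pow]
    calc |m k| * (2 ^ k * R₀ ^ k)⁻¹ ≤ C * R₀ ^ k * (2 ^ k * R₀ ^ k)⁻¹ := by
          gcongr; exact hm' k
      _ = _ := by rw [one_div, inv_pow]; field_simp
  have hsum : Summable fun k : ℕ => C * (1 / 2 : ℝ) ^ k := summable_geometric_two.mul_left C
  have hξ0 : ∀ θ, ξ θ ≠ 0 := fun θ => norm_pos_iff.1 (by rw [hξn]; exact hR)
  set κ : ℝ → ℂ := fun θ => ∑' k, (m k : ℂ) * (ξ θ ^ k)⁻¹ with hκ
  have hκc : Continuous κ := by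
    refine continuous_tsum (fun k => ?_) hsum hterm
    exact continuous_const.mul ((hξc.pow k).inv₀ fun θ => pow_ne_zero _ (hξ0 θ))
  have hrep : homMul m f = fun z => (2 * Real.pi : ℂ)⁻¹ *
      ∫ θ in Set.Ioc 0 (2 * Real.pi), κ θ * f (ξ θ • z) := by
    funext z
    obtain ⟨D, hD⟩ := exists_bound_line hf z R
    have hcont : ∀ k, Continuous fun θ => (m k : ℂ) * (ξ θ ^ k)⁻¹ * f (ξ θ • z) := fun k =>
      (continuous_const.mul ((hξc.pow k).inv₀ fun θ => pow_ne_zero _ (hξ0 θ))).mul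
        (hf.continuous.comp (hξc.smul continuous_const))
    have hb : ∀ k θ, ‖(m k : ℂ) * (ξ θ ^ k)⁻¹ * f (ξ θ • z)‖ ≤ C * (1 / 2) ^ k * D :=
      fun k θ => by
        rw [norm_mul]
        exact mul_le_mul (hterm k θ) (hD _ (hξn θ).le) (norm_nonneg _) (by positivity)
    have h1 := hasSum_integral_of_summable_integral_norm
      (μ := volume.restrict (Set.Ioc 0 (2 * Real.pi)))
      (F := fun k θ => (m k : ℂ) * (ξ θ ^ k)⁻¹ * f (ξ θ • z))
      (fun k => ((hcont k).integrableOn_Ioc)) ?_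
    · have h2 : ∀ θ, ∑' k, (m k : ℂ) * (ξ θ ^ k)⁻¹ * f (ξ θ • z) = κ θ * f (ξ θ • z) :=
        fun θ => tsum_mul_right
      simp only [h2] at h1
      have h3 := h1.mul_left (2 * Real.pi : ℂ)⁻¹
      refine (hasSum_homMul hm hf z).unique ?_
      refine h3.congr_fun fun k => ?_
      rw [homPart_eq_circleIntegral hf k z hR, intervalIntegral.integral_of_le (by positivity),
        mul_left_comm, ← integral_const_mul]
      simp only [mul_assoc, hξ]
      push_cast
      rfl
    · refine Summable.of_nonneg_of_le (fun k => integral_nonneg fun θ => norm_nonneg _)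
        (fun k => ?_) ((hsum.mul_right D).mul_left (2 * Real.pi))
      have h5 := integral_mono_of_nonneg (μ := volume.restrict (Set.Ioc 0 (2 * Real.pi)))
        (.of_forall fun θ => norm_nonneg ((m k : ℂ) * (ξ θ ^ k)⁻¹ * f (ξ θ • z)))
        (integrable_const (C * (1 / 2) ^ k * D)) (.of_forall (hb k))
      refine h5.trans (le_of_eq ?_)
      simp [Real.pi_pos.le]
  rw [hrep]
  refine Differentiable.const_mul ?_ _
  have hbd : ∀ r : ℝ, ∃ D, ∀ θ : ℝ, ∀ w : Cn n, ‖w‖ ≤ r → ‖f (ξ θ • w)‖ ≤ D := fun r => by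
    obtain ⟨D, hD⟩ := (isCompact_closedBall (0 : Cn n) (R * r)).exists_bound_of_continuousOn
      hf.continuous.continuousOn
    refine ⟨D, fun θ w hw => hD _ ?_⟩
    rw [mem_closedBall_zero_iff, norm_smul, hξn]
    gcongr
  choose D hD using hbd
  refine differentiable_integral_of_dominated (e := fun θ z => f (ξ θ • z))
    hκc.aestronglyMeasurable ?_ ?_ (fun r θ => ‖κ θ‖ * D r) ?_ ?_
  · exact hf.continuous.comp ((hξc.comp continuous_fst).smul continuous_snd)
  · exact fun θ => hf.comp (differentiable_id.const_smul (ξ θ))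
  · exact fun r => (hκc.norm.mul continuous_const).integrableOn_Ioc
  · exact fun r θ w hw => mul_le_mul_of_nonneg_left (hD r θ w hw) (norm_nonneg _)

theorem homMul_homMul {m m' : ℕ → ℝ} (hm' : GeomBdd m') {f : Cn n → ℂ}
    (hf : Differentiable ℂ f) : homMul m (homMul m' f) = homMul (m * m') f := by
  funext z
  refine tsum_congr fun k => ?_
  rw [homPart_homMul hm' hf, Pi.mul_apply]
  push_cast
  ring

theorem homMul_one {f : Cn n → ℂ} (hf : Differentiable ℂ f) : homMul 1 f = f := by
  funext z
  simp only [homMul, Pi.one_apply, Complex.ofReal_one, one_mul]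
  exact (hasSum_homPart hf z).tsum_eq

theorem homMul_add_coeff {m m' : ℕ → ℝ} (hm : GeomBdd m) (hm' : GeomBdd m') {f : Cn n → ℂ}
    (hf : Differentiable ℂ f) : homMul (m + m') f = homMul m f + homMul m' f := by
  funext z
  refine HasSum.tsum_eq ?_
  refine ((hasSum_homMul hm hf z).add (hasSum_homMul hm' hf z)).congr_fun fun k => ?_
  simp [add_mul]

theorem homMul_of_support {m : ℕ → ℝ} {K : ℕ} (h : ∀ k, K ≤ k → m k = 0) (f : Cn n → ℂ)
    (z : Cn n) : homMul m f z = ∑ k ∈ Finset.range K, (m k : ℂ) * homPart k f z := by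
  refine tsum_eq_sum fun k hk => ?_
  rw [h k (by simpa using hk)]
  simp

/-- The indicator of the degrees `k ≤ |s|`. -/
noncomputable def lowInd (s : ℝ) (k : ℕ) : ℝ := if k < ⌊|s|⌋₊ + 1 then 1 else 0

theorem lowInd_of_le (s : ℝ) : ∀ k, ⌊|s|⌋₊ + 1 ≤ k → lowInd s k = 0 := fun k hk => by
  rw [lowInd, if_neg (by omega)]

theorem lt_floor_abs_iff (s : ℝ) (k : ℕ) : k < ⌊|s|⌋₊ + 1 ↔ (k : ℝ) ≤ |s| := by
  rw [Nat.lt_succ_iff, Nat.le_floor_iff (abs_nonneg s)]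

theorem geomBdd_lowInd (s : ℝ) : GeomBdd (lowInd s) := geomBdd_of_support (lowInd_of_le s)

theorem geomBdd_one : GeomBdd 1 := geomBdd_of_bdd (C := 1) (by simp)

theorem geomBdd_highInd (s : ℝ) : GeomBdd (1 - lowInd s) := by
  refine geomBdd_of_bdd (C := 1) fun k => ?_
  rw [Pi.sub_apply, Pi.one_apply, lowInd]
  split_ifs <;> simp

theorem lowPart_eq_homMul (s : ℝ) (f : Cn n → ℂ) : lowPart s f = homMul (lowInd s) f := by
  funext z
  rw [homMul_of_support (lowInd_of_le s), lowPart]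
  refine Finset.sum_congr rfl fun k hk => ?_
  rw [lowInd, if_pos (by simpa using hk)]
  simp

theorem highPart_eq_homMul (s : ℝ) {f : Cn n → ℂ} (hf : Differentiable ℂ f) :
    highPart s f = homMul (1 - lowInd s) f := by
  have h := homMul_add_coeff (geomBdd_lowInd s) (geomBdd_highInd s) hf
  rw [add_sub_cancel, homMul_one hf, ← lowPart_eq_homMul] at h
  funext z
  rw [highPart, sub_eq_iff_eq_add']
  exact congrFun h z

theorem homMul_add {m : ℕ → ℝ} (hm : GeomBdd m) {f g : Cn n → ℂ}
    (hf : Differentiable ℂ f) (hg : Differentiable ℂ g) :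
    homMul m (f + g) = homMul m f + homMul m g := by
  funext z
  refine HasSum.tsum_eq ?_
  refine ((hasSum_homMul hm hf z).add (hasSum_homMul hm hg z)).congr_fun fun k => ?_
  rw [homPart_add hf hg]
  ring

theorem homMul_const_smul (m : ℕ → ℝ) (c : ℂ) (f : Cn n → ℂ) :
    homMul m (c • f) = c • homMul m f := by
  funext z
  rw [Pi.smul_apply, homMul, homMul, smul_eq_mul, ← tsum_mul_left]
  refine tsum_congr fun k => ?_
  rw [homPart_smul]
  ring

theorem differentiable_homPart {f : Cn n → ℂ} (hf : Differentiable ℂ f) (k : ℕ) :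
    Differentiable ℂ (homPart k f) := by
  have h : homPart k f = homMul (Pi.single k 1) f := by
    funext z
    refine ((hasSum_single k fun j hj => ?_).tsum_eq.trans ?_).symm
    · simp [hj]
    · simp
  rw [h]
  refine differentiable_homMul (geomBdd_of_support (K := k + 1) fun j hj => ?_) hf
  rw [Pi.single_eq_of_ne (by omega)]

end Homogeneous

/-! ### Elementary inequalities for powers and Gaussians. -/

/-- Peetre's inequality. For b ≥ 0 it is a power of 1+|z| ≤ (1+|w|)(1+|z-w|); for b ≤ 0 the roles of
z and w are exchanged. -/
theorem one_add_rpow_le_mul {E : Type*} [SeminormedAddCommGroup E] (b : ℝ) (z w : E) :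
    (1 + ‖z‖) ^ b ≤ (1 + ‖w‖) ^ b * (1 + ‖z - w‖) ^ |b| := by
  have hz : 0 < 1 + ‖z‖ := by positivity
  have hw : 0 < 1 + ‖w‖ := by positivity
  have hd : 0 < 1 + ‖z - w‖ := by positivity
  have key : ∀ x y : E, 1 + ‖x‖ ≤ (1 + ‖y‖) * (1 + ‖x - y‖) := fun x y => by
    have h1 := norm_sub_norm_le x y
    nlinarith [norm_nonneg y, norm_nonneg (x - y)]
  rcases le_total 0 b with hb | hb
  · rw [abs_of_nonneg hb, ← Real.mul_rpow hw.le hd.le]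
    exact Real.rpow_le_rpow hz.le (key z w) hb
  · rw [abs_of_nonpos hb]
    have h1 := Real.rpow_le_rpow hw.le (key w z) (neg_nonneg.2 hb)
    rw [norm_sub_rev w z, Real.mul_rpow hz.le hd.le, Real.rpow_neg hw.le, Real.rpow_neg hz.le] at h1
    have hzb : 0 < (1 + ‖z‖) ^ b := Real.rpow_pos_of_pos hz b
    have hwb : 0 < (1 + ‖w‖) ^ b := Real.rpow_pos_of_pos hw b
    rw [inv_mul_eq_div, inv_le_iff_one_le_mul₀ hwb, div_mul_eq_mul_div, le_div_iff₀ hzb,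
      one_mul] at h1
    linarith

theorem one_add_rpow_le_exp (a : ℝ) {x : ℝ} (hx : 0 ≤ x) : (1 + x) ^ a ≤ Real.exp (|a| * x) := by
  calc (1 + x) ^ a ≤ (1 + x) ^ |a| :=
        Real.rpow_le_rpow_of_exponent_le (by linarith) (le_abs_self a)
    _ ≤ (Real.exp x) ^ |a| := Real.rpow_le_rpow (by linarith) (by linarith [Real.add_one_le_exp x])
        (abs_nonneg a)
    _ = _ := by rw [← Real.exp_mul, mul_comm]

theorem exists_rpow_mul_exp_le (a L : ℝ) {ε : ℝ} (hε : 0 < ε) :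
    ∃ C : ℝ, 0 < C ∧ ∀ x : ℝ, 0 ≤ x → (1 + x) ^ a * Real.exp (L * x) ≤ C * Real.exp (ε * x ^ 2) := by
  -- The exponent is the maximum of (|a| + L)x - εx².
  refine ⟨Real.exp ((|a| + L) ^ 2 / (4 * ε)), Real.exp_pos _, fun x hx => ?_⟩
  calc (1 + x) ^ a * Real.exp (L * x) ≤ Real.exp (|a| * x) * Real.exp (L * x) := by
        gcongr; exact one_add_rpow_le_exp a hx
    _ ≤ _ := by
        rw [← Real.exp_add, ← Real.exp_add, Real.exp_le_exp]
        have h : (|a| + L) ^ 2 / (4 * ε) + ε * x ^ 2 - (|a| * x + L * x)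
          = (|a| + L - 2 * ε * x) ^ 2 / (4 * ε) := by field_simp; ring
        have h2 : 0 ≤ (|a| + L - 2 * ε * x) ^ 2 / (4 * ε) := by positivity
        linarith

/-! ### Weighted norms and the sub-mean value property for every p > 0. -/

section Weights

variable {n : ℕ}

instance (n : ℕ) : (fockV n).IsAddHaarMeasure :=
  Measure.IsAddHaarMeasure.smul _ (by simp) (by simp [Real.pi_pos])

/-- The weight `e^{-|z|²/2} (1 + |z|)^b`. -/
noncomputable def fockWgt (b : ℝ) (z : Cn n) : ℝ := Real.exp (-‖z‖ ^ 2 / 2) * (1 + ‖z‖) ^ b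

/-- The (quasi-)norm of `f e^{-|z|²/2} (1 + |z|)^b` in `L^p(dV)`. -/
noncomputable def fockN (p : ℝ≥0∞) (b : ℝ) (f : Cn n → ℂ) : ℝ≥0∞ :=
  eLpNorm (fun z => (fockWgt b z : ℂ) * f z) p (fockV n)

theorem fockWgt_pos (b : ℝ) (z : Cn n) : 0 < fockWgt b z := by
  rw [fockWgt]; positivity

theorem continuous_fockWgt (b : ℝ) : Continuous (fockWgt b : Cn n → ℝ) := by
  unfold fockWgt
  refine Continuous.mul (by fun_prop) ?_
  exact (by fun_prop : Continuous fun z : Cn n => 1 + ‖z‖).rpow_const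
    fun z => Or.inl (by positivity)

theorem norm_fockWgt_mul (b : ℝ) (f : Cn n → ℂ) (z : Cn n) :
    ‖(fockWgt b z : ℂ) * f z‖ = fockWgt b z * ‖f z‖ := by
  rw [norm_mul, Complex.norm_real, Real.norm_of_nonneg (fockWgt_pos b z).le]

theorem measurePreserving_rotation {e : ℂ} (he : ‖e‖ = 1) :
    MeasurePreserving (fun z : Cn n => e • z) (fockV n) (fockV n) := by
  let L : Cn n ≃ₗᵢ[ℝ] Cn n :=
    { toLinearEquiv := LinearEquiv.smulOfNeZero ℝ (Cn n) 1 one_ne_zero |>.trans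
        ((LinearEquiv.smulOfNeZero ℂ (Cn n) e (by rintro rfl; simp at he)).restrictScalars ℝ)
      norm_map' := fun z => by simp [norm_smul, he] }
  have h := L.measurePreserving
  have h2 : (L : Cn n → Cn n) = fun z => e • z := by funext z; simp [L]
  rw [h2] at h
  exact h.smul_measure _

/-- `|g(0)|^p` is at most the mean of `|g|^p` over the unit circle. -/
theorem norm_rpow_le_circleAverage {g : ℂ → ℂ} (hg : Differentiable ℂ g) {p : ℝ} (hp : 0 < p) :
    ‖g 0‖ ^ p ≤ Real.circleAverage (fun t => ‖g t‖ ^ p) 0 1 := by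
  -- Rescaling g makes |g(0)| large. This is needed because `Real.log 0 = 0`: the tangent-line
  -- inequality below must also hold at zeros of g.
  wlog hbig : 1 ≤ p * Real.log ‖g 0‖ generalizing g with H
  · rcases eq_or_ne (g 0) 0 with h0 | h0
    · rw [h0, norm_zero, Real.zero_rpow hp.ne']
      exact Real.circleAverage_nonneg_of_nonneg fun t _ => by positivity
    · set c : ℝ := Real.exp (1 / p) / ‖g 0‖ with hc
      have hc0 : 0 < c := by positivity
      have h1 := H (g := fun t => (c : ℂ) * g t) (hg.const_mul _) (by
        rw [norm_mul, Complex.norm_real, Real.norm_of_nonneg hc0.le, hc,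
          div_mul_cancel₀ _ (norm_ne_zero_iff.2 h0), Real.log_exp, mul_one_div_cancel hp.ne'])
      have h2 : ∀ t, ‖(c : ℂ) * g t‖ ^ p = c ^ p • ‖g t‖ ^ p := fun t => by
        rw [norm_mul, Complex.norm_real, Real.norm_of_nonneg hc0.le,
          Real.mul_rpow hc0.le (norm_nonneg _), smul_eq_mul]
      simp only [h2] at h1
      rw [Real.circleAverage_fun_smul, smul_eq_mul, smul_eq_mul] at h1
      exact le_of_mul_le_mul_left h1 (by positivity)
  have h0 : g 0 ≠ 0 := by
    intro h; rw [h] at hbig; norm_num at hbig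
  have han : AnalyticOnNhd ℂ g (Metric.closedBall 0 |(1 : ℝ)|) := fun z _ => hg.analyticAt z
  -- Jensen's formula: the zeros of g in the disc contribute nonnegative terms.
  have hlog : Real.log ‖g 0‖ ≤ Real.circleAverage (Real.log ‖g ·‖) 0 1 := by
    rw [han.circleAverage_log_norm one_ne_zero h0]
    refine le_add_of_nonneg_left (finsum_nonneg fun u => ?_)
    have hnn := MeromorphicOn.AnalyticOnNhd.divisor_nonneg han u
    by_cases hu : u ∈ Metric.closedBall (0 : ℂ) |(1 : ℝ)|
    · refine mul_nonneg (by exact_mod_cast hnn) ?_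
      rw [one_mul, zero_sub, norm_neg]
      rcases eq_or_ne u 0 with rfl | hu0
      · simp
      · refine Real.log_nonneg ((one_le_inv₀ (norm_pos_iff.2 hu0)).2 ?_)
        simpa using hu
    · rw [Function.locallyFinsuppWithin.apply_eq_zero_of_notMem _ hu]
      simp
  have hint : CircleIntegrable (Real.log ‖g ·‖) 0 1 :=
    MeromorphicOn.circleIntegrable_log_norm fun z _ => (hg.analyticAt z).meromorphicAt
  have hcont : Continuous fun t => ‖g t‖ ^ p :=
    hg.continuous.norm.rpow_const fun _ => Or.inr hp.le
  have hpos : 0 < ‖g 0‖ := norm_pos_iff.2 h0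
  set y := ‖g 0‖ with hy
  -- x^p is convex in log x, so it lies above its tangent at x = y. At x = 0 the left side is
  -- nonpositive by `hbig`.
  have hpt : ∀ x : ℝ, 0 ≤ x → y ^ p * (1 - p * Real.log y) + (y ^ p * p) * Real.log x ≤ x ^ p := by
    intro x hx
    have hyp : 0 < y ^ p := by positivity
    rcases hx.eq_or_lt with rfl | hx
    · rw [Real.log_zero, Real.zero_rpow hp.ne', mul_zero, add_zero]
      nlinarith
    · have h1 := Real.add_one_le_exp (p * (Real.log x - Real.log y))
      have h2 : x ^ p = y ^ p * Real.exp (p * (Real.log x - Real.log y)) := by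
        rw [Real.rpow_def_of_pos hx, Real.rpow_def_of_pos hpos, ← Real.exp_add]
        ring_nf
      rw [h2]
      nlinarith [mul_le_mul_of_nonneg_left h1 hyp.le]
  have hint2 : CircleIntegrable (fun t => y ^ p * (1 - p * Real.log y)
      + (y ^ p * p) * Real.log ‖g t‖) 0 1 :=
    (circleIntegrable_const _ 0 1).add (hint.const_smul (a := y ^ p * p))
  have h3 := Real.circleAverage_mono hint2 (hcont.continuousOn.circleIntegrable zero_le_one)
    fun t _ => hpt ‖g t‖ (norm_nonneg _)
  refine le_trans ?_ h3
  have h4 : Real.circleAverage (fun t => y ^ p * (1 - p * Real.log y)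
      + (y ^ p * p) * Real.log ‖g t‖) 0 1
      = y ^ p * (1 - p * Real.log y) + (y ^ p * p) * Real.circleAverage (Real.log ‖g ·‖) 0 1 := by
    have := Real.circleAverage_fun_add (circleIntegrable_const (y ^ p * (1 - p * Real.log y)) 0 1)
      (hint.const_smul (a := y ^ p * p))
    rw [Real.circleAverage_const, Real.circleAverage_smul, smul_eq_mul] at this
    exact this
  rw [h4]
  have hyp : 0 < y ^ p := by positivity
  nlinarith [mul_le_mul_of_nonneg_left hlog (mul_pos hyp hp).le]

theorem enorm_rpow_le_lintegral_circle {g : ℂ → ℂ} (hg : Differentiable ℂ g) {p : ℝ}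
    (hp : 0 < p) :
    ENNReal.ofReal (2 * Real.pi) * ‖g 0‖ₑ ^ p ≤
      ∫⁻ θ in Set.Ioc 0 (2 * Real.pi), ‖g (Complex.exp (θ * Complex.I))‖ₑ ^ p := by
  have hcont : Continuous fun θ : ℝ => ‖g (Complex.exp (θ * Complex.I))‖ ^ p :=
    (hg.continuous.comp (by fun_prop)).norm.rpow_const fun _ => Or.inr hp.le
  have h := norm_rpow_le_circleAverage hg hp
  rw [Real.circleAverage, intervalIntegral.integral_of_le (by positivity), smul_eq_mul,
    inv_mul_eq_div, le_div_iff₀ (by positivity)] at h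
  simp only [circleMap, zero_add, Complex.ofReal_one, one_mul] at h
  have h2 : ∀ x : ℂ, ‖x‖ₑ ^ p = ENNReal.ofReal (‖x‖ ^ p) := fun x => by
    rw [← ENNReal.ofReal_rpow_of_nonneg (norm_nonneg _) hp.le, ofReal_norm]
  simp only [h2]
  rw [← ofReal_integral_eq_lintegral_ofReal hcont.integrableOn_Ioc
    (.of_forall fun _ => by positivity), ← ENNReal.ofReal_mul (by positivity)]
  exact ENNReal.ofReal_le_ofReal (by linarith)

/-- The circle inequality on each slice t ↦ F(tu), integrated over u in the ball; the ball and the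
measure are invariant under u ↦ e^{iθ}u, so Tonelli removes the average over θ. -/
theorem enorm_rpow_mul_measure_ball_le {F : Cn n → ℂ} (hF : Differentiable ℂ F) {p : ℝ}
    (hp : 0 < p) :
    ‖F 0‖ₑ ^ p * fockV n (Metric.ball 0 1) ≤ ∫⁻ u in Metric.ball 0 1, ‖F u‖ₑ ^ p ∂(fockV n) := by
  set B : Set (Cn n) := Metric.ball 0 1
  have hrot : ∀ θ : ℝ, ∫⁻ u in B, ‖F (Complex.exp (θ * Complex.I) • u)‖ₑ ^ p ∂(fockV n)
      = ∫⁻ u in B, ‖F u‖ₑ ^ p ∂(fockV n) := fun θ => by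
    have he : ‖Complex.exp (θ * Complex.I)‖ = 1 := Complex.norm_exp_ofReal_mul_I θ
    have hpre : (fun z : Cn n => Complex.exp (θ * Complex.I) • z) ⁻¹' B = B := by
      ext z; simp [B, norm_smul, he]
    have h := (measurePreserving_rotation (n := n) he).setLIntegral_comp_preimage
      (s := B) measurableSet_ball (f := fun u => ‖F u‖ₑ ^ p)
      (by have := hF.continuous.measurable; fun_prop)
    rwa [hpre] at h
  have hpi : ENNReal.ofReal (2 * Real.pi) ≠ 0 := by simp [Real.pi_pos]
  have hpi' : ENNReal.ofReal (2 * Real.pi) ≠ ∞ := ENNReal.ofReal_ne_top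
  rw [← ENNReal.mul_le_mul_iff_right hpi hpi']
  calc ENNReal.ofReal (2 * Real.pi) * (‖F 0‖ₑ ^ p * fockV n B)
      = ∫⁻ u in B, ENNReal.ofReal (2 * Real.pi) * ‖F 0‖ₑ ^ p ∂(fockV n) := by
        rw [setLIntegral_const, mul_assoc]
    _ ≤ ∫⁻ u in B, (∫⁻ θ in Set.Ioc (0 : ℝ) (2 * Real.pi),
          ‖F (Complex.exp (θ * Complex.I) • u)‖ₑ ^ p) ∂(fockV n) := by
        refine lintegral_mono fun u => ?_
        have := enorm_rpow_le_lintegral_circle (differentiable_line hF u) hp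
        simpa using this
    _ = ∫⁻ θ in Set.Ioc (0 : ℝ) (2 * Real.pi), ∫⁻ u in B,
          ‖F (Complex.exp (θ * Complex.I) • u)‖ₑ ^ p ∂(fockV n) := by
        refine lintegral_lintegral_swap ?_
        have hc : Continuous fun x : Cn n × ℝ => F (Complex.exp (x.2 * Complex.I) • x.1) :=
          hF.continuous.comp (by fun_prop)
        exact (hc.enorm.measurable.pow_const p).aemeasurable
    _ = _ := by
        simp only [hrot]
        rw [setLIntegral_const, Real.volume_Ioc, sub_zero, mul_comm]

/-- Sub-mean value property for weighted entire functions, for every exponent `p > 0`. -/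
theorem exists_submean (n : ℕ) (b : ℝ) {p : ℝ} (hp : 0 < p) : ∃ C : ℝ≥0∞, C ≠ ∞ ∧
    ∀ f : Cn n → ℂ, Differentiable ℂ f → ∀ z, ‖(fockWgt b z : ℂ) * f z‖ₑ ^ p ≤
      C * ∫⁻ w in Metric.ball z 1, ‖(fockWgt b w : ℂ) * f w‖ₑ ^ p ∂(fockV n) := by
  set B : Set (Cn n) := Metric.ball 0 1
  have hB0 : fockV n B ≠ 0 := (Metric.measure_ball_pos _ _ one_pos).ne'
  have hBt : fockV n B ≠ ∞ := measure_ball_lt_top.ne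
  set D : ℝ := Real.exp (1 / 2) * 2 ^ |b|
  refine ⟨ENNReal.ofReal D ^ p / fockV n B, ENNReal.div_ne_top
    (ENNReal.rpow_ne_top_of_nonneg hp.le ENNReal.ofReal_ne_top) hB0, fun f hf z => ?_⟩
  -- The holomorphic factor e^{-⟨z,u⟩} has modulus e^{-Re⟨z,u⟩}, the cross term of |z+u|². So |F(u)|
  -- is, up to a constant on the unit ball, at most the weighted modulus of f at z+u, and F(0) is
  -- the weighted value at z.
  set F : Cn n → ℂ := fun u => (fockWgt b z : ℂ) * (Complex.exp (-inner ℂ z u) * f (z + u)) with hFdef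
  have hF : Differentiable ℂ F := by
    refine Differentiable.const_mul (Differentiable.mul ?_ ?_) _
    · exact (Differentiable.cexp ((innerSL ℂ z).differentiable.neg))
    · exact hf.comp (differentiable_id.const_add z)
  have hF0 : F 0 = (fockWgt b z : ℂ) * f z := by simp [hFdef]
  have hle : ∀ u ∈ B, ‖F u‖ₑ ≤ ENNReal.ofReal D * ‖(fockWgt b (z + u) : ℂ) * f (z + u)‖ₑ := by
    intro u hu
    have hu1 : ‖u‖ < 1 := by simpa [B] using hu
    rw [← ofReal_norm, ← ofReal_norm, ← ENNReal.ofReal_mul (by positivity)]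
    refine ENNReal.ofReal_le_ofReal ?_
    rw [norm_fockWgt_mul, hFdef]
    simp only
    rw [norm_mul, norm_mul, Complex.norm_real, Real.norm_of_nonneg (fockWgt_pos b z).le,
      Complex.norm_exp, ← mul_assoc, ← mul_assoc]
    refine mul_le_mul_of_nonneg_right ?_ (norm_nonneg _)
    have h1 : ‖z + u‖ ^ 2 = ‖z‖ ^ 2 + 2 * (inner ℂ z u).re + ‖u‖ ^ 2 :=
      norm_add_sq (𝕜 := ℂ) z u
    have h2 := one_add_rpow_le_mul b z (z + u)
    have h3 : (1 + ‖z - (z + u)‖) ^ |b| ≤ 2 ^ |b| := by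
      refine Real.rpow_le_rpow (by positivity) ?_ (abs_nonneg b)
      rw [sub_add_cancel_left, norm_neg]; linarith
    rw [fockWgt, fockWgt, Complex.neg_re]
    have h4 : Real.exp (-‖z‖ ^ 2 / 2) * Real.exp (-(inner ℂ z u).re)
        ≤ Real.exp (1 / 2) * Real.exp (-‖z + u‖ ^ 2 / 2) := by
      rw [← Real.exp_add, ← Real.exp_add, Real.exp_le_exp, h1]
      nlinarith [norm_nonneg u]
    calc Real.exp (-‖z‖ ^ 2 / 2) * (1 + ‖z‖) ^ b * Real.exp (-(inner ℂ z u).re)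
        = (Real.exp (-‖z‖ ^ 2 / 2) * Real.exp (-(inner ℂ z u).re)) * (1 + ‖z‖) ^ b := by ring
      _ ≤ (Real.exp (1 / 2) * Real.exp (-‖z + u‖ ^ 2 / 2)) * ((1 + ‖z + u‖) ^ b * 2 ^ |b|) := by
          gcongr
          exact h2.trans (by gcongr)
      _ = _ := by ring
  have hmain := enorm_rpow_mul_measure_ball_le hF hp
  rw [hF0] at hmain
  rw [ENNReal.div_eq_inv_mul, mul_assoc, ← ENNReal.mul_le_iff_le_inv hB0 hBt, mul_comm]
  refine hmain.trans ?_
  have hcf : Continuous fun w => (fockWgt b w : ℂ) * f w :=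
    (Complex.continuous_ofReal.comp (continuous_fockWgt b)).mul hf.continuous
  calc ∫⁻ u in B, ‖F u‖ₑ ^ p ∂(fockV n)
      ≤ ∫⁻ u in B, ENNReal.ofReal D ^ p * ‖(fockWgt b (z + u) : ℂ) * f (z + u)‖ₑ ^ p ∂(fockV n) := by
        refine setLIntegral_mono' measurableSet_ball fun u hu => ?_
        rw [← ENNReal.mul_rpow_of_nonneg _ _ hp.le]
        exact ENNReal.rpow_le_rpow (hle u hu) hp.le
    _ = ENNReal.ofReal D ^ p * ∫⁻ u in B, ‖(fockWgt b (z + u) : ℂ) * f (z + u)‖ₑ ^ p ∂(fockV n) :=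
        lintegral_const_mul' _ _ (ENNReal.rpow_ne_top_of_nonneg hp.le ENNReal.ofReal_ne_top)
    _ = _ := by
        congr 1
        have hpre : (fun u => z + u) ⁻¹' Metric.ball z 1 = B := by
          ext u; simp [B]
        rw [← hpre]
        exact (measurePreserving_add_left (fockV n) z).setLIntegral_comp_preimage
          measurableSet_ball (hcf.enorm.measurable.pow_const p)

theorem lintegral_exp_neg_norm_ne_top (n : ℕ) {p : ℝ} (hp : 0 < p) :
    ∫⁻ w : Cn n, ENNReal.ofReal (Real.exp (-p * ‖w‖)) ∂(fockV n) ≠ ∞ := by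
  set r : ℝ := Module.finrank ℝ (Cn n) + 1 with hr
  have hr0 : 0 < r := by positivity
  have hint : Integrable (fun w : Cn n => (1 + ‖w‖) ^ (-r)) (fockV n) :=
    integrable_one_add_norm (by rw [hr]; linarith)
  set c : ℝ := min 1 (p / r)
  have hc : 0 < c := by positivity
  have hle : ∀ w : Cn n, Real.exp (-p * ‖w‖) ≤ (c ^ (-r)) * (1 + ‖w‖) ^ (-r) := fun w => by
    have h1 : c * (1 + ‖w‖) ≤ Real.exp (p / r * ‖w‖) := by
      have := Real.add_one_le_exp (p / r * ‖w‖)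
      have h2 : c ≤ 1 := min_le_left _ _
      have h3 : c ≤ p / r := min_le_right _ _
      nlinarith [norm_nonneg w]
    rw [← Real.mul_rpow hc.le (by positivity), Real.rpow_neg (by positivity), neg_mul,
      Real.exp_neg]
    refine inv_anti₀ (by positivity) ?_
    calc (c * (1 + ‖w‖)) ^ r ≤ (Real.exp (p / r * ‖w‖)) ^ r :=
          Real.rpow_le_rpow (by positivity) h1 hr0.le
      _ = _ := by rw [← Real.exp_mul]; congr 1; field_simp
  have h2 : Integrable (fun w : Cn n => Real.exp (-p * ‖w‖)) (fockV n) :=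
    (hint.const_mul (c ^ (-r))).mono' (by fun_prop) (.of_forall fun w => by
      rw [Real.norm_of_nonneg (Real.exp_pos _).le]; exact hle w)
  exact h2.lintegral_lt_top.ne

/-- The smoothed `p`-th power `∫ e^{-p|z-w|} |f(w) e^{-|w|²/2} (1+|w|)^b|^p dV(w)`. -/
noncomputable def fockSmooth (p b : ℝ) (f : Cn n → ℂ) (z : Cn n) : ℝ≥0∞ :=
  ∫⁻ w, ENNReal.ofReal (Real.exp (-p * ‖z - w‖)) * ‖(fockWgt b w : ℂ) * f w‖ₑ ^ p ∂(fockV n)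

theorem lintegral_fockSmooth {p b : ℝ} {f : Cn n → ℂ} (hf : Continuous f) :
    ∫⁻ z, fockSmooth p b f z ∂(fockV n) =
      (∫⁻ w : Cn n, ENNReal.ofReal (Real.exp (-p * ‖w‖)) ∂(fockV n)) *
        ∫⁻ w, ‖(fockWgt b w : ℂ) * f w‖ₑ ^ p ∂(fockV n) := by
  have hcf : Continuous fun w => (fockWgt b w : ℂ) * f w :=
    (Complex.continuous_ofReal.comp (continuous_fockWgt b)).mul hf
  have hm : Measurable fun w => ‖(fockWgt b w : ℂ) * f w‖ₑ ^ p := hcf.enorm.measurable.pow_const p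
  have hm2 : Measurable fun x : Cn n × Cn n => ENNReal.ofReal (Real.exp (-p * ‖x.1 - x.2‖)) := by
    fun_prop
  unfold fockSmooth
  rw [lintegral_lintegral_swap ((hm2.mul (hm.comp measurable_snd)).aemeasurable)]
  have h : ∀ w, ∫⁻ z, ENNReal.ofReal (Real.exp (-p * ‖z - w‖)) * ‖(fockWgt b w : ℂ) * f w‖ₑ ^ p
      ∂(fockV n) = (∫⁻ w : Cn n, ENNReal.ofReal (Real.exp (-p * ‖w‖)) ∂(fockV n)) *
        ‖(fockWgt b w : ℂ) * f w‖ₑ ^ p := fun w => by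
    rw [lintegral_mul_const _ (by fun_prop)]
    congr 1
    exact lintegral_sub_right_eq_self (fun u : Cn n => ENNReal.ofReal (Real.exp (-p * ‖u‖))) w
  simp only [h]
  rw [lintegral_const_mul _ hm]

/-- On the unit ball about w the smoothing kernel e^{-p|z-u|} is at least e^{-p}e^{-p|z-w|}, so the
sub-mean value integral at w is controlled by the smoothed function at z. After taking p-th roots,
the loss is exactly e^{|z-w|}. -/
theorem exists_le_fockSmooth (n : ℕ) (b : ℝ) {p : ℝ} (hp : 0 < p) : ∃ C : ℝ≥0∞, C ≠ ∞ ∧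
    ∀ f : Cn n → ℂ, Differentiable ℂ f → ∀ z w, ‖(fockWgt b w : ℂ) * f w‖ₑ ^ p ≤
      ENNReal.ofReal (Real.exp (p * ‖z - w‖)) * (C * fockSmooth p b f z) := by
  obtain ⟨C, hC, h⟩ := exists_submean n b hp
  refine ⟨C * ENNReal.ofReal (Real.exp p), ENNReal.mul_ne_top hC ENNReal.ofReal_ne_top,
    fun f hf z w => (h f hf w).trans ?_⟩
  have hcf : Continuous fun w => (fockWgt b w : ℂ) * f w :=
    (Complex.continuous_ofReal.comp (continuous_fockWgt b)).mul hf.continuous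
  have key : ∫⁻ u in Metric.ball w 1, ‖(fockWgt b u : ℂ) * f u‖ₑ ^ p ∂(fockV n) ≤
      ENNReal.ofReal (Real.exp (p * ‖z - w‖) * Real.exp p) * fockSmooth p b f z := by
    rw [fockSmooth, ← lintegral_const_mul' _ _ ENNReal.ofReal_ne_top]
    refine le_trans (setLIntegral_mono' measurableSet_ball fun u hu => ?_)
      (setLIntegral_le_lintegral (Metric.ball w 1) _)
    rw [← mul_assoc, ← ENNReal.ofReal_mul (by positivity), ← Real.exp_add, ← Real.exp_add]
    refine le_mul_of_one_le_left (by positivity) ?_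
    rw [ENNReal.one_le_ofReal, Real.one_le_exp_iff]
    have h1 : ‖w - u‖ < 1 := by
      rw [← dist_eq_norm, dist_comm]; simpa using hu
    have h2 : ‖z - u‖ ≤ ‖z - w‖ + ‖w - u‖ := norm_sub_le_norm_sub_add_norm_sub z w u
    nlinarith
  calc _ ≤ C * (ENNReal.ofReal (Real.exp (p * ‖z - w‖) * Real.exp p) * fockSmooth p b f z) := by
        gcongr
    _ = _ := by rw [ENNReal.ofReal_mul (by positivity)]; ring

end Weights

/-! ### From localized sup estimates to L^p estimates. -/

section Dom

variable {n : ℕ}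

theorem continuous_fockWgt_mul (b : ℝ) {f : Cn n → ℂ} (hf : Continuous f) :
    Continuous fun z => (fockWgt b z : ℂ) * f z :=
  (Complex.continuous_ofReal.comp (continuous_fockWgt b)).mul hf

theorem fockN_rpow {p : ℝ} (hp : 0 < p) (b : ℝ) (f : Cn n → ℂ) :
    fockN (ENNReal.ofReal p) b f ^ p = ∫⁻ z, ‖(fockWgt b z : ℂ) * f z‖ₑ ^ p ∂(fockV n) := by
  rw [fockN, eLpNorm_eq_lintegral_rpow_enorm_toReal (by simpa using hp) ENNReal.ofReal_ne_top,
    ENNReal.toReal_ofReal hp.le, ← ENNReal.rpow_mul, one_div, inv_mul_cancel₀ hp.ne',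
    ENNReal.rpow_one]

/-- A set of full measure is dense, so for continuous functions the essential supremum is attained
as a pointwise bound. -/
theorem fockWgt_mul_le_of_fockN_top (b : ℝ) {f : Cn n → ℂ} (hf : Continuous f) (z : Cn n) :
    ‖(fockWgt b z : ℂ) * f z‖ₑ ≤ fockN ∞ b f := by
  have hae : ∀ᵐ z ∂(fockV n), ‖(fockWgt b z : ℂ) * f z‖ₑ ≤ fockN ∞ b f := by
    rw [fockN, eLpNorm_exponent_top]
    exact ae_le_eLpNormEssSup
  have hd := Measure.dense_of_ae hae
  have hcl : IsClosed {z | ‖(fockWgt b z : ℂ) * f z‖ₑ ≤ fockN ∞ b f} :=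
    isClosed_le (continuous_fockWgt_mul b hf).enorm continuous_const
  have := hd.closure_eq
  rw [hcl.closure_eq] at this
  exact (Set.ext_iff.1 this z).2 (Set.mem_univ z)

/-- For finite p, a constant times the p-th root of `fockSmooth` at z is an admissible A at z, by
`exists_le_fockSmooth`. Hence |h|^p is pointwise at most a multiple of `fockSmooth`, whose integral
is a multiple of ‖f‖^p. No convexity enters, so p < 1 is covered. -/
theorem exists_fockN_le_of_dom (n : ℕ) {p : ℝ≥0∞} (hp : p ≠ 0) (b b' : ℝ) {C : ℝ} (hC : 0 ≤ C) :
    ∃ K : ℝ≥0∞, K ≠ ∞ ∧ ∀ f h : Cn n → ℂ, Differentiable ℂ f →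
      (∀ z A, 0 ≤ A → (∀ w, fockWgt b w * ‖f w‖ ≤ A * Real.exp ‖z - w‖) →
        fockWgt b' z * ‖h z‖ ≤ C * A) → fockN p b' h ≤ K * fockN p b f := by
  induction p with
  | top =>
    -- C + 1 instead of C keeps the constant nonzero, so that its product with an infinite norm is
    -- ∞.
    refine ⟨ENNReal.ofReal (C + 1), ENNReal.ofReal_ne_top, fun f h hf hdom => ?_⟩
    by_cases hN : fockN ∞ b f = ∞
    · rw [hN, ENNReal.mul_top (by simp; linarith)]
      exact le_top
    · have hle : ∀ z, fockWgt b' z * ‖h z‖ ≤ C * (fockN ∞ b f).toReal := fun z => by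
        refine hdom z _ ENNReal.toReal_nonneg fun w => ?_
        have h1 := fockWgt_mul_le_of_fockN_top b hf.continuous w
        rw [← ofReal_norm, norm_fockWgt_mul, ← ENNReal.ofReal_toReal hN,
          ENNReal.ofReal_le_ofReal_iff ENNReal.toReal_nonneg] at h1
        exact h1.trans (le_mul_of_one_le_right ENNReal.toReal_nonneg
          (Real.one_le_exp (norm_nonneg _)))
      rw [fockN, eLpNorm_exponent_top]
      refine eLpNormEssSup_le_of_ae_enorm_bound (.of_forall fun z => ?_)
      rw [← ofReal_norm, norm_fockWgt_mul]
      conv_rhs => rw [← ENNReal.ofReal_toReal hN]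
      rw [← ENNReal.ofReal_mul (by linarith)]
      refine ENNReal.ofReal_le_ofReal ((hle z).trans ?_)
      gcongr
      linarith
  | coe p =>
    have hp0 : 0 < (p : ℝ) := by
      have : p ≠ 0 := by simpa using hp
      positivity
    have hpe : (p : ℝ≥0∞) = ENNReal.ofReal (p : ℝ) := by simp
    rw [hpe]
    obtain ⟨C₁, hC₁, h₁⟩ := exists_le_fockSmooth n b hp0
    set E := ∫⁻ w : Cn n, ENNReal.ofReal (Real.exp (-p * ‖w‖)) ∂(fockV n) with hE
    have hEt : E ≠ ∞ := lintegral_exp_neg_norm_ne_top n hp0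
    set K₀ := ENNReal.ofReal (C + 1) ^ (p : ℝ) * (C₁ + 1) with hK₀
    have hK₀t : K₀ ≠ ∞ := ENNReal.mul_ne_top
      (ENNReal.rpow_ne_top_of_nonneg hp0.le ENNReal.ofReal_ne_top) (by simpa using hC₁)
    have hK₀0 : K₀ ≠ 0 := by
      have h1 : ENNReal.ofReal (C + 1) ≠ 0 := by simp; linarith
      refine mul_ne_zero ?_ (by simp)
      simp [ENNReal.rpow_eq_zero_iff, hp0, hp0.not_gt]
      linarith
    refine ⟨(K₀ * E) ^ (1 / (p : ℝ)), ENNReal.rpow_ne_top_of_nonneg (by positivity)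
      (ENNReal.mul_ne_top hK₀t hEt), fun f h hf hdom => ?_⟩
    have hpt : ∀ z, ‖(fockWgt b' z : ℂ) * h z‖ₑ ^ (p : ℝ) ≤ K₀ * fockSmooth p b f z := fun z => by
      by_cases hz : fockSmooth p b f z = ∞
      · rw [hz, ENNReal.mul_top hK₀0]; exact le_top
      set I := (C₁ + 1) * fockSmooth p b f z with hI
      have hIt : I ≠ ∞ := ENNReal.mul_ne_top (by simpa using hC₁) hz
      set A := (I ^ (1 / (p : ℝ))).toReal with hA
      have hAt : I ^ (1 / (p : ℝ)) ≠ ∞ := ENNReal.rpow_ne_top_of_nonneg (by positivity) hIt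
      have hAI : ENNReal.ofReal A ^ (p : ℝ) = I := by
        rw [hA, ENNReal.ofReal_toReal hAt, ← ENNReal.rpow_mul, one_div, inv_mul_cancel₀ hp0.ne',
          ENNReal.rpow_one]
      have h2 := hdom z A ENNReal.toReal_nonneg fun w => by
        have h3 := h₁ f hf z w
        have h4 : ‖(fockWgt b w : ℂ) * f w‖ₑ ^ (p : ℝ) ≤
            ENNReal.ofReal (A * Real.exp ‖z - w‖) ^ (p : ℝ) := by
          refine h3.trans ?_
          rw [ENNReal.ofReal_mul ENNReal.toReal_nonneg, ENNReal.mul_rpow_of_nonneg _ _ hp0.le, hAI,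
            ENNReal.ofReal_rpow_of_nonneg (Real.exp_pos _).le hp0.le, ← Real.exp_mul,
            mul_comm ‖z - w‖, mul_comm I]
          exact mul_le_mul_right (mul_le_mul_left (le_self_add : C₁ ≤ C₁ + 1) _) _
        rw [ENNReal.rpow_le_rpow_iff hp0, ← ofReal_norm, norm_fockWgt_mul,
          ENNReal.ofReal_le_ofReal_iff (mul_nonneg ENNReal.toReal_nonneg (Real.exp_pos _).le)] at h4
        exact h4
      have h5 : ‖(fockWgt b' z : ℂ) * h z‖ₑ ≤ ENNReal.ofReal ((C + 1) * A) := by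
        rw [← ofReal_norm, norm_fockWgt_mul]
        refine ENNReal.ofReal_le_ofReal (h2.trans ?_)
        have : 0 ≤ A := ENNReal.toReal_nonneg
        nlinarith
      calc _ ≤ ENNReal.ofReal ((C + 1) * A) ^ (p : ℝ) := ENNReal.rpow_le_rpow h5 hp0.le
        _ = _ := by
          rw [ENNReal.ofReal_mul (by linarith), ENNReal.mul_rpow_of_nonneg _ _ hp0.le, hAI, hI,
            hK₀, mul_assoc]
    rw [← ENNReal.rpow_le_rpow_iff hp0, ENNReal.mul_rpow_of_nonneg _ _ hp0.le, fockN_rpow hp0,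
      fockN_rpow hp0, ← ENNReal.rpow_mul, one_div, inv_mul_cancel₀ hp0.ne', ENNReal.rpow_one,
      mul_assoc, hE, ← lintegral_fockSmooth hf.continuous, ← lintegral_const_mul' _ _ hK₀t]
    exact lintegral_mono hpt

/-- Weighted entire functions are bounded pointwise by their `L^p` norm. -/
theorem exists_enorm_fockWgt_mul_le (n : ℕ) {p : ℝ≥0∞} (hp : p ≠ 0) (b : ℝ) :
    ∃ C : ℝ≥0∞, C ≠ ∞ ∧ ∀ f : Cn n → ℂ, Differentiable ℂ f → ∀ z,
      ‖(fockWgt b z : ℂ) * f z‖ₑ ≤ C * fockN p b f := by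
  induction p with
  | top => exact ⟨1, by simp, fun f hf z => by
      rw [one_mul]; exact fockWgt_mul_le_of_fockN_top b hf.continuous z⟩
  | coe p =>
    have hp0 : 0 < (p : ℝ) := by
      have : p ≠ 0 := by simpa using hp
      positivity
    have hpe : (p : ℝ≥0∞) = ENNReal.ofReal (p : ℝ) := by simp
    rw [hpe]
    obtain ⟨C₁, hC₁, h₁⟩ := exists_submean n b hp0
    refine ⟨C₁ ^ (1 / (p : ℝ)), ENNReal.rpow_ne_top_of_nonneg (by positivity) hC₁,
      fun f hf z => ?_⟩
    rw [← ENNReal.rpow_le_rpow_iff hp0, ENNReal.mul_rpow_of_nonneg _ _ hp0.le, fockN_rpow hp0,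
      ← ENNReal.rpow_mul, one_div, inv_mul_cancel₀ hp0.ne', ENNReal.rpow_one]
    exact (h₁ f hf z).trans (mul_le_mul_right (setLIntegral_le_lintegral _ _) _)

theorem exists_fockWgt_mul_le (n : ℕ) {p : ℝ≥0∞} (hp : p ≠ 0) (b : ℝ) :
    ∃ C : ℝ, 0 ≤ C ∧ ∀ f : Cn n → ℂ, Differentiable ℂ f → fockN p b f ≠ ∞ → ∀ z,
      fockWgt b z * ‖f z‖ ≤ C * (fockN p b f).toReal := by
  obtain ⟨C, hC, h⟩ := exists_enorm_fockWgt_mul_le n hp b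
  refine ⟨C.toReal, ENNReal.toReal_nonneg, fun f hf hN z => ?_⟩
  have h1 := ENNReal.toReal_mono (ENNReal.mul_ne_top hC hN) (h f hf z)
  rwa [toReal_enorm, norm_fockWgt_mul, ENNReal.toReal_mul] at h1

/-! ### Multipliers and their orders. -/

/-- `m` is a multiplier of order `s`: `f ↦ ∑ m_k f_k` maps the weight exponent `b` to `b - 2s`,
with an exponentially localized sup-norm estimate. -/
def MulOrd (n : ℕ) (m : ℕ → ℝ) (s : ℝ) : Prop :=
  GeomBdd m ∧ ∀ b : ℝ, ∃ C : ℝ, 0 ≤ C ∧ ∀ f : Cn n → ℂ, Differentiable ℂ f → ∀ z A, 0 ≤ A →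
    (∀ w, fockWgt b w * ‖f w‖ ≤ A * Real.exp ‖z - w‖) →
      fockWgt (b - 2 * s) z * ‖homMul m f z‖ ≤ C * A

theorem MulOrd.exists_fockN_le {m : ℕ → ℝ} {s : ℝ} (h : MulOrd n m s) {p : ℝ≥0∞} (hp : p ≠ 0)
    (b : ℝ) : ∃ K : ℝ≥0∞, K ≠ ∞ ∧ ∀ f : Cn n → ℂ, Differentiable ℂ f →
      fockN p (b - 2 * s) (homMul m f) ≤ K * fockN p b f := by
  obtain ⟨C, hC, h1⟩ := h.2 b
  obtain ⟨K, hK, h2⟩ := exists_fockN_le_of_dom n hp b (b - 2 * s) hC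
  exact ⟨K, hK, fun f hf => h2 f _ hf fun z A hA hA2 => h1 f hf z A hA hA2⟩

/-- By the triangle inequality, domination by A e^{|z-·|} implies domination by A e^{|z-w|}
e^{|w-·|} for each w. So the estimate for m' at all w is again a hypothesis of the same shape at z,
with no loss in the exponential rate. -/
theorem MulOrd.mul {m m' : ℕ → ℝ} {s s' : ℝ} (h : MulOrd n m s) (h' : MulOrd n m' s') :
    MulOrd n (m * m') (s + s') := by
  refine ⟨h.1.mul h'.1, fun b => ?_⟩
  obtain ⟨C', hC', h2⟩ := h'.2 b
  obtain ⟨C, hC, h1⟩ := h.2 (b - 2 * s')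
  refine ⟨C * C', by positivity, fun f hf z A hA hle => ?_⟩
  rw [← homMul_homMul h'.1 hf, mul_assoc, show b - 2 * (s + s') = b - 2 * s' - 2 * s by ring]
  refine h1 _ (differentiable_homMul h'.1 hf) z (C' * A) (by positivity) fun w => ?_
  rw [mul_assoc]
  refine h2 f hf w (A * Real.exp ‖z - w‖) (by positivity) fun v => (hle v).trans ?_
  rw [mul_assoc, ← Real.exp_add]
  gcongr
  exact norm_sub_le_norm_sub_add_norm_sub z w v

theorem MulOrd.add {m m' : ℕ → ℝ} {s : ℝ} (h : MulOrd n m s) (h' : MulOrd n m' s) :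
    MulOrd n (m + m') s := by
  refine ⟨h.1.add h'.1, fun b => ?_⟩
  obtain ⟨C', hC', h2⟩ := h'.2 b
  obtain ⟨C, hC, h1⟩ := h.2 b
  refine ⟨C + C', by positivity, fun f hf z A hA hle => ?_⟩
  rw [homMul_add_coeff h.1 h'.1 hf, Pi.add_apply]
  calc fockWgt (b - 2 * s) z * ‖homMul m f z + homMul m' f z‖
      ≤ fockWgt (b - 2 * s) z * (‖homMul m f z‖ + ‖homMul m' f z‖) :=
        mul_le_mul_of_nonneg_left (norm_add_le _ _) (fockWgt_pos _ _).le
    _ ≤ C * A + C' * A := by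
        rw [mul_add]; exact add_le_add (h1 f hf z A hA hle) (h2 f hf z A hA hle)
    _ = _ := by ring

theorem fockWgt_le_of_le {b b' : ℝ} (h : b ≤ b') (z : Cn n) : fockWgt b z ≤ fockWgt b' z := by
  rw [fockWgt, fockWgt]
  gcongr
  simp

theorem mulOrd_const (n : ℕ) (c : ℝ) {s : ℝ} (hs : 0 ≤ s) : MulOrd n (fun _ => c) s := by
  refine ⟨geomBdd_of_bdd (C := |c|) fun _ => le_rfl, fun b => ⟨|c|, abs_nonneg c,
    fun f hf z A hA hle => ?_⟩⟩
  have h1 : homMul (fun _ => c) f z = c * f z := by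
    rw [homMul, tsum_mul_left, (hasSum_homPart hf z).tsum_eq]
  have h2 := hle z
  rw [sub_self, norm_zero, Real.exp_zero, mul_one] at h2
  rw [h1, norm_mul, Complex.norm_real, Real.norm_eq_abs, mul_left_comm]
  gcongr
  refine le_trans ?_ h2
  gcongr
  exact fockWgt_le_of_le (by linarith) z

/-- Cauchy's estimate for the homogeneous parts, from the unit ball. -/
theorem norm_homPart_le_norm_pow {f : Cn n → ℂ} (hf : Differentiable ℂ f) {S r : ℝ} (hr : 0 < r)
    (hS : ∀ w, ‖w‖ ≤ r → ‖f w‖ ≤ S) (k : ℕ) (z : Cn n) :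
    ‖homPart k f z‖ ≤ S * (‖z‖ / r) ^ k := by
  have hS0 : 0 ≤ S := (norm_nonneg _).trans (hS 0 (by simpa using hr.le))
  rcases eq_or_ne z 0 with rfl | hz
  · rcases Nat.eq_zero_or_pos k with rfl | hk
    · simpa [homPart] using hS 0 (by simpa using hr.le)
    · have h := homPart_smul_arg hf k 0 0
      rw [zero_smul, zero_pow hk.ne', zero_mul] at h
      rw [h, norm_zero]
      positivity
  · have hz' : 0 < ‖z‖ := norm_pos_iff.2 hz
    have h := norm_homPart_le hf k z (R := r / ‖z‖) (C := S) (by positivity) fun t ht =>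
      hS _ (by rw [norm_smul, ht, div_mul_cancel₀ _ hz'.ne'])
    refine h.trans (le_of_eq ?_)
    rw [div_pow, div_pow]
    field_simp

/-- Points of the ball are within |z| + r of z, so values near the origin cost only e^{|z|}, which a
Gaussian at z later absorbs. -/
theorem exists_local_bound (n : ℕ) (b r : ℝ) : ∃ C : ℝ, 0 < C ∧
    ∀ (f : Cn n → ℂ) (z : Cn n) (A : ℝ), 0 ≤ A →
    (∀ w, fockWgt b w * ‖f w‖ ≤ A * Real.exp ‖z - w‖) →
      ∀ w, ‖w‖ ≤ r → ‖f w‖ ≤ C * (A * Real.exp ‖z‖) := by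
  refine ⟨Real.exp (r + |b| * r + r ^ 2 / 2), Real.exp_pos _, fun f z A hA h w hw => ?_⟩
  have h1 := h w
  have h2 : Real.exp (-(|b| * r + r ^ 2 / 2)) ≤ fockWgt b w := by
    have h3 := one_add_rpow_le_exp (-b) (norm_nonneg w)
    rw [abs_neg, Real.rpow_neg (by positivity)] at h3
    have h4 : Real.exp (-(|b| * ‖w‖)) ≤ (1 + ‖w‖) ^ b := by
      rw [Real.exp_neg]
      exact inv_le_of_inv_le₀ (by positivity) h3
    rw [fockWgt]
    calc Real.exp (-(|b| * r + r ^ 2 / 2)) ≤ Real.exp (-‖w‖ ^ 2 / 2) * Real.exp (-(|b| * ‖w‖)) := by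
          rw [← Real.exp_add, Real.exp_le_exp]
          have : |b| * ‖w‖ ≤ |b| * r := by gcongr
          have : ‖w‖ ^ 2 ≤ r ^ 2 := by gcongr
          linarith
      _ ≤ _ := by gcongr
  have h5 : ‖z - w‖ ≤ ‖z‖ + r := (norm_sub_le z w).trans (by linarith)
  have h6 : Real.exp (-(|b| * r + r ^ 2 / 2)) * ‖f w‖ ≤ A * Real.exp (‖z‖ + r) :=
    (mul_le_mul_of_nonneg_right h2 (norm_nonneg _)).trans (h1.trans (by gcongr))
  rw [Real.exp_neg, inv_mul_le_iff₀ (Real.exp_pos _)] at h6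
  refine h6.trans (le_of_eq ?_)
  rw [show r + |b| * r + r ^ 2 / 2 = r + (|b| * r + r ^ 2 / 2) by ring, Real.exp_add r,
    Real.exp_add ‖z‖]
  ring

/-- The image is a polynomial of degree below K with parts bounded through values of f on the unit
ball. The Gaussian beats e^{|z|} times any power of 1+|z|, so every order is allowed; consequently
only the tail of a multiplier determines its order. -/
theorem mulOrd_of_support (n : ℕ) {m : ℕ → ℝ} {K : ℕ} (h : ∀ k, K ≤ k → m k = 0) (s : ℝ) :
    MulOrd n m s := by
  refine ⟨geomBdd_of_support h, fun b => ?_⟩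
  obtain ⟨C₁, hC₁, h1⟩ := exists_local_bound n b 1
  obtain ⟨C₂, hC₂, h2⟩ := exists_rpow_mul_exp_le (b - 2 * s + K) 1 (ε := 1 / 2) (by norm_num)
  refine ⟨(∑ k ∈ Finset.range K, |m k|) * (C₁ * C₂), by positivity, fun f hf z A hA hle => ?_⟩
  have h3 : ∀ k < K, ‖homPart k f z‖ ≤ C₁ * (A * Real.exp ‖z‖) * (1 + ‖z‖) ^ (K : ℝ) :=
    fun k hk => by
      refine (norm_homPart_le_norm_pow hf one_pos (h1 f z A hA hle) k z).trans ?_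
      gcongr
      rw [div_one, Real.rpow_natCast]
      calc ‖z‖ ^ k ≤ (1 + ‖z‖) ^ k := by gcongr; linarith
        _ ≤ (1 + ‖z‖) ^ K := pow_le_pow_right₀ (by linarith [norm_nonneg z]) hk.le
  have h4 : ‖homMul m f z‖ ≤ (∑ k ∈ Finset.range K, |m k|) *
      (C₁ * (A * Real.exp ‖z‖) * (1 + ‖z‖) ^ (K : ℝ)) := by
    rw [homMul_of_support h, Finset.sum_mul]
    refine (norm_sum_le _ _).trans (Finset.sum_le_sum fun k hk => ?_)
    rw [norm_mul, Complex.norm_real, Real.norm_eq_abs]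
    exact mul_le_mul_of_nonneg_left (h3 k (Finset.mem_range.1 hk)) (abs_nonneg _)
  have h5 := h2 ‖z‖ (norm_nonneg z)
  rw [one_mul] at h5
  have h6 : fockWgt (b - 2 * s) z * (Real.exp ‖z‖ * (1 + ‖z‖) ^ (K : ℝ)) ≤ C₂ := by
    rw [Real.rpow_add (by positivity)] at h5
    have h7 : Real.exp (-‖z‖ ^ 2 / 2) * Real.exp (1 / 2 * ‖z‖ ^ 2) = 1 := by
      rw [← Real.exp_add, Real.exp_eq_one_iff]; ring
    rw [fockWgt]
    calc _ = Real.exp (-‖z‖ ^ 2 / 2) *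
          ((1 + ‖z‖) ^ (b - 2 * s) * (1 + ‖z‖) ^ (K : ℝ) * Real.exp ‖z‖) := by ring
      _ ≤ Real.exp (-‖z‖ ^ 2 / 2) * (C₂ * Real.exp (1 / 2 * ‖z‖ ^ 2)) := by gcongr
      _ = C₂ * (Real.exp (-‖z‖ ^ 2 / 2) * Real.exp (1 / 2 * ‖z‖ ^ 2)) := by ring
      _ = C₂ := by rw [h7, mul_one]
  set M := ∑ k ∈ Finset.range K, |m k| with hM
  have hM0 : 0 ≤ M := Finset.sum_nonneg fun _ _ => abs_nonneg _
  calc fockWgt (b - 2 * s) z * ‖homMul m f z‖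
      ≤ fockWgt (b - 2 * s) z * (M * (C₁ * (A * Real.exp ‖z‖) * (1 + ‖z‖) ^ (K : ℝ))) :=
        mul_le_mul_of_nonneg_left h4 (fockWgt_pos _ _).le
    _ = M * C₁ * A * (fockWgt (b - 2 * s) z * (Real.exp ‖z‖ * (1 + ‖z‖) ^ (K : ℝ))) := by ring
    _ ≤ M * C₁ * A * C₂ := by gcongr
    _ = _ := by ring

theorem MulOrd.congr {m m' : ℕ → ℝ} {s : ℝ} (h : MulOrd n m s) {K : ℕ}
    (he : ∀ k, K ≤ k → m' k = m k) : MulOrd n m' s := by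
  have h1 : MulOrd n (m' - m) s := mulOrd_of_support n (K := K) (fun k hk => by
    rw [Pi.sub_apply, he k hk, sub_self]) s
  have h2 := h.add h1
  rwa [add_sub_cancel] at h2

/-- Multiplication by the degree, i.e. the radial derivative, has order `1`. -/
theorem mulOrd_natCast (n : ℕ) : MulOrd n (fun k => (k : ℝ)) 1 := by
  refine ⟨⟨1, 2, zero_le_one, one_le_two, fun k => ?_⟩, fun b => ⟨Real.exp (3 / 2) * 2 ^ |b| *
    Real.exp 1, by positivity, fun f hf z A hA hle => ?_⟩⟩
  · rw [Nat.abs_cast, one_mul]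
    exact_mod_cast Nat.lt_two_pow_self.le
  have hg := differentiable_line hf z
  -- Euler's identity: ∑ k f_k(z) is the derivative of t ↦ f(tz) at t = 1.
  have hderiv : homMul (fun k => (k : ℝ)) f z = deriv (fun t : ℂ => f (t • z)) 1 := by
    have h1 := Complex.hasSum_taylorSeries_of_entire hg.deriv 0 1
    rw [homMul]
    have h2 : HasSum (fun k : ℕ => (((k + 1 : ℕ) : ℝ) : ℂ) * homPart (k + 1) f z)
        (deriv (fun t : ℂ => f (t • z)) 1) := by
      refine h1.congr_fun fun k => ?_
      rw [homPart, iteratedDeriv_succ', Nat.factorial_succ]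
      have hk1 : (k : ℂ) + 1 ≠ 0 := by exact_mod_cast k.succ_ne_zero
      have hk2 : (k.factorial : ℂ) ≠ 0 := by exact_mod_cast k.factorial_ne_zero
      simp only [sub_zero, one_pow, smul_eq_mul, one_mul]
      push_cast
      field_simp
    have h3 := (hasSum_nat_add_iff' (f := fun k : ℕ => ((k : ℝ) : ℂ) * homPart k f z) 1
      (g := deriv (fun t : ℂ => f (t • z)) 1)).1 (by simpa using h2)
    exact h3.tsum_eq
  -- On |t-1| = δ the point tz is within 1 of z and |tz|² exceeds |z|² by at most 3, so the weights
  -- are comparable. Cauchy's estimate then costs 1/δ = (1+|z|)², that is, order 1.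
  set δ : ℝ := ((1 + ‖z‖) ^ 2)⁻¹ with hδ
  have hz : 0 ≤ ‖z‖ := norm_nonneg z
  have hδ0 : 0 < δ := by positivity
  have hδz2 : δ * (1 + ‖z‖) ^ 2 = 1 := by rw [hδ, inv_mul_cancel₀ (by positivity)]
  have hδz : δ * ‖z‖ ≤ 1 := by nlinarith
  have hδ1 : δ ≤ 1 := inv_le_one_of_one_le₀ (by nlinarith)
  have hcauchy := Complex.norm_deriv_le_of_forall_mem_sphere_norm_le (c := 1) (R := δ) hδ0
    hg.diffContOnCl (C := Real.exp (3 / 2) * 2 ^ |b| * Real.exp 1 * A / fockWgt b z) fun t ht => by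
      have ht : ‖t - 1‖ = δ := by simpa using ht
      have hd : ‖z - t • z‖ ≤ 1 := by
        rw [show z - t • z = (1 - t) • z by rw [sub_smul, one_smul], norm_smul, norm_sub_rev, ht]
        exact hδz
      have ht1 : ‖t‖ ≤ 1 + δ := by
        have := norm_sub_norm_le t 1
        rw [norm_one, ht] at this
        linarith
      have h1 := hle (t • z)
      have h2 : fockWgt b z ≤ Real.exp (3 / 2) * 2 ^ |b| * fockWgt b (t • z) := by
        have h3 := one_add_rpow_le_mul b z (t • z)
        have h4 : (1 + ‖z - t • z‖) ^ |b| ≤ 2 ^ |b| :=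
          Real.rpow_le_rpow (by positivity) (by linarith) (abs_nonneg b)
        have h5 : Real.exp (-‖z‖ ^ 2 / 2) ≤ Real.exp (3 / 2) * Real.exp (-‖t • z‖ ^ 2 / 2) := by
          rw [← Real.exp_add, Real.exp_le_exp, norm_smul, mul_pow]
          have h6 : ‖t‖ ^ 2 ≤ (1 + δ) ^ 2 := by gcongr
          have h7 : (1 + δ) ^ 2 * ‖z‖ ^ 2 ≤ ‖z‖ ^ 2 + 3 := by
            have h8 : δ * ‖z‖ ^ 2 ≤ 1 := by nlinarith
            nlinarith
          nlinarith [sq_nonneg ‖z‖]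
        rw [fockWgt, fockWgt]
        calc _ ≤ (Real.exp (3 / 2) * Real.exp (-‖t • z‖ ^ 2 / 2)) *
              ((1 + ‖t • z‖) ^ b * 2 ^ |b|) := by
              gcongr
              exact h3.trans (by gcongr)
          _ = _ := by ring
      rw [le_div_iff₀ (fockWgt_pos _ _)]
      calc ‖f (t • z)‖ * fockWgt b z
          ≤ ‖f (t • z)‖ * (Real.exp (3 / 2) * 2 ^ |b| * fockWgt b (t • z)) := by gcongr
        _ = Real.exp (3 / 2) * 2 ^ |b| * (fockWgt b (t • z) * ‖f (t • z)‖) := by ring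
        _ ≤ Real.exp (3 / 2) * 2 ^ |b| * (A * Real.exp 1) := by
            refine mul_le_mul_of_nonneg_left (h1.trans ?_) (by positivity)
            gcongr
        _ = _ := by ring
  rw [hderiv]
  have hw : fockWgt (b - 2 * 1) z = fockWgt b z * δ := by
    rw [fockWgt, fockWgt, mul_one, Real.rpow_sub (by positivity), hδ, mul_assoc,
      div_eq_mul_inv]
    norm_cast
  rw [hw]
  have hwp := fockWgt_pos b z
  calc _ ≤ fockWgt b z * δ * (Real.exp (3 / 2) * 2 ^ |b| * Real.exp 1 * A / fockWgt b z / δ) := by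
        gcongr
    _ = _ := by field_simp

end Dom

/-! ### Gamma quotients as multipliers, through beta averages of dilations. -/

/-- Euler's beta integral. -/
theorem integral_rpow_mul_one_sub_rpow {a c : ℝ} (ha : 0 < a) (hc : 0 < c) :
    IntegrableOn (fun u : ℝ => u ^ (c - 1) * (1 - u) ^ (a - 1)) (Set.Ioo 0 1) ∧
    ∫ u in Set.Ioo (0 : ℝ) 1, u ^ (c - 1) * (1 - u) ^ (a - 1) =
      Real.Gamma c * (Real.Gamma a / Real.Gamma (a + c)) := by
  have hc' : (0 : ℝ) < (c : ℂ).re := by simpa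
  have ha' : (0 : ℝ) < (a : ℂ).re := by simpa
  have h1 := Complex.betaIntegral_convergent hc' ha'
  rw [intervalIntegrable_iff_integrableOn_Ioo_of_le zero_le_one] at h1
  have heq : Set.EqOn (fun x : ℝ => (x : ℂ) ^ ((c : ℂ) - 1) * (1 - (x : ℂ)) ^ ((a : ℂ) - 1))
      (fun u : ℝ => ((u ^ (c - 1) * (1 - u) ^ (a - 1) : ℝ) : ℂ)) (Set.Ioo 0 1) := fun u hu => by
    simp only
    rw [Complex.ofReal_mul, Complex.ofReal_cpow hu.1.le, Complex.ofReal_cpow (by linarith [hu.2])]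
    push_cast
    rfl
  rw [integrableOn_congr_fun heq measurableSet_Ioo] at h1
  have h2 : IntegrableOn (fun u : ℝ => u ^ (c - 1) * (1 - u) ^ (a - 1)) (Set.Ioo 0 1) := by
    have := h1.re
    simpa [IntegrableOn] using this
  refine ⟨h2, ?_⟩
  have h3 := Complex.betaIntegral_eq_Gamma_mul_div (c : ℂ) (a : ℂ) hc' ha'
  rw [Complex.betaIntegral, intervalIntegral.integral_of_le zero_le_one,
    integral_Ioc_eq_integral_Ioo, setIntegral_congr_fun measurableSet_Ioo heq,
    integral_complex_ofReal, Complex.Gamma_ofReal, Complex.Gamma_ofReal, ← Complex.ofReal_add,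
    Complex.Gamma_ofReal] at h3
  have h4 := congrArg Complex.re h3
  rw [← Complex.ofReal_mul, ← Complex.ofReal_div, Complex.ofReal_re, Complex.ofReal_re] at h4
  rw [h4, mul_div_assoc, add_comm c a]

section Beta

variable {n : ℕ}

/-- The indicator of the degrees `k ≥ K`. -/
noncomputable def tailInd (K k : ℕ) : ℝ := if K ≤ k then 1 else 0

theorem abs_tailInd_le (K k : ℕ) : |tailInd K k| ≤ 1 := by
  rw [tailInd]; split_ifs <;> simp

theorem geomBdd_tailInd (K : ℕ) : GeomBdd (tailInd K) := geomBdd_of_bdd (abs_tailInd_le K)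

/-- Contracting z to (1-u)z changes |z|²/2 by (u - u²/2)|z|² ≥ (3/4)u|z|² when u ≤ 1/2. This gain
pays for e^{u|z|} and still leaves decay in u at the rate (1+|z|)²/8. -/
theorem exists_dilate_weight_bound (n : ℕ) (B : ℝ) : ∃ C : ℝ, 0 < C ∧ ∀ (z : Cn n) (u : ℝ), 0 ≤ u →
    u ≤ 1 / 2 → fockWgt B z * Real.exp (u * ‖z‖) ≤
      C * fockWgt B (((1 - u : ℝ) : ℂ) • z) * Real.exp (-(u * ((1 + ‖z‖) ^ 2 / 8))) := by
  refine ⟨2 ^ |B| * Real.exp 1, by positivity, fun z u hu0 hu => ?_⟩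
  have hz := norm_nonneg z
  have hnorm : ‖((1 - u : ℝ) : ℂ) • z‖ = (1 - u) * ‖z‖ := by
    rw [norm_smul, Complex.norm_real, Real.norm_of_nonneg (by linarith)]
  have h1 : (1 + ‖z‖) ^ B ≤ (1 + (1 - u) * ‖z‖) ^ B * 2 ^ |B| := by
    have hp : 0 < 1 + (1 - u) * ‖z‖ := by nlinarith
    have h2 : 1 + ‖z‖ ≤ (1 + (1 - u) * ‖z‖) * 2 := by nlinarith
    rcases le_total 0 B with hB | hB
    · rw [abs_of_nonneg hB, ← Real.mul_rpow hp.le zero_le_two]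
      exact Real.rpow_le_rpow (by linarith) h2 hB
    · refine le_trans ?_ (le_mul_of_one_le_right (by positivity)
        (Real.one_le_rpow one_le_two (abs_nonneg B)))
      refine Real.rpow_le_rpow_of_nonpos hp ?_ hB
      nlinarith
  have h3 : Real.exp (-‖z‖ ^ 2 / 2) * Real.exp (u * ‖z‖) ≤ Real.exp 1 *
      Real.exp (-((1 - u) * ‖z‖) ^ 2 / 2) * Real.exp (-(u * ((1 + ‖z‖) ^ 2 / 8))) := by
    rw [← Real.exp_add, ← Real.exp_add, ← Real.exp_add, Real.exp_le_exp]
    have h4 : 0 ≤ u * (1 / 2 - u) * ‖z‖ ^ 2 := by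
      have : 0 ≤ 1 / 2 - u := by linarith
      positivity
    have h5 : u * (1 / 8 + 5 / 4 * ‖z‖ - 5 / 8 * ‖z‖ ^ 2) ≤ 1 := by
      have : 1 / 8 + 5 / 4 * ‖z‖ - 5 / 8 * ‖z‖ ^ 2 ≤ 3 / 4 := by nlinarith [sq_nonneg (‖z‖ - 1)]
      nlinarith
    nlinarith
  rw [fockWgt, fockWgt, hnorm]
  calc _ = (Real.exp (-‖z‖ ^ 2 / 2) * Real.exp (u * ‖z‖)) * (1 + ‖z‖) ^ B := by ring
    _ ≤ (Real.exp 1 * Real.exp (-((1 - u) * ‖z‖) ^ 2 / 2) *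
        Real.exp (-(u * ((1 + ‖z‖) ^ 2 / 8)))) * ((1 + (1 - u) * ‖z‖) ^ B * 2 ^ |B|) := by gcongr
    _ = _ := by ring

/-- For |w| ≤ (3/4)|z| the Gaussian at w costs at most e^{(9/32)|z|²}, against e^{-(1/2)|z|²} at z.
The surplus (7/32)|z|² absorbs every power and every e^{L|z|}. -/
theorem exists_near_bound (n : ℕ) (b B : ℝ) : ∃ C : ℝ, 0 < C ∧
    ∀ (f : Cn n → ℂ) (z : Cn n) (A : ℝ), 0 ≤ A →
    (∀ w, fockWgt b w * ‖f w‖ ≤ A * Real.exp ‖z - w‖) →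
      ∀ w, ‖w‖ ≤ 3 / 4 * ‖z‖ → fockWgt B z * ‖f w‖ ≤ C * A := by
  obtain ⟨C, hC, h⟩ := exists_rpow_mul_exp_le B (2 + |b|) (ε := 7 / 32) (by norm_num)
  refine ⟨C, hC, fun f z A hA hle w hw => ?_⟩
  have h1 := hle w
  have hz := norm_nonneg z
  have h2 : Real.exp (-(9 / 32 * ‖z‖ ^ 2) - |b| * ‖z‖) ≤ fockWgt b w := by
    have h3 := one_add_rpow_le_exp (-b) (norm_nonneg w)
    rw [abs_neg, Real.rpow_neg (by positivity)] at h3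
    have h4 : Real.exp (-(|b| * ‖w‖)) ≤ (1 + ‖w‖) ^ b := by
      rw [Real.exp_neg]
      exact inv_le_of_inv_le₀ (by positivity) h3
    rw [fockWgt]
    refine le_trans ?_ (mul_le_mul_of_nonneg_left h4 (Real.exp_pos _).le)
    rw [← Real.exp_add, Real.exp_le_exp]
    have h5 : |b| * ‖w‖ ≤ |b| * ‖z‖ := by gcongr; linarith
    have h6 : ‖w‖ ^ 2 ≤ (3 / 4 * ‖z‖) ^ 2 := by gcongr
    nlinarith
  have h7 : ‖z - w‖ ≤ 2 * ‖z‖ := (norm_sub_le z w).trans (by linarith)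
  have h8 : Real.exp (-(9 / 32 * ‖z‖ ^ 2) - |b| * ‖z‖) * ‖f w‖ ≤ A * Real.exp (2 * ‖z‖) :=
    (mul_le_mul_of_nonneg_right h2 (norm_nonneg _)).trans (h1.trans (by gcongr))
  have h9 : ‖f w‖ ≤ A * Real.exp ((2 + |b|) * ‖z‖) * Real.exp (9 / 32 * ‖z‖ ^ 2) := by
    rw [show -(9 / 32 * ‖z‖ ^ 2) - |b| * ‖z‖ = -(9 / 32 * ‖z‖ ^ 2 + |b| * ‖z‖) by ring,
      Real.exp_neg, inv_mul_le_iff₀ (Real.exp_pos _)] at h8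
    refine h8.trans (le_of_eq ?_)
    rw [mul_left_comm, ← Real.exp_add, mul_assoc, ← Real.exp_add]
    ring_nf
  have h10 := h ‖z‖ hz
  calc fockWgt B z * ‖f w‖
      ≤ fockWgt B z * (A * Real.exp ((2 + |b|) * ‖z‖) * Real.exp (9 / 32 * ‖z‖ ^ 2)) :=
        mul_le_mul_of_nonneg_left h9 (fockWgt_pos _ _).le
    _ = A * ((1 + ‖z‖) ^ B * Real.exp ((2 + |b|) * ‖z‖)) *
        (Real.exp (-‖z‖ ^ 2 / 2) * Real.exp (9 / 32 * ‖z‖ ^ 2)) := by rw [fockWgt]; ring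
    _ ≤ A * (C * Real.exp (7 / 32 * ‖z‖ ^ 2)) *
        (Real.exp (-‖z‖ ^ 2 / 2) * Real.exp (9 / 32 * ‖z‖ ^ 2)) := by gcongr
    _ = C * A * (Real.exp (7 / 32 * ‖z‖ ^ 2) *
        (Real.exp (-‖z‖ ^ 2 / 2) * Real.exp (9 / 32 * ‖z‖ ^ 2))) := by ring
    _ = C * A := by
        rw [← Real.exp_add, ← Real.exp_add,
          Real.exp_eq_one_iff _ |>.2 (by ring), mul_one]

/-- A bound for the integrand of the beta average. For u ≥ 1/2, Cauchy on |t| = 3/4 against (1-u)^k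
gives ratio (1/2)/(3/4) = 2/3, and the possible singularity (1-u)^{a-1} is absorbed because k ≥ K
and a + K ≥ 1. For u < 1/2 the tail is f minus a polynomial: f is handled by the dilation weight
bound, and the polynomial by `mulOrd_of_support` with order -c. -/
theorem exists_dilate_bound (n : ℕ) (a b c : ℝ) (K : ℕ) (hc : 0 ≤ c) (hK : 1 ≤ a + K) :
    ∃ C : ℝ, 0 ≤ C ∧
    ∀ f : Cn n → ℂ, Differentiable ℂ f → ∀ (z : Cn n) (A : ℝ), 0 ≤ A →
    (∀ w, fockWgt b w * ‖f w‖ ≤ A * Real.exp ‖z - w‖) → ∀ u ∈ Set.Ioo (0 : ℝ) 1,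
      fockWgt (b + 2 * c) z * ((1 - u) ^ (a - 1) *
        ‖homMul (tailInd K) f (((1 - u : ℝ) : ℂ) • z)‖) ≤
      C * A * (1 + (1 + ‖z‖) ^ (2 * c) * Real.exp (-(u * ((1 + ‖z‖) ^ 2 / 8)))) := by
  obtain ⟨C₁, hC₁, h1⟩ := exists_near_bound n b (b + 2 * c)
  obtain ⟨C₂, hC₂, h2⟩ := exists_dilate_weight_bound n (b + 2 * c)
  obtain ⟨C₃, hC₃, h3⟩ := (mulOrd_of_support n (m := fun k => if K ≤ k then 0 else -1) (K := K)
    (fun k hk => by simp [hk]) (-c)).2 b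
  set D := ∑' k : ℕ, (2 : ℝ) ^ (1 - a) * (2 / 3 : ℝ) ^ k with hD
  have hsumD : Summable fun k : ℕ => (2 : ℝ) ^ (1 - a) * (2 / 3 : ℝ) ^ k :=
    (summable_geometric_of_lt_one (by norm_num) (by norm_num)).mul_left _
  have hD0 : 0 ≤ D := tsum_nonneg fun k => by positivity
  refine ⟨D * C₁ + 2 ^ |a - 1| * (C₂ * (1 + C₃)), by positivity,
    fun f hf z A hA hle u hu => ?_⟩
  have hz := norm_nonneg z
  have hu1 : 0 < 1 - u := by linarith [hu.2]
  set E := (1 + ‖z‖) ^ (2 * c) * Real.exp (-(u * ((1 + ‖z‖) ^ 2 / 8))) with hE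
  have hE0 : 0 ≤ E := by positivity
  have hwB := fockWgt_pos (b + 2 * c) z
  rcases le_or_gt (1 / 2) u with hu2 | hu2
  · have hS : ∀ k, ‖homPart k f z‖ ≤ C₁ * A / fockWgt (b + 2 * c) z / (3 / 4) ^ k := fun k => by
      refine norm_homPart_le hf k z (by norm_num) fun t ht => ?_
      rw [le_div_iff₀ hwB, mul_comm]
      exact h1 f z A hA hle _ (by rw [norm_smul, ht])
    have hb : ∀ k, ‖(tailInd K k : ℂ) * homPart k f (((1 - u : ℝ) : ℂ) • z)‖ ≤
        (C₁ * A / fockWgt (b + 2 * c) z / (1 - u) ^ (a - 1)) *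
          ((2 : ℝ) ^ (1 - a) * (2 / 3 : ℝ) ^ k) := fun k => by
      rw [homPart_smul_arg hf, tailInd]
      split_ifs with hk
      · rw [Complex.ofReal_one, one_mul, norm_mul, norm_pow, Complex.norm_real,
          Real.norm_of_nonneg hu1.le]
        have h4 : (1 - u) ^ (a - 1) * (1 - u) ^ k ≤ (2 : ℝ) ^ (1 - a) * (1 / 2) ^ k := by
          rw [← Real.rpow_natCast, ← Real.rpow_add hu1, ← Real.rpow_natCast,
            show (2 : ℝ) ^ (1 - a) = (1 / 2) ^ (a - 1) by
              rw [one_div, Real.inv_rpow zero_le_two, ← Real.rpow_neg zero_le_two, neg_sub],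
            ← Real.rpow_add (by norm_num)]
          have hk' : (K : ℝ) ≤ k := by exact_mod_cast hk
          exact Real.rpow_le_rpow hu1.le (by linarith) (by linarith)
        have h5 : (0 : ℝ) < (1 - u) ^ (a - 1) := by positivity
        rw [div_mul_eq_mul_div, le_div_iff₀ h5]
        calc (1 - u) ^ k * ‖homPart k f z‖ * (1 - u) ^ (a - 1)
            = (1 - u) ^ (a - 1) * (1 - u) ^ k * ‖homPart k f z‖ := by ring
          _ ≤ (2 : ℝ) ^ (1 - a) * (1 / 2) ^ k *
              (C₁ * A / fockWgt (b + 2 * c) z / (3 / 4) ^ k) := by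
              gcongr; exact hS k
          _ = C₁ * A / fockWgt (b + 2 * c) z * ((2 : ℝ) ^ (1 - a) * ((1 / 2) ^ k / (3 / 4) ^ k)) := by
              ring
          _ = _ := by rw [← div_pow]; norm_num
      · rw [Complex.ofReal_zero, zero_mul, norm_zero]
        positivity
    have h6 := (hasSum_homMul (geomBdd_tailInd K) hf (((1 - u : ℝ) : ℂ) • z)).norm_le_of_bounded
      (hsumD.hasSum.mul_left _) hb
    have h5 : (0 : ℝ) < (1 - u) ^ (a - 1) := by positivity
    calc _ ≤ fockWgt (b + 2 * c) z * ((1 - u) ^ (a - 1) *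
          (C₁ * A / fockWgt (b + 2 * c) z / (1 - u) ^ (a - 1) * D)) := by gcongr
      _ = D * C₁ * A := by field_simp
      _ ≤ (D * C₁ + 2 ^ |a - 1| * (C₂ * (1 + C₃))) * A * (1 + E) := by
          have : 0 ≤ 2 ^ |a - 1| * (C₂ * (1 + C₃)) * A := by positivity
          have h7 : 0 ≤ D * C₁ * A := by positivity
          nlinarith
  · set t : ℂ := ((1 - u : ℝ) : ℂ) with ht
    have hd : ‖z - t • z‖ = u * ‖z‖ := by
      have : z - t • z = (u : ℂ) • z := by
        rw [ht, Complex.ofReal_sub, sub_smul, Complex.ofReal_one, one_smul, sub_sub_cancel]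
      rw [this, norm_smul, Complex.norm_real, Real.norm_of_nonneg hu.1.le]
    have htz : ‖t • z‖ ≤ ‖z‖ := by
      rw [norm_smul, ht, Complex.norm_real, Real.norm_of_nonneg hu1.le]
      nlinarith [hu.1]
    have htail : ‖homMul (tailInd K) f (t • z)‖ ≤ ‖f (t • z)‖ +
        ‖homMul (fun k => if K ≤ k then 0 else -1) f (t • z)‖ := by
      have h4 : tailInd K = 1 + fun k => if K ≤ k then 0 else -1 := by
        funext k; simp only [tailInd, Pi.add_apply, Pi.one_apply]; split_ifs <;> simp
      rw [h4, homMul_add_coeff geomBdd_one (geomBdd_of_support (K := K) fun k hk => by simp [hk]) hf,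
        homMul_one hf]
      exact norm_add_le _ _
    have ha : (1 - u) ^ (a - 1) ≤ 2 ^ |a - 1| := by
      rcases le_total 0 (a - 1) with ha | ha
      · calc (1 - u) ^ (a - 1) ≤ 1 := Real.rpow_le_one hu1.le (by linarith [hu.1]) ha
          _ ≤ _ := Real.one_le_rpow one_le_two (abs_nonneg _)
      · rw [abs_of_nonpos ha, Real.rpow_neg zero_le_two, ← Real.inv_rpow zero_le_two]
        exact Real.rpow_le_rpow_of_nonpos (by norm_num) (by linarith) ha
    have hW := h2 z u hu.1.le hu2.le
    rw [← ht] at hW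
    have hcancel : ∀ x M : ℝ, 0 ≤ x →
        fockWgt (b + 2 * c) (t • z) * x ≤ M * (A * Real.exp (u * ‖z‖)) →
        fockWgt (b + 2 * c) z * x ≤ C₂ * A * (M * Real.exp (-(u * ((1 + ‖z‖) ^ 2 / 8)))) := by
      intro x M hx hxM
      refine le_of_mul_le_mul_right ?_ (Real.exp_pos (u * ‖z‖))
      calc fockWgt (b + 2 * c) z * x * Real.exp (u * ‖z‖)
          = fockWgt (b + 2 * c) z * Real.exp (u * ‖z‖) * x := by ring
        _ ≤ C₂ * fockWgt (b + 2 * c) (t • z) * Real.exp (-(u * ((1 + ‖z‖) ^ 2 / 8))) * x := by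
            gcongr
        _ = C₂ * Real.exp (-(u * ((1 + ‖z‖) ^ 2 / 8))) * (fockWgt (b + 2 * c) (t • z) * x) := by
            ring
        _ ≤ C₂ * Real.exp (-(u * ((1 + ‖z‖) ^ 2 / 8))) * (M * (A * Real.exp (u * ‖z‖))) := by
            gcongr
        _ = _ := by ring
    have hX : fockWgt (b + 2 * c) z * ‖f (t • z)‖ ≤ C₂ * A * E := by
      refine hcancel _ ((1 + ‖z‖) ^ (2 * c)) (norm_nonneg _) ?_
      have h4 := hle (t • z)
      rw [hd] at h4
      rw [fockWgt, Real.rpow_add (by positivity)]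
      calc _ = (1 + ‖t • z‖) ^ (2 * c) * (fockWgt b (t • z) * ‖f (t • z)‖) := by
            rw [fockWgt]; ring
        _ ≤ _ := mul_le_mul (Real.rpow_le_rpow (by positivity) (by linarith) (by linarith)) h4
            (mul_nonneg (fockWgt_pos _ _).le (norm_nonneg _)) (by positivity)
    have hY : fockWgt (b + 2 * c) z * ‖homMul (fun k => if K ≤ k then 0 else -1) f (t • z)‖ ≤
        C₂ * A * C₃ := by
      have h4 := h3 f hf (t • z) (A * Real.exp (u * ‖z‖)) (by positivity) fun w =>
        (hle w).trans (by
          rw [mul_assoc, ← Real.exp_add, ← hd]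
          gcongr
          exact norm_sub_le_norm_sub_add_norm_sub _ _ _)
      rw [show b - 2 * -c = b + 2 * c by ring] at h4
      refine (hcancel _ C₃ (norm_nonneg _) h4).trans ?_
      gcongr
      refine mul_le_of_le_one_right hC₃ (Real.exp_le_one_iff.2 ?_)
      have := hu.1
      have : 0 ≤ u * ((1 + ‖z‖) ^ 2 / 8) := by positivity
      linarith
    calc _ ≤ fockWgt (b + 2 * c) z * (2 ^ |a - 1| * (‖f (t • z)‖ +
          ‖homMul (fun k => if K ≤ k then 0 else -1) f (t • z)‖)) := by gcongr
      _ = 2 ^ |a - 1| * (fockWgt (b + 2 * c) z * ‖f (t • z)‖ + fockWgt (b + 2 * c) z *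
          ‖homMul (fun k => if K ≤ k then 0 else -1) f (t • z)‖) := by ring
      _ ≤ 2 ^ |a - 1| * (C₂ * A * E + C₂ * A * C₃) := by gcongr
      _ ≤ (D * C₁ + 2 ^ |a - 1| * (C₂ * (1 + C₃))) * A * (1 + E) := by
          have h7 : 0 ≤ D * C₁ * A * (1 + E) := by positivity
          have h8 : 0 ≤ 2 ^ |a - 1| * C₂ * A := by positivity
          have h9 : 0 ≤ 2 ^ |a - 1| * C₂ * A * (C₃ * E) := by positivity
          nlinarith

/-- Quotients of Gamma functions are multipliers; this is the case given by a Beta average. -/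
theorem mulOrd_gamma_div_of_pos (n : ℕ) (a : ℝ) {c : ℝ} (hc : 0 < c) :
    MulOrd n (fun k => Real.Gamma (a + k) / Real.Gamma (a + c + k)) (-c) := by
  -- From degree K on, the exponent a + k - 1 is nonnegative; lower degrees are discarded by
  -- `MulOrd.congr`.
  obtain ⟨K, hK'⟩ := exists_nat_ge (1 - a)
  have hK : 1 ≤ a + K := by linarith
  suffices h : MulOrd n (fun k => tailInd K k * (Real.Gamma (a + k) / Real.Gamma (a + c + k))) (-c)
    from h.congr (K := K) fun k hk => by simp [tailInd, hk]
  set ρ : ℕ → ℝ → ℝ := fun k u => tailInd K k * (u ^ (c - 1) * (1 - u) ^ (a + k - 1)) with hρ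
  set m : ℕ → ℝ := fun k => tailInd K k * (Real.Gamma (a + k) / Real.Gamma (a + c + k)) with hm
  have hG : 0 < Real.Gamma c := Real.Gamma_pos_of_pos hc
  have hpw : IntegrableOn (fun u : ℝ => u ^ (c - 1)) (Set.Ioo 0 1) := by
    have h := (integral_rpow_mul_one_sub_rpow one_pos hc).1
    simpa using h
  have hbeta : ∀ k, IntegrableOn (ρ k) (Set.Ioo 0 1) ∧
      ∫ u in Set.Ioo (0 : ℝ) 1, ρ k u = Real.Gamma c * m k := fun k => by
    by_cases hk : K ≤ k
    · have hk' : (K : ℝ) ≤ k := by exact_mod_cast hk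
      have h := integral_rpow_mul_one_sub_rpow (a := a + k) (by linarith) hc
      rw [show a + k + c = a + c + k by ring] at h
      simpa [hρ, hm, tailInd, hk] using h
    · simp [hρ, hm, tailInd, hk]
  have hρ0 : ∀ k, ∀ u ∈ Set.Ioo (0 : ℝ) 1, 0 ≤ ρ k u := fun k u hu => by
    have h1 := hu.1
    have h2 : 0 < 1 - u := by linarith [hu.2]
    have h3 : 0 ≤ tailInd K k := by rw [tailInd]; split_ifs <;> simp
    simp only [hρ]
    positivity
  have hρ1 : ∀ k, ∀ u ∈ Set.Ioo (0 : ℝ) 1, ρ k u ≤ u ^ (c - 1) := fun k u hu => by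
    have h1 := hu.1
    have h2 : 0 < 1 - u := by linarith [hu.2]
    simp only [hρ, tailInd]
    split_ifs with hk
    · have hk' : (K : ℝ) ≤ k := by exact_mod_cast hk
      rw [one_mul]
      exact mul_le_of_le_one_right (by positivity)
        (Real.rpow_le_one h2.le (by linarith) (by linarith))
    · rw [zero_mul]; positivity
  have hm0 : ∀ k, 0 ≤ m k := fun k => by
    have h1 : 0 ≤ Real.Gamma c * m k := by
      rw [← (hbeta k).2]
      exact setIntegral_nonneg measurableSet_Ioo (hρ0 k)
    exact nonneg_of_mul_nonneg_right h1 hG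
  have hgeom : GeomBdd m := by
    refine geomBdd_of_bdd (C := (∫ u in Set.Ioo (0 : ℝ) 1, u ^ (c - 1)) / Real.Gamma c) fun k => ?_
    rw [abs_of_nonneg (hm0 k), le_div_iff₀ hG, mul_comm, ← (hbeta k).2]
    exact setIntegral_mono_on (hbeta k).1 hpw measurableSet_Ioo (hρ1 k)
  refine ⟨hgeom, fun b => ?_⟩
  obtain ⟨C, hC, hbd⟩ := exists_dilate_bound n a b c K hc.le hK
  set I₀ := ∫ u in Set.Ioo (0 : ℝ) 1, u ^ (c - 1) with hI₀
  have hI₀0 : 0 ≤ I₀ := setIntegral_nonneg measurableSet_Ioo fun u hu => by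
    have := hu.1
    positivity
  refine ⟨(Real.Gamma c)⁻¹ * (C * (I₀ + 8 ^ c * Real.Gamma c)), by positivity,
    fun f hf z A hA hle => ?_⟩
  rw [show b - 2 * -c = b + 2 * c by ring]
  have hz := norm_nonneg z
  have hint : ∀ k, IntegrableOn (fun u => (ρ k u : ℂ) * homPart k f z) (Set.Ioo 0 1) := fun k =>
    (Integrable.ofReal (hbeta k).1).mul_const _
  have hnorm : ∀ k, ∫ u in Set.Ioo (0 : ℝ) 1, ‖(ρ k u : ℂ) * homPart k f z‖ =
      Real.Gamma c * ‖(m k : ℂ) * homPart k f z‖ := fun k => by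
    rw [norm_mul, Complex.norm_real, Real.norm_of_nonneg (hm0 k), ← mul_assoc, ← (hbeta k).2,
      ← integral_mul_const]
    refine setIntegral_congr_fun measurableSet_Ioo fun u hu => ?_
    rw [norm_mul, Complex.norm_real, Real.norm_of_nonneg (hρ0 k u hu)]
  have hsum := hasSum_integral_of_summable_integral_norm hint (by
    simp only [hnorm]
    exact (summable_norm_homMul hgeom hf z).mul_left _)
  -- Summing the beta integral over degrees represents the multiplier as the average of
  -- u^{c-1}(1-u)^{a-1} times the tail of f at (1-u)z.
  have hrep : (Real.Gamma c : ℂ) * homMul m f z =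
      ∫ u in Set.Ioo (0 : ℝ) 1, ∑' k, (ρ k u : ℂ) * homPart k f z := by
    refine HasSum.unique ?_ hsum
    refine ((hasSum_homMul hgeom hf z).mul_left (Real.Gamma c : ℂ)).congr_fun fun k => ?_
    rw [integral_mul_const, integral_complex_ofReal, (hbeta k).2]
    push_cast
    ring
  have hinner : ∀ u ∈ Set.Ioo (0 : ℝ) 1, ∑' k, (ρ k u : ℂ) * homPart k f z =
      ((u ^ (c - 1) * (1 - u) ^ (a - 1) : ℝ) : ℂ) *
        homMul (tailInd K) f (((1 - u : ℝ) : ℂ) • z) := fun u hu => by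
    rw [homMul, ← tsum_mul_left]
    refine tsum_congr fun k => ?_
    have h2 : 0 < 1 - u := by linarith [hu.2]
    rw [homPart_smul_arg hf, hρ]
    simp only
    rw [show a + k - 1 = a - 1 + k by ring, Real.rpow_add h2, Real.rpow_natCast]
    push_cast
    ring
  -- The integral of u^{c-1}e^{-Lu} is at most Γ(c)L^{-c}, which cancels the factor (1+|z|)^{2c}:
  -- this is the gain of order -c.
  set L := (1 + ‖z‖) ^ 2 / 8 with hL
  have hL0 : 0 < L := by positivity
  have hexp : IntegrableOn (fun u : ℝ => u ^ (c - 1) * Real.exp (-(L * u))) (Set.Ioi 0) := by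
    have h := integrableOn_rpow_mul_exp_neg_mul_rpow (p := 1) (s := c - 1) (b := L) (by linarith)
      one_pos hL0
    simpa using h
  have hexp' : IntegrableOn (fun u : ℝ => u ^ (c - 1) * Real.exp (-(L * u))) (Set.Ioo 0 1) :=
    hexp.mono_set Set.Ioo_subset_Ioi_self
  have hexpi : ∫ u in Set.Ioo (0 : ℝ) 1, u ^ (c - 1) * Real.exp (-(L * u)) ≤
      (1 / L) ^ c * Real.Gamma c := by
    rw [← Real.integral_rpow_mul_exp_neg_mul_Ioi hc hL0]
    refine setIntegral_mono_set hexp ?_ (Set.Ioo_subset_Ioi_self.eventuallyLE)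
    exact (ae_restrict_mem measurableSet_Ioi).mono fun u hu => by
      have : 0 < u := hu
      simp only [Pi.zero_apply]
      positivity
  have hfin : fockWgt (b + 2 * c) z * (Real.Gamma c * ‖homMul m f z‖) ≤
      C * A * (I₀ + 8 ^ c * Real.Gamma c) := by
    have h1 : Real.Gamma c * ‖homMul m f z‖ =
        ‖∫ u in Set.Ioo (0 : ℝ) 1, ∑' k, (ρ k u : ℂ) * homPart k f z‖ := by
      rw [← hrep, norm_mul, Complex.norm_real, Real.norm_of_nonneg hG.le]
    have h2 : fockWgt (b + 2 * c) z *
        ‖∫ u in Set.Ioo (0 : ℝ) 1, ∑' k, (ρ k u : ℂ) * homPart k f z‖ =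
        ‖∫ u in Set.Ioo (0 : ℝ) 1, (fockWgt (b + 2 * c) z : ℂ) *
          ∑' k, (ρ k u : ℂ) * homPart k f z‖ := by
      rw [integral_const_mul, norm_mul, Complex.norm_real,
        Real.norm_of_nonneg (fockWgt_pos _ _).le]
    rw [h1, h2]
    set G : ℝ → ℝ := fun u => C * A * (u ^ (c - 1) +
      (1 + ‖z‖) ^ (2 * c) * (u ^ (c - 1) * Real.exp (-(L * u)))) with hGdef
    have hGint : IntegrableOn G (Set.Ioo 0 1) :=
      (hpw.add (hexp'.const_mul ((1 + ‖z‖) ^ (2 * c)))).const_mul (C * A)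
    refine (norm_integral_le_of_norm_le hGint ?_).trans ?_
    · refine (ae_restrict_mem measurableSet_Ioo).mono fun u hu => ?_
      have hu0 := hu.1
      have h3 : 0 < 1 - u := by linarith [hu.2]
      have h4 := hbd f hf z A hA hle u hu
      rw [hinner u hu, norm_mul, norm_mul, Complex.norm_real, Complex.norm_real,
        Real.norm_of_nonneg (fockWgt_pos _ _).le, Real.norm_of_nonneg (by positivity)]
      calc _ = u ^ (c - 1) * (fockWgt (b + 2 * c) z * ((1 - u) ^ (a - 1) *
            ‖homMul (tailInd K) f (((1 - u : ℝ) : ℂ) • z)‖)) := by ring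
        _ ≤ u ^ (c - 1) * (C * A * (1 + (1 + ‖z‖) ^ (2 * c) * Real.exp (-(u * L)))) := by
            gcongr
        _ = _ := by rw [hGdef, mul_comm u L]; ring
    · have h5 : ∫ u in Set.Ioo (0 : ℝ) 1, G u = C * A * (I₀ + (1 + ‖z‖) ^ (2 * c) *
          ∫ u in Set.Ioo (0 : ℝ) 1, u ^ (c - 1) * Real.exp (-(L * u))) := by
        rw [hGdef, integral_const_mul, integral_add hpw (hexp'.const_mul _), integral_const_mul]
      rw [h5]
      refine mul_le_mul_of_nonneg_left (add_le_add_right ?_ _) (by positivity)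
      calc (1 + ‖z‖) ^ (2 * c) * ∫ u in Set.Ioo (0 : ℝ) 1, u ^ (c - 1) * Real.exp (-(L * u))
          ≤ (1 + ‖z‖) ^ (2 * c) * ((1 / L) ^ c * Real.Gamma c) := by gcongr
        _ = 8 ^ c * Real.Gamma c := by
            rw [← mul_assoc]
            congr 1
            rw [Real.rpow_mul (by positivity), ← Real.mul_rpow (by positivity) (by positivity)]
            congr 1
            rw [hL, Real.rpow_two]
            field_simp
  calc fockWgt (b + 2 * c) z * ‖homMul m f z‖
      = (Real.Gamma c)⁻¹ * (fockWgt (b + 2 * c) z * (Real.Gamma c * ‖homMul m f z‖)) := by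
        field_simp
    _ ≤ (Real.Gamma c)⁻¹ * (C * A * (I₀ + 8 ^ c * Real.Gamma c)) := by gcongr
    _ = _ := by ring

theorem mulOrd_prod_add (n : ℕ) (b : ℝ) (j : ℕ) :
    MulOrd n (fun k => ∏ i ∈ Finset.range j, (b + i + k)) j := by
  induction j with
  | zero => simpa using mulOrd_const n 1 le_rfl
  | succ j ih =>
    have h1 : MulOrd n (fun k => b + j + k) 1 :=
      (mulOrd_const n (b + j) zero_le_one).add (mulOrd_natCast n)
    have h2 := ih.mul h1
    rw [Nat.cast_succ]
    convert h2 using 1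
    funext k
    rw [Finset.prod_range_succ, Pi.mul_apply]

/-- `Γ(a+k)/Γ(b+k)` is a multiplier of order `a - b`. -/
theorem mulOrd_gamma_div (n : ℕ) (a b : ℝ) :
    MulOrd n (fun k => Real.Gamma (a + k) / Real.Gamma (b + k)) (a - b) := by
  -- With j > a - b the quotient factors as Γ(a+k)/Γ(b+j+k), of negative order a - b - j, times
  -- ∏_{i<j}(b+i+k), of order j; the identity holds for all large k.
  obtain ⟨j, hj⟩ := exists_nat_gt (a - b)
  have hc : 0 < b + j - a := by linarith
  have h := (mulOrd_gamma_div_of_pos n a hc).mul (mulOrd_prod_add n b j)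
  rw [show -(b + j - a) + j = a - b by ring] at h
  obtain ⟨K, hK⟩ := exists_nat_gt |b|
  refine h.congr (K := K) fun k hk => ?_
  have hk' : (K : ℝ) ≤ k := by exact_mod_cast hk
  have hbk : 0 < b + k := by linarith [neg_abs_le b]
  have hprod : Real.Gamma (b + j + k) =
      (∏ i ∈ Finset.range j, (b + i + k)) * Real.Gamma (b + k) := by
    clear hj hc h
    induction j with
    | zero => simp
    | succ j ih =>
      rw [Finset.prod_range_succ, mul_right_comm, ← ih, Nat.cast_succ, mul_comm,
        ← Real.Gamma_add_one (show 0 < b + j + (k : ℝ) by linarith [(j.cast_nonneg : (0 : ℝ) ≤ j)]).ne']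
      congr 1
      ring
  have hpos : 0 < ∏ i ∈ Finset.range j, (b + i + k) :=
    Finset.prod_pos fun i _ => by linarith [(i.cast_nonneg : (0 : ℝ) ≤ i)]
  rw [Pi.mul_apply, show a + (b + j - a) + k = b + j + k by ring, hprod]
  field_simp

end Beta

/-! ### Fock–Sobolev spaces as weighted Fock spaces. -/

section Spaces

variable {n : ℕ}

theorem fockN_smul (p : ℝ≥0∞) (b : ℝ) (c : ℂ) (f : Cn n → ℂ) :
    fockN p b (c • f) = ‖c‖ₑ * fockN p b f := by
  rw [fockN, fockN, ← eLpNorm_const_smul]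
  congr 1
  funext z
  simp only [Pi.smul_apply, smul_eq_mul]
  ring

theorem fockN_add_le (p : ℝ≥0∞) (b : ℝ) {f g : Cn n → ℂ} (hf : Continuous f) (hg : Continuous g) :
    fockN p b (f + g) ≤ ENNReal.LpAddConst p * (fockN p b f + fockN p b g) := by
  have h := eLpNorm_add_le' (continuous_fockWgt_mul b hf).aestronglyMeasurable
    (continuous_fockWgt_mul b hg).aestronglyMeasurable p (μ := fockV n)
  refine le_trans (le_of_eq ?_) h
  rw [fockN]
  congr 1
  funext z
  simp only [Pi.add_apply]
  ring

/-- The spare factor e^{-ε|z|²} absorbs (1+|z|)^b e^{|z|} and leaves e^{-|z|}, which lies in every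
L^p. -/
theorem exists_fockN_le_of_growth (n : ℕ) {p : ℝ≥0∞} (hp : p ≠ 0) (b : ℝ) {ε : ℝ} (hε : 0 < ε) :
    ∃ K : ℝ≥0∞, K ≠ ∞ ∧ ∀ (h : Cn n → ℂ) (C : ℝ), 0 ≤ C →
      (∀ z, ‖h z‖ ≤ C * Real.exp ((1 / 2 - ε) * ‖z‖ ^ 2)) → fockN p b h ≤ K * ENNReal.ofReal C := by
  set e : Cn n → ℝ := fun z => Real.exp (-‖z‖) with he
  obtain ⟨D, hD, hle⟩ := exists_rpow_mul_exp_le b 1 hε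
  have hfin : eLpNorm e p (fockV n) ≠ ∞ := by
    induction p with
    | top =>
      rw [eLpNorm_exponent_top]
      refine ((eLpNormEssSup_le_of_ae_bound (C := 1) (.of_forall fun z => ?_)).trans_lt
        ENNReal.ofReal_lt_top).ne
      rw [he, Real.norm_of_nonneg (Real.exp_pos _).le]
      exact Real.exp_le_one_iff.2 (by simp)
    | coe p =>
      have hp0 : 0 < (p : ℝ) := by
        have : p ≠ 0 := by simpa using hp
        positivity
      rw [eLpNorm_eq_lintegral_rpow_enorm_toReal hp ENNReal.coe_ne_top]
      refine ENNReal.rpow_ne_top_of_nonneg (by positivity) ?_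
      convert lintegral_exp_neg_norm_ne_top n hp0 using 3 with z
      rw [he, ← ofReal_norm, Real.norm_of_nonneg (Real.exp_pos _).le,
        ENNReal.ofReal_rpow_of_nonneg (Real.exp_pos _).le (by simp), ← Real.exp_mul]
      congr 2
      simp
      ring
  refine ⟨eLpNorm e p (fockV n) * ENNReal.ofReal D, ENNReal.mul_ne_top hfin ENNReal.ofReal_ne_top,
    fun h C hC hh => ?_⟩
  have h1 : fockN p b h ≤ eLpNorm ((D * C) • e) p (fockV n) := by
    refine eLpNorm_mono fun z => ?_
    rw [norm_fockWgt_mul, Pi.smul_apply, norm_smul, Real.norm_of_nonneg (by positivity),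
      Real.norm_of_nonneg (Real.exp_pos _).le]
    have h2 := hle ‖z‖ (norm_nonneg z)
    have h3 : fockWgt b z * Real.exp ((1 / 2 - ε) * ‖z‖ ^ 2) ≤ D * Real.exp (-‖z‖) := by
      rw [one_mul] at h2
      rw [fockWgt, Real.exp_neg, ← div_eq_mul_inv, le_div_iff₀ (Real.exp_pos _)]
      calc _ = (1 + ‖z‖) ^ b * Real.exp ‖z‖ *
            (Real.exp (-‖z‖ ^ 2 / 2) * Real.exp ((1 / 2 - ε) * ‖z‖ ^ 2)) := by ring
        _ ≤ D * Real.exp (ε * ‖z‖ ^ 2) *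
            (Real.exp (-‖z‖ ^ 2 / 2) * Real.exp ((1 / 2 - ε) * ‖z‖ ^ 2)) := by gcongr
        _ = D * (Real.exp (ε * ‖z‖ ^ 2) *
            (Real.exp (-‖z‖ ^ 2 / 2) * Real.exp ((1 / 2 - ε) * ‖z‖ ^ 2))) := by ring
        _ = D := by
            rw [← Real.exp_add, ← Real.exp_add, (Real.exp_eq_one_iff _).2 (by ring), mul_one]
    calc fockWgt b z * ‖h z‖ ≤ fockWgt b z * (C * Real.exp ((1 / 2 - ε) * ‖z‖ ^ 2)) :=
          mul_le_mul_of_nonneg_left (hh z) (fockWgt_pos _ _).le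
      _ = C * (fockWgt b z * Real.exp ((1 / 2 - ε) * ‖z‖ ^ 2)) := by ring
      _ ≤ C * (D * Real.exp (-‖z‖)) := by gcongr
      _ = _ := by ring
  refine h1.trans (le_of_eq ?_)
  rw [eLpNorm_const_smul, ← ofReal_norm, Real.norm_of_nonneg (by positivity),
    ENNReal.ofReal_mul hD.le]
  ring

theorem fockN_homPart_ne_top {p : ℝ≥0∞} (hp : p ≠ 0) (b : ℝ) {f : Cn n → ℂ}
    (hf : Differentiable ℂ f) (k : ℕ) : fockN p b (homPart k f) ≠ ∞ := by
  obtain ⟨S, hS⟩ := (isCompact_closedBall (0 : Cn n) 1).exists_bound_of_continuousOn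
    hf.continuous.continuousOn
  have hS' : ∀ w : Cn n, ‖w‖ ≤ 1 → ‖f w‖ ≤ S := fun w hw => hS w (by simpa using hw)
  have hS0 : 0 ≤ S := (norm_nonneg _).trans (hS' 0 (by simp))
  obtain ⟨D, hD, hle⟩ := exists_rpow_mul_exp_le k 0 (ε := 1 / 4) (by norm_num)
  obtain ⟨K, hK, h⟩ := exists_fockN_le_of_growth n hp b (ε := 1 / 4) (by norm_num)
  refine ne_top_of_le_ne_top ?_ (h (homPart k f) (S * D) (by positivity) fun z => ?_)
  · exact ENNReal.mul_ne_top hK ENNReal.ofReal_ne_top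
  · have h1 := hle ‖z‖ (norm_nonneg z)
    rw [zero_mul, Real.exp_zero, mul_one, Real.rpow_natCast] at h1
    calc ‖homPart k f z‖ ≤ S * (‖z‖ / 1) ^ k := norm_homPart_le_norm_pow hf one_pos hS' k z
      _ ≤ S * (D * Real.exp (1 / 4 * ‖z‖ ^ 2)) := by
          gcongr
          refine le_trans ?_ h1
          gcongr
          simp
      _ = _ := by norm_num; ring

/-- Entire functions with finite weighted norm. -/
def fockA (n : ℕ) (p : ℝ≥0∞) (b : ℝ) : Submodule ℂ (Cn n → ℂ) where
  carrier := {f | Differentiable ℂ f ∧ fockN p b f ≠ ∞}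
  zero_mem' := ⟨differentiable_const 0, by
    have : fockN p b (0 : Cn n → ℂ) = 0 := by simp [fockN]
    rw [this]; exact ENNReal.zero_ne_top⟩
  add_mem' := fun {f g} hf hg => ⟨hf.1.add hg.1, ne_top_of_le_ne_top
    (ENNReal.mul_ne_top (ENNReal.LpAddConst_lt_top p).ne (ENNReal.add_ne_top.2 ⟨hf.2, hg.2⟩))
    (fockN_add_le p b hf.1.continuous hg.1.continuous)⟩
  smul_mem' := fun c f hf => ⟨hf.1.const_smul c, by
    rw [fockN_smul]; exact ENNReal.mul_ne_top enorm_ne_top hf.2⟩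

theorem homPart_mem_fockA {p : ℝ≥0∞} (hp : p ≠ 0) (b : ℝ) {f : Cn n → ℂ}
    (hf : Differentiable ℂ f) (k : ℕ) : homPart k f ∈ fockA n p b :=
  ⟨differentiable_homPart hf k, fockN_homPart_ne_top hp b hf k⟩

theorem lowPart_mem_fockA {p : ℝ≥0∞} (hp : p ≠ 0) (b s : ℝ) {f : Cn n → ℂ}
    (hf : Differentiable ℂ f) : lowPart s f ∈ fockA n p b := by
  have h : lowPart s f = ∑ k ∈ Finset.range (⌊|s|⌋₊ + 1), homPart k f := by
    funext z; simp [lowPart]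
  rw [h]
  exact Submodule.sum_mem _ fun k _ => homPart_mem_fockA hp b hf k

theorem eLpNorm_gaussMul {p : ℝ} (hp : 0 < p) (α : ℝ) {ψ : Cn n → ℂ} (hψ : Continuous ψ) :
    eLpNorm (gaussMul ψ) (ENNReal.ofReal p) (fockVw n α) =
      fockN (ENNReal.ofReal p) (-(α / p)) ψ := by
  have hp' : ENNReal.ofReal p ≠ 0 := by simpa using hp
  rw [fockN, eLpNorm_eq_lintegral_rpow_enorm_toReal hp' ENNReal.ofReal_ne_top,
    eLpNorm_eq_lintegral_rpow_enorm_toReal hp' ENNReal.ofReal_ne_top, ENNReal.toReal_ofReal hp.le]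
  congr 1
  have hw : Continuous fun z : Cn n => 1 / (1 + ‖z‖) ^ α := by
    refine continuous_const.div ?_ fun z => by positivity
    exact (by fun_prop : Continuous fun z : Cn n => 1 + ‖z‖).rpow_const
      fun z => Or.inl (by positivity)
  have hg : Continuous (gaussMul ψ) := by unfold gaussMul; fun_prop
  rw [fockVw, lintegral_withDensity_eq_lintegral_mul _ (by fun_prop)
    (hg.enorm.measurable.pow_const p)]
  refine lintegral_congr fun z => ?_
  rw [Pi.mul_apply, ← ofReal_norm, ← ofReal_norm, norm_fockWgt_mul,
    ENNReal.ofReal_rpow_of_nonneg (norm_nonneg _) hp.le,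
    ENNReal.ofReal_rpow_of_nonneg (mul_nonneg (fockWgt_pos _ _).le (norm_nonneg _)) hp.le,
    ← ENNReal.ofReal_mul (by positivity)]
  congr 1
  rw [gaussMul, norm_mul, Complex.norm_real, Real.norm_of_nonneg (Real.exp_pos _).le, fockWgt,
    mul_right_comm _ _ ‖ψ z‖, Real.mul_rpow (by positivity) (by positivity),
    Real.mul_rpow (by positivity) (by positivity),
    Real.mul_rpow (by positivity) (by positivity), ← Real.rpow_mul (by positivity), neg_mul, div_mul_cancel₀ _ hp.ne', Real.rpow_neg (by positivity), one_div,
    mul_comm]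

theorem gaussMulInfty_eq (β : ℝ) (ψ : Cn n → ℂ) :
    gaussMulInfty β ψ = fun z => (fockWgt (-β) z : ℂ) * ψ z := by
  funext z
  rw [gaussMulInfty, fockWgt, Real.rpow_neg (by positivity), div_eq_mul_inv]

theorem fockSpace_top_eq (n : ℕ) (β : ℝ) : fockSpace n ∞ β = fockA n ∞ (-β) := by
  ext f
  refine and_congr_right fun hf => ?_
  have h : MemLw ∞ β f ↔ MemLp (gaussMulInfty β f) ∞ (fockV n) := by simp [MemLw]
  rw [h, gaussMulInfty_eq, MemLp, and_iff_right
    (continuous_fockWgt_mul _ hf.continuous).aestronglyMeasurable, lt_top_iff_ne_top, fockN]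

theorem normLw_top_eq (β : ℝ) (f : Cn n → ℂ) : normLw ∞ β f = (fockN ∞ (-β) f).toReal := by
  rw [normLw, if_pos rfl, gaussMulInfty_eq, fockN]

theorem normLw_eq {p : ℝ} (hp : 0 < p) (α : ℝ) {ψ : Cn n → ℂ} (hψ : Continuous ψ) :
    normLw (ENNReal.ofReal p) α ψ = (fockN (ENNReal.ofReal p) (-(α / p)) ψ).toReal := by
  rw [normLw, if_neg ENNReal.ofReal_ne_top, eLpNorm_gaussMul hp α hψ]

theorem memLw_iff {p : ℝ} (hp : 0 < p) (α : ℝ) {ψ : Cn n → ℂ} (hψ : Continuous ψ) :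
    MemLw (ENNReal.ofReal p) α ψ ↔ fockN (ENNReal.ofReal p) (-(α / p)) ψ ≠ ∞ := by
  have hg : Continuous (gaussMul ψ) := by unfold gaussMul; fun_prop
  have h : MemLw (ENNReal.ofReal p) α ψ ↔
      MemLp (gaussMul ψ) (ENNReal.ofReal p) (fockVw n α) := by simp [MemLw]
  rw [h, MemLp, and_iff_right hg.aestronglyMeasurable, lt_top_iff_ne_top, eLpNorm_gaussMul hp α hψ]

theorem fockN_fracR (p : ℝ≥0∞) (b s : ℝ) (f : Cn n → ℂ) :
    fockN p b (fracR s f) = fockN p (b - s) (fracD s f) := by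
  rw [fockN, fockN]
  congr 1
  funext z
  rw [fracR, ← mul_assoc, ← Complex.ofReal_mul, fockWgt, fockWgt, Real.rpow_sub (by positivity)]
  congr 2
  ring

theorem mulOrd_fracCoeff (n : ℕ) (s : ℝ) : MulOrd n (fracCoeff n s) s := by
  have h := mulOrd_gamma_div n (n + s) n
  rw [add_sub_cancel_left] at h
  obtain ⟨K, hK⟩ := exists_nat_gt |s|
  refine h.congr (K := K) fun k hk => ?_
  have hk' : (K : ℝ) ≤ k := by exact_mod_cast hk
  rw [fracCoeff, if_pos (Or.inr (by linarith))]

theorem mulOrd_fracCoeff_inv (n : ℕ) (s : ℝ) : MulOrd n (fun k => (fracCoeff n s k)⁻¹) (-s) := by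
  have h := mulOrd_gamma_div n n (n + s)
  rw [sub_add_cancel_left] at h
  obtain ⟨K, hK⟩ := exists_nat_gt |s|
  refine h.congr (K := K) fun k hk => ?_
  have hk' : (K : ℝ) ≤ k := by exact_mod_cast hk
  rw [fracCoeff, if_pos (Or.inr (by linarith)), inv_div]

theorem fracCoeff_pos {n : ℕ} (hn : 1 ≤ n) {s : ℝ} {k : ℕ} (h : 0 ≤ s ∨ |s| < (k : ℝ)) :
    0 < fracCoeff n s k := by
  have hn' : (1 : ℝ) ≤ n := by exact_mod_cast hn
  have hk : (0 : ℝ) ≤ k := k.cast_nonneg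
  rw [fracCoeff, if_pos h]
  refine div_pos (Real.Gamma_pos_of_pos ?_) (Real.Gamma_pos_of_pos (by linarith))
  rcases h with h | h
  · linarith
  · linarith [neg_abs_le s]

theorem differentiable_fracD (s : ℝ) {f : Cn n → ℂ} (hf : Differentiable ℂ f) :
    Differentiable ℂ (fracD s f) := differentiable_homMul (mulOrd_fracCoeff n s).1 hf

theorem continuous_fracR (s : ℝ) {f : Cn n → ℂ} (hf : Differentiable ℂ f) :
    Continuous (fracR s f) := by
  have h := (differentiable_fracD s hf).continuous
  have hw : Continuous fun z : Cn n => 1 / (1 + ‖z‖) ^ s := by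
    refine continuous_const.div ?_ fun z => by positivity
    exact (by fun_prop : Continuous fun z : Cn n => 1 + ‖z‖).rpow_const
      fun z => Or.inl (by positivity)
  unfold fracR
  fun_prop

theorem exists_fockN_lowPart_le (n : ℕ) {p : ℝ≥0∞} (hp : p ≠ 0) (b b' s : ℝ) :
    ∃ K : ℝ≥0∞, K ≠ ∞ ∧ ∀ f : Cn n → ℂ, Differentiable ℂ f →
      fockN p b' (lowPart s f) ≤ K * fockN p b f := by
  obtain ⟨K, hK, h⟩ := (mulOrd_of_support n (lowInd_of_le s) ((b - b') / 2)).exists_fockN_le hp b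
  refine ⟨K, hK, fun f hf => ?_⟩
  rw [lowPart_eq_homMul]
  have := h f hf
  rwa [show b - 2 * ((b - b') / 2) = b' by ring] at this

theorem exists_fockN_highPart_le (n : ℕ) {p : ℝ≥0∞} (hp : p ≠ 0) (b s : ℝ) :
    ∃ K : ℝ≥0∞, K ≠ ∞ ∧ ∀ f : Cn n → ℂ, Differentiable ℂ f →
      fockN p b (highPart s f) ≤ K * fockN p b f := by
  have h0 : MulOrd n (1 - lowInd s) 0 :=
    (mulOrd_const n 1 le_rfl).congr (K := ⌊|s|⌋₊ + 1) fun k hk => by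
      rw [Pi.sub_apply, lowInd_of_le s k hk]; simp
  obtain ⟨K, hK, h⟩ := h0.exists_fockN_le hp b
  refine ⟨K, hK, fun f hf => ?_⟩
  rw [highPart_eq_homMul s hf]
  simpa using h f hf

theorem lowPart_lowPart (s : ℝ) {f : Cn n → ℂ} (hf : Differentiable ℂ f) :
    lowPart s (lowPart s f) = lowPart s f := by
  rw [lowPart_eq_homMul, lowPart_eq_homMul, homMul_homMul (geomBdd_lowInd s) hf]
  congr 1
  funext k
  rw [Pi.mul_apply, lowInd]
  split_ifs <;> simp

/-- The part of the Fock–Sobolev norm that controls the low-degree terms. -/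
theorem exists_fockN_le_fracD {n : ℕ} (hn : 1 ≤ n) {p : ℝ≥0∞} (hp : p ≠ 0) (b c s : ℝ) :
    ∃ K : ℝ≥0∞, K ≠ ∞ ∧ ∀ f : Cn n → ℂ, Differentiable ℂ f →
      fockN p b f ≤ K * (fockN p (b - 2 * s) (fracD s f) +
        if 0 ≤ s then 0 else fockN p c (lowPart s f)) := by
  obtain ⟨K, hK, h⟩ := (mulOrd_fracCoeff_inv n s).exists_fockN_le hp (b - 2 * s)
  rw [show b - 2 * s - 2 * -s = b by ring] at h
  rcases le_or_gt 0 s with hs | hs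
  · refine ⟨K, hK, fun f hf => ?_⟩
    rw [if_pos hs, add_zero]
    have h1 := h _ (differentiable_fracD s hf)
    rw [fracD_eq_homMul, homMul_homMul (mulOrd_fracCoeff n s).1 hf,
      show ((fun k => (fracCoeff n s k)⁻¹) * fracCoeff n s) = 1 by
        funext k
        exact inv_mul_cancel₀ (fracCoeff_pos hn (Or.inl hs)).ne', homMul_one hf] at h1
    rwa [fracD_eq_homMul]
  · obtain ⟨K', hK', h'⟩ := exists_fockN_lowPart_le n hp c b s
    refine ⟨ENNReal.LpAddConst p * (K + K'), ENNReal.mul_ne_top (ENNReal.LpAddConst_lt_top p).ne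
      (ENNReal.add_ne_top.2 ⟨hK, hK'⟩), fun f hf => ?_⟩
    rw [if_neg hs.not_ge]
    have h1 := h _ (differentiable_fracD s hf)
    -- For s < 0 the coefficients vanish in degrees at most |s|, so inverting 𝒟^s recovers only the
    -- high part; the low part has to come from the second term of the norm.
    have hmul : ((fun k => (fracCoeff n s k)⁻¹) * fracCoeff n s) = 1 - lowInd s := by
      funext k
      rw [Pi.mul_apply, Pi.sub_apply, Pi.one_apply, lowInd]
      by_cases hk : |s| < (k : ℝ)
      · rw [inv_mul_cancel₀ (fracCoeff_pos hn (Or.inr hk)).ne',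
          if_neg (by rw [lt_floor_abs_iff]; exact not_le.2 hk), sub_zero]
      · rw [fracCoeff, if_neg (by rw [not_or]; exact ⟨not_le.2 hs, hk⟩), mul_zero,
          if_pos (by rw [lt_floor_abs_iff]; exact not_lt.1 hk), sub_self]
    have h2 : homMul (fun k => (fracCoeff n s k)⁻¹) (fracD s f) = highPart s f := by
      rw [fracD_eq_homMul, homMul_homMul (mulOrd_fracCoeff n s).1 hf, hmul,
        highPart_eq_homMul s hf]
    rw [h2] at h1
    have h3 := h' _ (lowPart_mem_fockA hp c s hf).1
    rw [lowPart_lowPart s hf] at h3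
    have h4 : f = highPart s f + lowPart s f := by funext z; simp [highPart]
    have hlow := (lowPart_mem_fockA hp c s hf).1
    have hhigh : Differentiable ℂ (highPart s f) := hf.sub hlow
    calc fockN p b f = fockN p b (highPart s f + lowPart s f) := by rw [← h4]
      _ ≤ ENNReal.LpAddConst p * (fockN p b (highPart s f) + fockN p b (lowPart s f)) :=
          fockN_add_le p b hhigh.continuous hlow.continuous
      _ ≤ ENNReal.LpAddConst p * ((K + K') * fockN p (b - 2 * s) (fracD s f) +
            (K + K') * fockN p c (lowPart s f)) := by
          gcongr
          · exact h1.trans (by gcongr; exact le_self_add)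
          · exact h3.trans (by gcongr; exact le_add_self)
      _ = _ := by ring

/-- 𝒟^s lowers the weight exponent by 2s, the factor (1+|z|)^{-s} in ℛ^s accounts for one s, and
dV_α for α/p: with b = s - α/p one has b - 2s = -(α/p) - s. Both inclusions follow from the orders s
and -s of 𝒟^s and its inverse. -/
theorem fockSobolev_eq {n : ℕ} (hn : 1 ≤ n) {p : ℝ} (hp : 0 < p) (α s : ℝ) :
    fockSobolev n (ENNReal.ofReal p) α s = fockA n (ENNReal.ofReal p) (s - α / p) := by
  have hp' : ENNReal.ofReal p ≠ 0 := by simpa using hp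
  ext f
  refine and_congr_right fun hf => ?_
  rw [memLw_iff hp α (continuous_fracR s hf), fockN_fracR]
  have he : -(α / p) - s = s - α / p - 2 * s := by ring
  rw [he]
  constructor
  · intro h
    obtain ⟨K, hK, hle⟩ := exists_fockN_le_fracD hn hp' (s - α / p) 0 s
    refine ne_top_of_le_ne_top (ENNReal.mul_ne_top hK (ENNReal.add_ne_top.2 ⟨h, ?_⟩)) (hle f hf)
    split_ifs
    · exact ENNReal.zero_ne_top
    · exact (lowPart_mem_fockA hp' 0 s hf).2
  · intro h
    obtain ⟨K, hK, hle⟩ := (mulOrd_fracCoeff n s).exists_fockN_le hp' (s - α / p)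
    exact ne_top_of_le_ne_top (ENNReal.mul_ne_top hK h) (hle f hf)

theorem exists_fockSobolevNorm_equiv {n : ℕ} (hn : 1 ≤ n) {p : ℝ} (hp : 0 < p) (α s : ℝ) :
    ∃ C : ℝ, 0 < C ∧ ∀ f ∈ fockA n (ENNReal.ofReal p) (s - α / p),
      (fockN (ENNReal.ofReal p) (s - α / p) f).toReal ≤
        C * fockSobolevNorm (ENNReal.ofReal p) α s f ∧
      fockSobolevNorm (ENNReal.ofReal p) α s f ≤
        C * (fockN (ENNReal.ofReal p) (s - α / p) f).toReal := by
  have hp' : ENNReal.ofReal p ≠ 0 := by simpa using hp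
  set P := ENNReal.ofReal p with hP
  set b := s - α / p with hb
  obtain ⟨K₁, hK₁, h1⟩ := exists_fockN_le_fracD hn hp' b (-(α / p)) s
  obtain ⟨K₂, hK₂, h2⟩ := (mulOrd_fracCoeff n s).exists_fockN_le hp' b
  obtain ⟨K₃, hK₃, h3⟩ := exists_fockN_lowPart_le n hp' b (-(α / p)) s
  have he : -(α / p) - s = b - 2 * s := by rw [hb]; ring
  refine ⟨K₁.toReal + K₂.toReal + K₃.toReal + 1, by positivity, fun f hf => ?_⟩
  have hlow := lowPart_mem_fockA hp' (-(α / p)) s hf.1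
  have hDt : fockN P (b - 2 * s) (fracD s f) ≠ ∞ :=
    ne_top_of_le_ne_top (ENNReal.mul_ne_top hK₂ hf.2) (h2 f hf.1)
  have hLt : (if 0 ≤ s then 0 else fockN P (-(α / p)) (lowPart s f)) ≠ ∞ := by
    split_ifs
    · exact ENNReal.zero_ne_top
    · exact hlow.2
  have hnorm : fockSobolevNorm P α s f = (fockN P (b - 2 * s) (fracD s f) +
      if 0 ≤ s then 0 else fockN P (-(α / p)) (lowPart s f)).toReal := by
    rw [ENNReal.toReal_add hDt hLt, fockSobolevNorm, normLw_eq hp α (continuous_fracR s hf.1),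
      normLw_eq hp α hlow.1.continuous, fockN_fracR, he]
    split_ifs
    · rw [ENNReal.toReal_zero, add_zero]
    · rfl
  have hN0 : 0 ≤ fockSobolevNorm P α s f := by rw [hnorm]; exact ENNReal.toReal_nonneg
  constructor
  · have h4 := ENNReal.toReal_mono
      (ENNReal.mul_ne_top hK₁ (ENNReal.add_ne_top.2 ⟨hDt, hLt⟩)) (h1 f hf.1)
    rw [ENNReal.toReal_mul, ← hnorm] at h4
    refine h4.trans (mul_le_mul_of_nonneg_right ?_ hN0)
    linarith [@ENNReal.toReal_nonneg K₂, @ENNReal.toReal_nonneg K₃]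
  · have h5 := ENNReal.toReal_mono (ENNReal.mul_ne_top hK₂ hf.2) (h2 f hf.1)
    have h6 := ENNReal.toReal_mono (ENNReal.mul_ne_top hK₃ hf.2) (h3 f hf.1)
    rw [ENNReal.toReal_mul] at h5 h6
    have h7 : (if 0 ≤ s then 0 else fockN P (-(α / p)) (lowPart s f)).toReal ≤
        K₃.toReal * (fockN P b f).toReal := by
      split_ifs
      · rw [ENNReal.toReal_zero]; positivity
      · exact h6
    rw [hnorm, ENNReal.toReal_add hDt hLt]
    have h8 : fockN P (b - 2 * s) (fracD s f) = fockN P (b - 2 * s) (homMul (fracCoeff n s) f) := rfl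
    rw [h8]
    have h9 : 0 ≤ K₁.toReal * (fockN P b f).toReal := by positivity
    nlinarith [@ENNReal.toReal_nonneg (fockN P b f)]

end Spaces

/-! ### Density of polynomials for finite p. -/

section Density

variable {n : ℕ}

theorem ennreal_add_rpow_le (x y : ℝ≥0∞) {p : ℝ} (hp : 0 < p) :
    (x + y) ^ p ≤ 2 ^ p * (x ^ p + y ^ p) := by
  have h1 : x + y ≤ 2 * max x y := by
    rw [two_mul]; exact add_le_add (le_max_left _ _) (le_max_right _ _)
  refine (ENNReal.rpow_le_rpow h1 hp.le).trans ?_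
  rw [ENNReal.mul_rpow_of_nonneg _ _ hp.le]
  gcongr
  rcases le_total x y with h | h
  · rw [max_eq_right h]; exact le_add_self
  · rw [max_eq_left h]; exact le_self_add

/-- Dominated convergence with majorant `fockSmooth`. It dominates f(z) directly, and f((1-u)z)
because the loss e^{u|z|} from moving the base point is absorbed by `exists_dilate_weight_bound`. -/
theorem tendsto_fockN_dilate {p : ℝ} (hp : 0 < p) {b : ℝ} {f : Cn n → ℂ}
    (hf : f ∈ fockA n (ENNReal.ofReal p) b) {u : ℕ → ℝ} (hu0 : ∀ j, 0 ≤ u j)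
    (hu : ∀ j, u j ≤ 1 / 2) (hlim : Filter.Tendsto u Filter.atTop (nhds 0)) :
    Filter.Tendsto (fun j => fockN (ENNReal.ofReal p) b
      (f - fun z => f (((1 - u j : ℝ) : ℂ) • z))) Filter.atTop (nhds 0) := by
  obtain ⟨C₁, hC₁, h1⟩ := exists_le_fockSmooth n b hp
  obtain ⟨C₂, hC₂, h2⟩ := exists_dilate_weight_bound n b
  have hfc := hf.1.continuous
  have hcont : ∀ j, Continuous (f - fun z => f (((1 - u j : ℝ) : ℂ) • z)) := fun j =>
    hfc.sub (hfc.comp (continuous_const_smul _))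
  set M : ℝ≥0∞ := 2 ^ p * (C₁ + ENNReal.ofReal C₂ ^ p * C₁) with hM
  have hMt : M ≠ ∞ := by
    refine ENNReal.mul_ne_top (ENNReal.rpow_ne_top_of_nonneg hp.le (by simp))
      (ENNReal.add_ne_top.2 ⟨hC₁, ENNReal.mul_ne_top
        (ENNReal.rpow_ne_top_of_nonneg hp.le ENNReal.ofReal_ne_top) hC₁⟩)
  have hfin : ∫⁻ z, fockSmooth p b f z ∂(fockV n) ≠ ∞ := by
    rw [lintegral_fockSmooth hfc, ← fockN_rpow hp]
    exact ENNReal.mul_ne_top (lintegral_exp_neg_norm_ne_top n hp)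
      (ENNReal.rpow_ne_top_of_nonneg hp.le hf.2)
  suffices h : Filter.Tendsto (fun j => fockN (ENNReal.ofReal p) b
      (f - fun z => f (((1 - u j : ℝ) : ℂ) • z)) ^ p) Filter.atTop (nhds 0) by
    have h3 := (ENNReal.continuous_rpow_const (y := 1 / p)).tendsto 0 |>.comp h
    rw [ENNReal.zero_rpow_of_pos (by positivity)] at h3
    refine h3.congr fun j => ?_
    simp only [Function.comp]
    rw [← ENNReal.rpow_mul, mul_one_div_cancel hp.ne', ENNReal.rpow_one]
  simp only [fockN_rpow hp]
  have hzero : ∫⁻ _ : Cn n, (0 : ℝ≥0∞) ∂(fockV n) = 0 := lintegral_zero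
  rw [← hzero]
  refine tendsto_lintegral_of_dominated_convergence (fun z => M * fockSmooth p b f z)
    (fun j => (continuous_fockWgt_mul b (hcont j)).enorm.measurable.pow_const p)
    (fun j => .of_forall fun z => ?_) ?_ (.of_forall fun z => ?_)
  · have hx : ‖(fockWgt b z : ℂ) * f z‖ₑ ^ p ≤ C₁ * fockSmooth p b f z := by
      simpa using h1 f hf.1 z z
    have hy : ‖(fockWgt b z : ℂ) * f (((1 - u j : ℝ) : ℂ) • z)‖ₑ ^ p ≤
        ENNReal.ofReal C₂ ^ p * C₁ * fockSmooth p b f z := by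
      set w := ((1 - u j : ℝ) : ℂ) • z with hw
      have h4 : ‖z - w‖ = u j * ‖z‖ := by
        have : z - w = (u j : ℂ) • z := by
          rw [hw, Complex.ofReal_sub, sub_smul, Complex.ofReal_one, one_smul, sub_sub_cancel]
        rw [this, norm_smul, Complex.norm_real, Real.norm_of_nonneg (hu0 j)]
      have h5 := h1 f hf.1 z w
      have h6 := h2 z (u j) (hu0 j) (hu j)
      rw [← hw] at h6
      have h7 : ‖(fockWgt b z : ℂ) * f w‖ₑ ≤ ENNReal.ofReal (C₂ * Real.exp (-‖z - w‖)) *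
          ‖(fockWgt b w : ℂ) * f w‖ₑ := by
        rw [← ofReal_norm, ← ofReal_norm, ← ENNReal.ofReal_mul (by positivity), norm_mul,
          norm_fockWgt_mul, Complex.norm_real, Real.norm_of_nonneg (fockWgt_pos b z).le,
          ← mul_assoc]
        refine ENNReal.ofReal_le_ofReal (mul_le_mul_of_nonneg_right ?_ (norm_nonneg _))
        rw [Real.exp_neg, mul_right_comm, ← div_eq_mul_inv, le_div_iff₀ (Real.exp_pos _), h4]
        refine h6.trans (mul_le_of_le_one_right (mul_nonneg hC₂.le (fockWgt_pos _ _).le)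
          (Real.exp_le_one_iff.2 ?_))
        have := hu0 j
        have : 0 ≤ u j * ((1 + ‖z‖) ^ 2 / 8) := by positivity
        linarith
      refine (ENNReal.rpow_le_rpow h7 hp.le).trans ?_
      rw [ENNReal.mul_rpow_of_nonneg _ _ hp.le, ENNReal.ofReal_mul hC₂.le,
        ENNReal.mul_rpow_of_nonneg _ _ hp.le, ENNReal.ofReal_rpow_of_nonneg
        (Real.exp_pos _).le hp.le, ← Real.exp_mul]
      calc _ ≤ ENNReal.ofReal C₂ ^ p * ENNReal.ofReal (Real.exp (-‖z - w‖ * p)) *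
            (ENNReal.ofReal (Real.exp (p * ‖z - w‖)) * (C₁ * fockSmooth p b f z)) := by gcongr
        _ = ENNReal.ofReal C₂ ^ p * (ENNReal.ofReal (Real.exp (-‖z - w‖ * p)) *
            ENNReal.ofReal (Real.exp (p * ‖z - w‖))) * (C₁ * fockSmooth p b f z) := by ring
        _ = _ := by
            rw [← ENNReal.ofReal_mul (by positivity), ← Real.exp_add,
              (Real.exp_eq_one_iff _).2 (by ring), ENNReal.ofReal_one, mul_one, mul_assoc]
    have h8 : ‖(fockWgt b z : ℂ) * (f - fun z => f (((1 - u j : ℝ) : ℂ) • z)) z‖ₑ ≤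
        ‖(fockWgt b z : ℂ) * f z‖ₑ + ‖(fockWgt b z : ℂ) * f (((1 - u j : ℝ) : ℂ) • z)‖ₑ := by
      rw [Pi.sub_apply, mul_sub]
      exact enorm_sub_le
    calc _ ≤ _ := ENNReal.rpow_le_rpow h8 hp.le
      _ ≤ _ := ennreal_add_rpow_le _ _ hp
      _ ≤ 2 ^ p * (C₁ * fockSmooth p b f z +
          ENNReal.ofReal C₂ ^ p * C₁ * fockSmooth p b f z) := by gcongr
      _ = _ := by rw [hM]; ring
  · rw [lintegral_const_mul' _ _ hMt]
    exact ENNReal.mul_ne_top hMt hfin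
  · have h9 : Filter.Tendsto (fun j => ((1 - u j : ℝ) : ℂ) • z) Filter.atTop (nhds z) := by
      have : Filter.Tendsto (fun j => ((1 - u j : ℝ) : ℂ)) Filter.atTop (nhds ((1 - 0 : ℝ) : ℂ)) :=
        (Complex.continuous_ofReal.tendsto _).comp (hlim.const_sub 1)
      simpa using this.smul_const z
    have h10 : Filter.Tendsto (fun j => (fockWgt b z : ℂ) *
        (f - fun z => f (((1 - u j : ℝ) : ℂ) • z)) z) Filter.atTop (nhds 0) := by
      have h11 := ((hfc.tendsto z).comp h9).const_sub (f z)
      rw [sub_self] at h11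
      simpa using h11.const_mul (fockWgt b z : ℂ)
    have h12 := ((continuous_enorm.tendsto _).comp h10)
    have h13 := ((ENNReal.continuous_rpow_const (y := p)).tendsto _).comp h12
    rw [enorm_zero, ENNReal.zero_rpow_of_pos hp] at h13
    exact h13

/-- Taylor polynomials of a dilation. -/
noncomputable def dilateTaylor (r : ℝ) (K : ℕ) (f : Cn n → ℂ) : Cn n → ℂ :=
  ∑ k ∈ Finset.range K, ((r : ℂ) ^ k) • homPart k f

/-- A dilated function grows strictly more slowly than e^{|z|²/2}, which leaves room for Cauchy's
estimate to make its Taylor tail geometrically small with a growth still covered by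
`exists_fockN_le_of_growth`. -/
theorem tendsto_fockN_dilateTaylor {p : ℝ≥0∞} (hp : p ≠ 0) {b : ℝ} {f : Cn n → ℂ}
    (hf : f ∈ fockA n p b) {r : ℝ} (hr0 : 0 < r) (hr1 : r < 1) :
    Filter.Tendsto (fun K => fockN p b ((fun z => f ((r : ℂ) • z)) - dilateTaylor r K f))
      Filter.atTop (nhds 0) := by
  obtain ⟨C₁, hC₁, h1⟩ := exists_fockWgt_mul_le n hp b
  -- Chosen so that r(1/2 + (1-r)/2) = 1/2 - ε.
  set ε := (1 - r) ^ 2 / 2 with hε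
  have hr1' : 0 < 1 - r := by linarith
  have hε0 : 0 < ε := by positivity
  obtain ⟨C₂, hC₂, h2⟩ := exists_rpow_mul_exp_le (-b) 0 (ε := (1 - r) / 2) (by positivity)
  set M := C₁ * (fockN p b f).toReal * C₂ with hM
  have hM0 : 0 ≤ M := by positivity
  have hfb : ∀ w, ‖f w‖ ≤ M * Real.exp ((1 / 2 + (1 - r) / 2) * ‖w‖ ^ 2) := fun w => by
    have h3 := h1 f hf.1 hf.2 w
    have h4 := h2 ‖w‖ (norm_nonneg w)
    rw [zero_mul, Real.exp_zero, mul_one] at h4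
    have h5 : fockWgt b w * ((1 + ‖w‖) ^ (-b) * Real.exp (‖w‖ ^ 2 / 2)) = 1 := by
      rw [fockWgt, Real.rpow_neg (by positivity), neg_div, Real.exp_neg]
      field_simp
    calc ‖f w‖ = (fockWgt b w * ‖f w‖) * ((1 + ‖w‖) ^ (-b) * Real.exp (‖w‖ ^ 2 / 2)) := by
          rw [mul_right_comm, h5, one_mul]
      _ ≤ (C₁ * (fockN p b f).toReal) *
          (C₂ * Real.exp ((1 - r) / 2 * ‖w‖ ^ 2) * Real.exp (‖w‖ ^ 2 / 2)) := by gcongr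
      _ = _ := by
          rw [mul_assoc C₂, ← Real.exp_add, hM, mul_assoc _ C₂]
          ring_nf
  -- Cauchy on |t| = √r splits the dilation: ρ² = r goes into the growth exponent, and r^k/ρ^k = ρ^k
  -- remains as geometric decay.
  set ρ := Real.sqrt r with hρ
  have hρ0 : 0 < ρ := Real.sqrt_pos.2 hr0
  have hρ2 : ρ ^ 2 = r := Real.sq_sqrt hr0.le
  have hρ1 : ρ < 1 := by
    rw [hρ, Real.sqrt_lt' one_pos]; simpa using hr1
  have hpart : ∀ k z, ‖((r : ℂ) ^ k) * homPart k f z‖ ≤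
      ρ ^ k * (M * Real.exp ((1 / 2 - ε) * ‖z‖ ^ 2)) := fun k z => by
    have h6 := norm_homPart_le hf.1 k z hρ0 (C := M * Real.exp ((1 / 2 - ε) * ‖z‖ ^ 2))
      fun t ht => by
        refine (hfb _).trans (le_of_eq ?_)
        rw [norm_smul, ht, mul_pow, hρ2, hε]
        ring_nf
    rw [norm_mul, norm_pow, Complex.norm_real, Real.norm_of_nonneg hr0.le, ← hρ2]
    calc (ρ ^ 2) ^ k * ‖homPart k f z‖
        ≤ (ρ ^ 2) ^ k * (M * Real.exp ((1 / 2 - ε) * ‖z‖ ^ 2) / ρ ^ k) := by gcongr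
      _ = _ := by
          rw [← pow_mul, mul_comm 2 k, pow_mul]
          field_simp
  have htail : ∀ K z, ‖((fun z => f ((r : ℂ) • z)) - dilateTaylor r K f) z‖ ≤
      (M * (ρ ^ K * (1 - ρ)⁻¹)) * Real.exp ((1 / 2 - ε) * ‖z‖ ^ 2) := fun K z => by
    have h7 := hasSum_homPart hf.1 ((r : ℂ) • z)
    simp only [homPart_smul_arg hf.1] at h7
    have h8 := (hasSum_nat_add_iff' K).2 h7
    have h9 : ((fun z => f ((r : ℂ) • z)) - dilateTaylor r K f) z =
        f ((r : ℂ) • z) - ∑ k ∈ Finset.range K, (r : ℂ) ^ k * homPart k f z := by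
      simp [dilateTaylor]
    rw [h9]
    have h10 := ((hasSum_geometric_of_lt_one hρ0.le hρ1).mul_left (ρ ^ K)).mul_right
      (M * Real.exp ((1 / 2 - ε) * ‖z‖ ^ 2))
    refine (h8.norm_le_of_bounded h10 fun k => ?_).trans (le_of_eq (by ring))
    refine (hpart (k + K) z).trans (le_of_eq ?_)
    rw [pow_add]
    ring
  obtain ⟨D, hD, h11⟩ := exists_fockN_le_of_growth n hp b hε0
  have hlim : Filter.Tendsto (fun K : ℕ => D * ENNReal.ofReal (M * (ρ ^ K * (1 - ρ)⁻¹)))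
      Filter.atTop (nhds 0) := by
    have h12 : Filter.Tendsto (fun K : ℕ => M * (ρ ^ K * (1 - ρ)⁻¹)) Filter.atTop (nhds 0) := by
      have := ((tendsto_pow_atTop_nhds_zero_of_lt_one hρ0.le hρ1).mul_const (1 - ρ)⁻¹).const_mul M
      simpa using this
    have h13 := ENNReal.Tendsto.const_mul (ENNReal.tendsto_ofReal h12) (Or.inr hD)
    simpa using h13
  have hρ3 : 0 < 1 - ρ := by linarith
  refine tendsto_of_tendsto_of_tendsto_of_le_of_le tendsto_const_nhds hlim
    (fun _ => zero_le) fun K => h11 _ _ (by positivity) (htail K)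

theorem exists_dilateTaylor_approx {p : ℝ} (hp : 0 < p) {b : ℝ} {f : Cn n → ℂ}
    (hf : f ∈ fockA n (ENNReal.ofReal p) b) {ε : ℝ≥0∞} (hε : ε ≠ 0) :
    ∃ r K, fockN (ENNReal.ofReal p) b (f - dilateTaylor r K f) < ε := by
  have hp' : ENNReal.ofReal p ≠ 0 := by simpa using hp
  set L := ENNReal.LpAddConst (ENNReal.ofReal p) with hL
  have hLt : L ≠ ∞ := (ENNReal.LpAddConst_lt_top _).ne
  obtain ⟨δ, hδ0, hδ⟩ : ∃ δ : ℝ≥0∞, 0 < δ ∧ L * (δ + δ) < ε := by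
    have hc : Filter.Tendsto (fun δ : ℝ≥0∞ => L * (δ + δ)) (nhds 0) (nhds 0) := by
      have h1 : Filter.Tendsto (fun δ : ℝ≥0∞ => δ + δ) (nhds 0) (nhds 0) := by
        have h : Continuous fun δ : ℝ≥0∞ => δ + δ := by fun_prop
        simpa using h.tendsto 0
      simpa using ENNReal.Tendsto.const_mul h1 (Or.inr hLt)
    have h2 := hc.eventually (gt_mem_nhds (pos_iff_ne_zero.2 hε))
    obtain ⟨δ, h3, h4⟩ := ((h2.filter_mono nhdsWithin_le_nhds).and
      (self_mem_nhdsWithin : Set.Ioi (0 : ℝ≥0∞) ∈ nhdsWithin 0 (Set.Ioi 0))).exists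
    exact ⟨δ, h4, h3⟩
  have hlim : Filter.Tendsto (fun j : ℕ => 1 / ((j : ℝ) + 1) / 2) Filter.atTop (nhds 0) := by
    simpa using tendsto_one_div_add_atTop_nhds_zero_nat.div_const (2 : ℝ)
  have hle : ∀ j : ℕ, 1 / ((j : ℝ) + 1) / 2 ≤ 1 / 2 := fun j => by
    have : 1 / ((j : ℝ) + 1) ≤ 1 := by
      rw [div_le_one (by positivity)]
      linarith [(j.cast_nonneg : (0 : ℝ) ≤ j)]
    linarith
  have h1 := tendsto_fockN_dilate hp hf (u := fun j : ℕ => 1 / ((j : ℝ) + 1) / 2)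
    (fun j => by positivity) hle hlim
  obtain ⟨j, hj⟩ := (h1.eventually (gt_mem_nhds hδ0)).exists
  set r := 1 - 1 / ((j : ℝ) + 1) / 2 with hr
  have hr0 : 0 < r := by have := hle j; linarith
  have hr1 : r < 1 := by
    have : 0 < 1 / ((j : ℝ) + 1) / 2 := by positivity
    linarith
  have h2 := tendsto_fockN_dilateTaylor hp' hf hr0 hr1
  obtain ⟨K, hK⟩ := (h2.eventually (gt_mem_nhds hδ0)).exists
  refine ⟨r, K, lt_of_le_of_lt ?_ hδ⟩
  have h3 : f - dilateTaylor r K f = (f - fun z => f ((r : ℂ) • z)) +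
      ((fun z => f ((r : ℂ) • z)) - dilateTaylor r K f) := by abel
  have hc1 : Continuous fun z => f ((r : ℂ) • z) := hf.1.continuous.comp (continuous_const_smul _)
  have hc2 : Continuous (dilateTaylor r K f) := by
    rw [show dilateTaylor r K f = fun z => ∑ k ∈ Finset.range K, (((r : ℂ) ^ k) • homPart k f) z by
      funext z; simp [dilateTaylor]]
    exact continuous_finsetSum _ fun k _ =>
      (differentiable_homPart hf.1 k).continuous.const_smul _
  rw [h3]
  refine (fockN_add_le _ b (hf.1.continuous.sub hc1) (hc1.sub hc2)).trans ?_
  gcongr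

/-- A bounded functional that vanishes on the homogeneous parts vanishes. -/
theorem eq_zero_of_homPart {p : ℝ} (hp : 0 < p) {b : ℝ}
    (ν : fockA n (ENNReal.ofReal p) b →ₗ[ℂ] ℂ) {C : ℝ}
    (hν : ∀ f, ‖ν f‖ ≤ C * (fockN (ENNReal.ofReal p) b (f : Cn n → ℂ)).toReal)
    (h0 : ∀ (f : fockA n (ENNReal.ofReal p) b) (k : ℕ) (h : homPart k (f : Cn n → ℂ) ∈
      fockA n (ENNReal.ofReal p) b), ν ⟨homPart k (f : Cn n → ℂ), h⟩ = 0) : ν = 0 := by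
  have hp' : ENNReal.ofReal p ≠ 0 := by simpa using hp
  ext f
  rw [LinearMap.zero_apply]
  have hT : ∀ r K, ∃ h : dilateTaylor r K (f : Cn n → ℂ) ∈ fockA n (ENNReal.ofReal p) b,
      ν ⟨_, h⟩ = 0 := fun r K => by
    have hmem : ∀ k, homPart k (f : Cn n → ℂ) ∈ fockA n (ENNReal.ofReal p) b := fun k =>
      homPart_mem_fockA hp' b f.2.1 k
    refine ⟨Submodule.sum_mem _ fun k _ => Submodule.smul_mem _ _ (hmem k), ?_⟩
    have h1 : (⟨dilateTaylor r K (f : Cn n → ℂ), Submodule.sum_mem _ fun k _ =>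
        Submodule.smul_mem _ _ (hmem k)⟩ : fockA n (ENNReal.ofReal p) b) =
        ∑ k ∈ Finset.range K, ((r : ℂ) ^ k) • (⟨_, hmem k⟩ : fockA n (ENNReal.ofReal p) b) := by
      ext1
      simp [dilateTaylor]
    rw [h1, map_sum]
    exact Finset.sum_eq_zero fun k _ => by rw [map_smul, h0, smul_zero]
  by_contra hne
  have hpos : 0 < ‖ν f‖ := norm_pos_iff.2 hne
  set D := |C| + 1 with hD
  have hD0 : 0 < D := by positivity
  obtain ⟨r, K, h2⟩ := exists_dilateTaylor_approx hp f.2 (ε := ENNReal.ofReal (‖ν f‖ / D))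
    (by simpa using by positivity)
  obtain ⟨hm, h3⟩ := hT r K
  have h4 := hν (f - ⟨_, hm⟩)
  rw [map_sub, h3, sub_zero] at h4
  have h5 : (fockN (ENNReal.ofReal p) b ((f : Cn n → ℂ) - dilateTaylor r K (f : Cn n → ℂ))).toReal <
      ‖ν f‖ / D := by
    rw [← ENNReal.toReal_ofReal (div_nonneg hpos.le hD0.le)]
    exact ENNReal.toReal_strict_mono ENNReal.ofReal_ne_top h2
  rw [lt_div_iff₀ hD0] at h5
  have h6 : C ≤ D := (le_abs_self C).trans (by linarith)
  have h7 : ‖ν f‖ ≤ C * (fockN (ENNReal.ofReal p) b ((f : Cn n → ℂ) - dilateTaylor r K (f : Cn n → ℂ))).toReal :=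
    h4
  nlinarith [@ENNReal.toReal_nonneg (fockN (ENNReal.ofReal p) b
    ((f : Cn n → ℂ) - dilateTaylor r K (f : Cn n → ℂ)))]

end Density

/-! ### Boundedness of the pairing. -/

section Pairing

variable {n : ℕ}

/-- `q` is the exponent of the Fock space dual to the one of exponent `p`. -/
def DualExp (p : ℝ) (q : ℝ≥0∞) : Prop :=
  (∃ r : ℝ, p.HolderConjugate r ∧ q = ENNReal.ofReal r) ∨ (0 < p ∧ p ≤ 1 ∧ q = ∞)

theorem DualExp.pos {p : ℝ} {q : ℝ≥0∞} (h : DualExp p q) : 0 < p := by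
  rcases h with ⟨r, hr, -⟩ | ⟨h, -⟩
  exacts [hr.pos, h]

theorem DualExp.ne_zero {p : ℝ} {q : ℝ≥0∞} (h : DualExp p q) : q ≠ 0 := by
  rcases h with ⟨r, hr, rfl⟩ | ⟨-, -, rfl⟩
  · simpa using hr.symm.pos
  · simp

theorem fockN_eq_lintegral {p : ℝ} (hp : 0 < p) (b : ℝ) (f : Cn n → ℂ) :
    fockN (ENNReal.ofReal p) b f =
      (∫⁻ z, ‖(fockWgt b z : ℂ) * f z‖ₑ ^ p ∂(fockV n)) ^ (1 / p) := by
  rw [← fockN_rpow hp, ← ENNReal.rpow_mul, one_div, mul_inv_cancel₀ hp.ne', ENNReal.rpow_one]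

/-- Hölder for conjugate exponents. For p ≤ 1, write x = x^{1-p}x^p for the weighted modulus x of f
and bound the first factor and g pointwise by their norms. -/
theorem exists_lintegral_mul_le (n : ℕ) {p : ℝ} {q : ℝ≥0∞} (h : DualExp p q) (b b' : ℝ) :
    ∃ C : ℝ≥0∞, C ≠ ∞ ∧ ∀ f ∈ fockA n (ENNReal.ofReal p) b, ∀ g ∈ fockA n q b',
      ∫⁻ z, ‖(fockWgt b z : ℂ) * f z‖ₑ * ‖(fockWgt b' z : ℂ) * g z‖ₑ ∂(fockV n) ≤
        C * (fockN (ENNReal.ofReal p) b f * fockN q b' g) := by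
  have hp := h.pos
  rcases h with ⟨r, hr, rfl⟩ | ⟨-, hp1, rfl⟩
  · refine ⟨1, by simp, fun f hf g hg => ?_⟩
    rw [one_mul, fockN_eq_lintegral hp, fockN_eq_lintegral hr.symm.pos]
    exact ENNReal.lintegral_mul_le_Lp_mul_Lq (fockV n) hr
      (continuous_fockWgt_mul b hf.1.continuous).enorm.measurable.aemeasurable
      (continuous_fockWgt_mul b' hg.1.continuous).enorm.measurable.aemeasurable
  · obtain ⟨C, hC, hle⟩ := exists_enorm_fockWgt_mul_le n (p := ENNReal.ofReal p)
      (by simpa using hp) b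
    refine ⟨C ^ (1 - p), ENNReal.rpow_ne_top_of_nonneg (by linarith) hC, fun f hf g hg => ?_⟩
    set N := fockN (ENNReal.ofReal p) b f with hN
    set M := fockN ∞ b' g with hM
    have hCN : (C * N) ^ (1 - p) * M ≠ ∞ := ENNReal.mul_ne_top
      (ENNReal.rpow_ne_top_of_nonneg (by linarith) (ENNReal.mul_ne_top hC hf.2)) hg.2
    calc _ ≤ ∫⁻ z, (C * N) ^ (1 - p) * M * ‖(fockWgt b z : ℂ) * f z‖ₑ ^ p ∂(fockV n) := by
          refine lintegral_mono fun z => ?_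
          have h1 := hle f hf.1 z
          have h2 := fockWgt_mul_le_of_fockN_top b' hg.1.continuous z
          set x := ‖(fockWgt b z : ℂ) * f z‖ₑ
          calc x * ‖(fockWgt b' z : ℂ) * g z‖ₑ = x ^ ((1 - p) + p) * _ := by
                rw [sub_add_cancel, ENNReal.rpow_one]
            _ = x ^ (1 - p) * x ^ p * ‖(fockWgt b' z : ℂ) * g z‖ₑ := by
                rw [ENNReal.rpow_add_of_nonneg _ _ (by linarith) hp.le]
            _ ≤ (C * N) ^ (1 - p) * x ^ p * M := by
                gcongr
            _ = _ := by ring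
      _ = (C * N) ^ (1 - p) * M * N ^ p := by
          rw [lintegral_const_mul' _ _ hCN, ← fockN_rpow hp]
      _ = C ^ (1 - p) * (N ^ (1 - p) * N ^ p) * M := by
          rw [ENNReal.mul_rpow_of_nonneg _ _ (by linarith)]; ring
      _ = C ^ (1 - p) * (N * M) := by
          rw [← ENNReal.rpow_add_of_nonneg _ _ (by linarith) hp.le, sub_add_cancel,
            ENNReal.rpow_one]; ring

theorem exists_integral_mul_le (n : ℕ) {p : ℝ} {q : ℝ≥0∞} (h : DualExp p q) (b b' : ℝ) :
    ∃ C : ℝ, 0 ≤ C ∧ ∀ f ∈ fockA n (ENNReal.ofReal p) b, ∀ g ∈ fockA n q b',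
      Integrable (fun z => fockWgt b z * ‖f z‖ * (fockWgt b' z * ‖g z‖)) (fockV n) ∧
      ∫ z, fockWgt b z * ‖f z‖ * (fockWgt b' z * ‖g z‖) ∂(fockV n) ≤
        C * ((fockN (ENNReal.ofReal p) b f).toReal * (fockN q b' g).toReal) := by
  obtain ⟨C, hC, hle⟩ := exists_lintegral_mul_le n h b b'
  refine ⟨C.toReal, ENNReal.toReal_nonneg, fun f hf g hg => ?_⟩
  have hnn : ∀ z, 0 ≤ fockWgt b z * ‖f z‖ * (fockWgt b' z * ‖g z‖) := fun z =>
    mul_nonneg (mul_nonneg (fockWgt_pos _ _).le (norm_nonneg _))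
      (mul_nonneg (fockWgt_pos _ _).le (norm_nonneg _))
  have hc : Continuous fun z => fockWgt b z * ‖f z‖ * (fockWgt b' z * ‖g z‖) :=
    ((continuous_fockWgt b).mul hf.1.continuous.norm).mul
      ((continuous_fockWgt b').mul hg.1.continuous.norm)
  have h1 : ∫⁻ z, ENNReal.ofReal (fockWgt b z * ‖f z‖ * (fockWgt b' z * ‖g z‖)) ∂(fockV n) ≤
      C * (fockN (ENNReal.ofReal p) b f * fockN q b' g) := by
    refine le_trans (le_of_eq ?_) (hle f hf g hg)
    refine lintegral_congr fun z => ?_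
    rw [← ofReal_norm, ← ofReal_norm, norm_fockWgt_mul, norm_fockWgt_mul,
      ENNReal.ofReal_mul (mul_nonneg (fockWgt_pos _ _).le (norm_nonneg _))]
  have h2 : C * (fockN (ENNReal.ofReal p) b f * fockN q b' g) ≠ ∞ :=
    ENNReal.mul_ne_top hC (ENNReal.mul_ne_top hf.2 hg.2)
  refine ⟨(lintegral_ofReal_ne_top_iff_integrable hc.aestronglyMeasurable
    (.of_forall hnn)).1 (ne_top_of_le_ne_top h2 h1), ?_⟩
  rw [integral_eq_lintegral_of_nonneg_ae (.of_forall hnn) hc.aestronglyMeasurable,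
    ← ENNReal.toReal_mul, ← ENNReal.toReal_mul]
  exact ENNReal.toReal_mono h2 h1

/-- A Schwarz-type estimate: Cauchy on the ball of radius 2 bounds the parts by S(|z|/2)^k, and
|z|^k ≤ |z|^K for the degrees that occur; the factor 2 is ∑ 2^{-k}. -/
theorem norm_le_of_homPart_eq_zero {h : Cn n → ℂ} (hh : Differentiable ℂ h) {K : ℕ}
    (h0 : ∀ k < K, ∀ z, homPart k h z = 0) {S : ℝ} (hS : ∀ w, ‖w‖ ≤ 2 → ‖h w‖ ≤ S) {z : Cn n}
    (hz : ‖z‖ ≤ 1) : ‖h z‖ ≤ 2 * S * ‖z‖ ^ K := by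
  have hS0 : 0 ≤ S := (norm_nonneg _).trans (hS 0 (by simp))
  have hb : ∀ k, ‖homPart k h z‖ ≤ S * ‖z‖ ^ K * (1 / 2) ^ k := fun k => by
    rcases lt_or_ge k K with hk | hk
    · rw [h0 k hk, norm_zero]; positivity
    · refine (norm_homPart_le_norm_pow hh two_pos hS k z).trans ?_
      rw [div_pow, mul_assoc, one_div, inv_pow, div_eq_mul_inv]
      gcongr S * (?_ * _)
      exact pow_le_pow_of_le_one (norm_nonneg z) hz hk
  have h1 := (hasSum_geometric_two.mul_left (S * ‖z‖ ^ K))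
  rw [← (hasSum_homPart hh z).tsum_eq]
  refine (tsum_of_norm_bounded h1 hb).trans (le_of_eq (by ring))

theorem exists_norm_le_of_mem_fockA (n : ℕ) {p : ℝ≥0∞} (hp : p ≠ 0) (b r : ℝ) :
    ∃ C : ℝ, 0 ≤ C ∧ ∀ f ∈ fockA n p b, ∀ w, ‖w‖ ≤ r → ‖f w‖ ≤ C * (fockN p b f).toReal := by
  obtain ⟨C, hC, hle⟩ := exists_fockWgt_mul_le n hp b
  obtain ⟨D, hD⟩ := (isCompact_closedBall (0 : Cn n) r).exists_bound_of_continuousOn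
    ((continuous_fockWgt b).inv₀ fun z => (fockWgt_pos b z).ne').continuousOn
  refine ⟨|D| * C, by positivity, fun f hf w hw => ?_⟩
  have h1 := hle f hf.1 hf.2 w
  have h2 : (fockWgt b w)⁻¹ ≤ |D| := by
    have := hD w (by simpa using hw)
    rw [Pi.inv_apply, Real.norm_of_nonneg (inv_nonneg.2 (fockWgt_pos b w).le)] at this
    exact this.trans (le_abs_self D)
  calc ‖f w‖ = (fockWgt b w)⁻¹ * (fockWgt b w * ‖f w‖) := by
        rw [← mul_assoc, inv_mul_cancel₀ (fockWgt_pos b w).ne', one_mul]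
    _ ≤ |D| * (C * (fockN p b f).toReal) := by
        exact mul_le_mul h2 h1 (mul_nonneg (fockWgt_pos b w).le (norm_nonneg _)) (abs_nonneg D)
    _ = _ := by ring

theorem exists_highPart_le (n : ℕ) {p : ℝ≥0∞} (hp : p ≠ 0) (b s : ℝ) :
    ∃ C : ℝ, 0 ≤ C ∧ ∀ f ∈ fockA n p b, ∀ z, ‖z‖ ≤ 1 →
      ‖highPart s f z‖ ≤ C * (fockN p b f).toReal * ‖z‖ ^ (⌊|s|⌋₊ + 1) := by
  obtain ⟨C, hC, hle⟩ := exists_norm_le_of_mem_fockA n hp b 2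
  obtain ⟨K, hK, h⟩ := exists_fockN_highPart_le n hp b s
  refine ⟨2 * (C * K.toReal), by positivity, fun f hf z hz => ?_⟩
  have hd : Differentiable ℂ (highPart s f) := by
    rw [highPart_eq_homMul s hf.1]; exact differentiable_homMul (geomBdd_highInd s) hf.1
  have h1 := h f hf.1
  have hKf : K * fockN p b f ≠ ∞ := ENNReal.mul_ne_top hK hf.2
  have h2 := ENNReal.toReal_mono hKf h1
  rw [ENNReal.toReal_mul] at h2
  have h3 := norm_le_of_homPart_eq_zero hd (K := ⌊|s|⌋₊ + 1) (fun k hk z => by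
    rw [highPart_eq_homMul s hf.1, homPart_homMul (geomBdd_highInd s) hf.1]
    simp [lowInd, hk]) (hle _ ⟨hd, ne_top_of_le_ne_top hKf h1⟩) hz
  refine h3.trans (mul_le_mul_of_nonneg_right ?_ (by positivity))
  calc _ ≤ 2 * (C * (K.toReal * (fockN p b f).toReal)) := by gcongr
    _ = _ := by ring

theorem measurable_ofReal_one_div_norm_rpow (σ : ℝ) :
    Measurable fun z : Cn n => ENNReal.ofReal (1 / ‖z‖ ^ σ) := by fun_prop

theorem integrable_fockW_iff (σ : ℝ) (F : Cn n → ℂ) :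
    Integrable F (fockW n σ) ↔ Integrable (fun z => ((1 / ‖z‖ ^ σ : ℝ) : ℂ) * F z) (fockV n) := by
  rw [fockW, integrable_withDensity_iff_integrable_smul' (measurable_ofReal_one_div_norm_rpow σ)
    (.of_forall fun z => ENNReal.ofReal_lt_top)]
  refine integrable_congr (.of_forall fun z => ?_)
  simp only [Complex.real_smul]
  rw [ENNReal.toReal_ofReal (by positivity)]

theorem integral_fockW (σ : ℝ) (F : Cn n → ℂ) :
    ∫ z, F z ∂(fockW n σ) = ∫ z, ((1 / ‖z‖ ^ σ : ℝ) : ℂ) * F z ∂(fockV n) := by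
  rw [fockW, integral_withDensity_eq_integral_toReal_smul (measurable_ofReal_one_div_norm_rpow σ)
    (.of_forall fun z => ENNReal.ofReal_lt_top)]
  refine integral_congr_ae (.of_forall fun z => ?_)
  simp only [Complex.real_smul]
  rw [ENNReal.toReal_ofReal (by positivity)]

theorem finrank_real_Cn (n : ℕ) : Module.finrank ℝ (Cn n) = 2 * n := by
  rw [← Module.finrank_mul_finrank ℝ ℂ (Cn n)]
  simp

theorem nontrivial_Cn (hn : 1 ≤ n) : Nontrivial (Cn n) := by
  have : Nonempty (Fin n) := ⟨⟨0, hn⟩⟩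
  infer_instance

theorem integrable_indicator_norm_rpow (hn : 1 ≤ n) {κ : ℝ} (hκ : -(2 * n : ℝ) < κ) :
    Integrable ((Metric.ball (0 : Cn n) 1).indicator fun z => ‖z‖ ^ κ) (fockV n) := by
  have := nontrivial_Cn hn
  rw [integrable_indicator_iff Metric.isOpen_ball.measurableSet]
  refine (integrableOn_fun_norm_addHaar (fockV n) (f := fun y => y ^ κ)).2 ?_
  rw [finrank_real_Cn]
  have h1 : IntegrableOn (fun y : ℝ => y ^ (κ + (2 * n - 1 : ℝ))) (Set.Ioo 0 1) volume := by
    rw [intervalIntegral.integrableOn_Ioo_rpow_iff one_pos]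
    linarith
  refine h1.congr_fun (fun y hy => ?_) measurableSet_Ioo
  simp only [smul_eq_mul]
  rw [← Real.rpow_natCast, ← Real.rpow_add hy.1, Nat.cast_sub (by omega)]
  congr 1
  push_cast
  ring

theorem one_div_rpow_mul_le {x : ℝ} (hx : 1 ≤ x) (σ : ℝ) :
    1 / x ^ σ ≤ 2 ^ |σ| * (1 + x) ^ (-σ) := by
  have hx0 : 0 < x := by linarith
  rw [one_div, ← Real.rpow_neg hx0.le]
  rcases le_total 0 σ with hs | hs
  · rw [abs_of_nonneg hs]
    calc x ^ (-σ) ≤ ((1 + x) / 2) ^ (-σ) :=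
          Real.rpow_le_rpow_of_nonpos (by linarith) (by linarith) (by linarith)
      _ = _ := by
          rw [Real.div_rpow (by linarith) two_pos.le, Real.rpow_neg two_pos.le, div_inv_eq_mul,
            mul_comm]
  · calc x ^ (-σ) ≤ (1 + x) ^ (-σ) := Real.rpow_le_rpow hx0.le (by linarith) (by linarith)
      _ ≤ 2 ^ |σ| * (1 + x) ^ (-σ) := by
          refine le_mul_of_one_le_left (by positivity) ?_
          exact Real.one_le_rpow one_le_two (abs_nonneg σ)

theorem fockWgt_mul_fockWgt (b b' : ℝ) (z : Cn n) :
    fockWgt b z * fockWgt b' z = Real.exp (-‖z‖ ^ 2) * (1 + ‖z‖) ^ (b + b') := by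
  rw [fockWgt, fockWgt, Real.rpow_add (by positivity)]
  calc _ = Real.exp (-‖z‖ ^ 2 / 2) * Real.exp (-‖z‖ ^ 2 / 2) *
        ((1 + ‖z‖) ^ b * (1 + ‖z‖) ^ b') := by ring
    _ = _ := by rw [← Real.exp_add]; congr 2; ring

theorem norm_pairInt (F G : Cn n → ℂ) (z : Cn n) :
    ‖pairInt F G z‖ = ‖F z‖ * ‖G z‖ * Real.exp (-‖z‖ ^ 2) := by
  rw [pairInt, norm_mul, norm_mul, RCLike.norm_conj, Complex.norm_real,
    Real.norm_of_nonneg (Real.exp_pos _).le]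

theorem continuous_pairInt {F G : Cn n → ℂ} (hF : Continuous F) (hG : Continuous G) :
    Continuous (pairInt F G) := by
  unfold pairInt
  exact (hF.mul (Complex.continuous_conj.comp hG)).mul (by fun_prop)

/-- An equality for x > 0. At x = 0 with σ ≠ 0 the left side is 0, since 0^σ = 0 and 1/0 = 0 by
convention. -/
theorem one_div_rpow_mul_rpow_le {x : ℝ} (hx : 0 ≤ x) (κ σ : ℝ) :
    1 / x ^ σ * x ^ κ ≤ x ^ (κ - σ) := by
  rcases hx.eq_or_lt with rfl | hx
  · rcases eq_or_ne σ 0 with rfl | hσ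
    · simp
    · rw [Real.zero_rpow hσ]
      simp only [div_zero, zero_mul]
      positivity
  · rw [Real.rpow_sub hx]
    exact le_of_eq (by ring)

/-- Here κ is the order of vanishing of FG at the origin. Outside the unit ball |z|^{-σ} is at most
a constant times (1+|z|)^{-σ} = (1+|z|)^{b+b'}, which is the product of the two weights. Inside,
|z|^{κ-σ} is integrable in real dimension 2n. -/
theorem exists_rawPairing_bound (hn : 1 ≤ n) {p : ℝ} {q : ℝ≥0∞} (h : DualExp p q) {b b' σ κ : ℝ}
    (hσ : σ = -(b + b')) (hκ : σ - 2 * n < κ) :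
    ∃ C : ℝ, 0 ≤ C ∧ ∀ F ∈ fockA n (ENNReal.ofReal p) b, ∀ G ∈ fockA n q b', ∀ D, 0 ≤ D →
      (∀ z, ‖z‖ ≤ 1 → ‖F z‖ * ‖G z‖ ≤ D * ‖z‖ ^ κ) →
      Integrable (pairInt F G) (fockW n σ) ∧ ‖rawPairing σ F G‖ ≤
        C * ((fockN (ENNReal.ofReal p) b F).toReal * (fockN q b' G).toReal + D) := by
  obtain ⟨C, hC, hle⟩ := exists_integral_mul_le n h b b'
  have hI := integrable_indicator_norm_rpow (n := n) hn (κ := κ - σ) (by linarith)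
  set I := (Metric.ball (0 : Cn n) 1).indicator fun z => ‖z‖ ^ (κ - σ) with hIdef
  have hI0 : ∀ z, 0 ≤ I z := fun z => Set.indicator_nonneg (fun z _ => by positivity) z
  refine ⟨2 ^ |σ| * C + ∫ z, I z ∂(fockV n), add_nonneg (by positivity)
    (integral_nonneg hI0), fun F hF G hG D hD hFG => ?_⟩
  obtain ⟨h1, h2⟩ := hle F hF G hG
  set B := fun z => 2 ^ |σ| * (fockWgt b z * ‖F z‖ * (fockWgt b' z * ‖G z‖)) + D * I z with hB
  have hBi : Integrable B (fockV n) := (h1.const_mul _).add (hI.const_mul _)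
  have hdom : ∀ z, ‖((1 / ‖z‖ ^ σ : ℝ) : ℂ) * pairInt F G z‖ ≤ B z := fun z => by
    rw [norm_mul, norm_pairInt, Complex.norm_real, Real.norm_of_nonneg (by positivity)]
    have hnn : 0 ≤ 2 ^ |σ| * (fockWgt b z * ‖F z‖ * (fockWgt b' z * ‖G z‖)) :=
      mul_nonneg (by positivity) (mul_nonneg (mul_nonneg (fockWgt_pos _ _).le (norm_nonneg _))
        (mul_nonneg (fockWgt_pos _ _).le (norm_nonneg _)))
    by_cases hz : ‖z‖ < 1
    · have hIz : I z = ‖z‖ ^ (κ - σ) := Set.indicator_of_mem (by simpa using hz) _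
      calc _ ≤ 1 / ‖z‖ ^ σ * (D * ‖z‖ ^ κ * 1) := by
            gcongr ?_ * ?_
            exact mul_le_mul (hFG z hz.le) (Real.exp_le_one_iff.2 (by simp)) (Real.exp_pos _).le
              (by positivity)
        _ = D * (1 / ‖z‖ ^ σ * ‖z‖ ^ κ) := by ring
        _ ≤ D * I z := by
            rw [hIz]; gcongr; exact one_div_rpow_mul_rpow_le (norm_nonneg z) κ σ
        _ ≤ B z := le_add_of_nonneg_left hnn
    · push Not at hz
      calc _ ≤ 2 ^ |σ| * (1 + ‖z‖) ^ (-σ) * (‖F z‖ * ‖G z‖ * Real.exp (-‖z‖ ^ 2)) := by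
            gcongr; exact one_div_rpow_mul_le hz σ
        _ = 2 ^ |σ| * (fockWgt b z * fockWgt b' z * (‖F z‖ * ‖G z‖)) := by
            rw [fockWgt_mul_fockWgt, hσ, neg_neg]; ring
        _ = 2 ^ |σ| * (fockWgt b z * ‖F z‖ * (fockWgt b' z * ‖G z‖)) := by ring
        _ ≤ B z := le_add_of_nonneg_right (mul_nonneg hD (hI0 z))
  have hint : Integrable (fun z => ((1 / ‖z‖ ^ σ : ℝ) : ℂ) * pairInt F G z) (fockV n) := by
    refine hBi.mono' ?_ (.of_forall hdom)
    refine AEStronglyMeasurable.mul ?_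
      (continuous_pairInt hF.1.continuous hG.1.continuous).aestronglyMeasurable
    have : Measurable fun z : Cn n => ((1 / ‖z‖ ^ σ : ℝ) : ℂ) := by fun_prop
    exact this.aestronglyMeasurable
  refine ⟨(integrable_fockW_iff σ _).2 hint, ?_⟩
  rw [rawPairing, integral_fockW]
  set NN := (fockN (ENNReal.ofReal p) b F).toReal * (fockN q b' G).toReal with hNN
  have hNN0 : 0 ≤ NN := mul_nonneg ENNReal.toReal_nonneg ENNReal.toReal_nonneg
  have hJ : 0 ≤ ∫ z, I z ∂(fockV n) := integral_nonneg hI0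
  calc _ ≤ ∫ z, B z ∂(fockV n) := norm_integral_le_of_norm_le hBi (.of_forall hdom)
    _ = 2 ^ |σ| * (∫ z, fockWgt b z * ‖F z‖ * (fockWgt b' z * ‖G z‖) ∂(fockV n)) +
        D * ∫ z, I z ∂(fockV n) := by
        rw [hB, integral_add (h1.const_mul _) (hI.const_mul _), integral_const_mul,
          integral_const_mul]
    _ ≤ 2 ^ |σ| * (C * NN) + D * ∫ z, I z ∂(fockV n) := by gcongr
    _ ≤ _ := by
        have e1 : 0 ≤ 2 ^ |σ| * C * D := by positivity
        have e2 := mul_nonneg hJ hNN0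
        nlinarith

theorem exists_toReal_fockN_lowPart_le (n : ℕ) {p : ℝ≥0∞} (hp : p ≠ 0) (b b' s : ℝ) :
    ∃ C : ℝ, 0 ≤ C ∧ ∀ f ∈ fockA n p b,
      (fockN p b' (lowPart s f)).toReal ≤ C * (fockN p b f).toReal := by
  obtain ⟨K, hK, h⟩ := exists_fockN_lowPart_le n hp b b' s
  refine ⟨K.toReal, ENNReal.toReal_nonneg, fun f hf => ?_⟩
  rw [← ENNReal.toReal_mul]
  exact ENNReal.toReal_mono (ENNReal.mul_ne_top hK hf.2) (h f hf.1)

theorem exists_toReal_fockN_highPart_le (n : ℕ) {p : ℝ≥0∞} (hp : p ≠ 0) (b s : ℝ) :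
    ∃ C : ℝ, 0 ≤ C ∧ ∀ f ∈ fockA n p b, highPart s f ∈ fockA n p b ∧
      (fockN p b (highPart s f)).toReal ≤ C * (fockN p b f).toReal := by
  obtain ⟨K, hK, h⟩ := exists_fockN_highPart_le n hp b s
  refine ⟨K.toReal, ENNReal.toReal_nonneg, fun f hf => ?_⟩
  have hd : Differentiable ℂ (highPart s f) := by
    rw [highPart_eq_homMul s hf.1]; exact differentiable_homMul (geomBdd_highInd s) hf.1
  have hKf : K * fockN p b f ≠ ∞ := ENNReal.mul_ne_top hK hf.2
  rw [← ENNReal.toReal_mul]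
  exact ⟨⟨hd, ne_top_of_le_ne_top hKf (h f hf.1)⟩, ENNReal.toReal_mono hKf (h f hf.1)⟩

theorem exists_rawPairing_bound_of_lt (hn : 1 ≤ n) {p : ℝ} {q : ℝ≥0∞} (h : DualExp p q)
    {b b' σ : ℝ} (hσ : σ = -(b + b')) (hσn : σ < 2 * n) :
    ∃ C : ℝ, 0 ≤ C ∧ ∀ F ∈ fockA n (ENNReal.ofReal p) b, ∀ G ∈ fockA n q b',
      Integrable (pairInt F G) (fockW n σ) ∧ ‖rawPairing σ F G‖ ≤
        C * ((fockN (ENNReal.ofReal p) b F).toReal * (fockN q b' G).toReal) := by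
  obtain ⟨C, hC, hle⟩ := exists_rawPairing_bound hn h hσ (κ := 0) (by linarith)
  obtain ⟨C₁, hC₁, h₁⟩ := exists_norm_le_of_mem_fockA n (p := ENNReal.ofReal p)
    (by simpa using h.pos) b 1
  obtain ⟨C₂, hC₂, h₂⟩ := exists_norm_le_of_mem_fockA n h.ne_zero b' 1
  refine ⟨C * (1 + C₁ * C₂), by positivity, fun F hF G hG => ?_⟩
  set N := (fockN (ENNReal.ofReal p) b F).toReal with hN
  set M := (fockN q b' G).toReal with hM
  have hN0 : 0 ≤ N := ENNReal.toReal_nonneg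
  have hM0 : 0 ≤ M := ENNReal.toReal_nonneg
  obtain ⟨hi, hb⟩ := hle F hF G hG (C₁ * N * (C₂ * M)) (by positivity) fun z hz => by
    rw [Real.rpow_zero, mul_one]
    exact mul_le_mul (h₁ F hF z hz) (h₂ G hG z hz) (norm_nonneg _) (by positivity)
  exact ⟨hi, hb.trans (le_of_eq (by ring))⟩

/-- For σ ≥ 2n each high part vanishes at 0 to order K = ⌊σ/2⌋ + 1, which exceeds σ/2, so the
previous bound applies with κ = 2K. -/
theorem exists_fockPairing_bound (hn : 1 ≤ n) {p : ℝ} {q : ℝ≥0∞} (h : DualExp p q)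
    {b b' σ : ℝ} (hσ : σ = -(b + b')) :
    ∃ C : ℝ, 0 ≤ C ∧ ∀ F ∈ fockA n (ENNReal.ofReal p) b, ∀ G ∈ fockA n q b',
      FockPairingConverges σ F G ∧ ‖fockPairing σ F G‖ ≤
        C * ((fockN (ENNReal.ofReal p) b F).toReal * (fockN q b' G).toReal) := by
  have hp : ENNReal.ofReal p ≠ 0 := by simpa using h.pos
  by_cases hσn : σ < 2 * n
  · obtain ⟨C, hC, hle⟩ := exists_rawPairing_bound_of_lt hn h hσ hσn
    refine ⟨C, hC, fun F hF G hG => ?_⟩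
    rw [fockPairing, if_pos hσn]
    exact ⟨⟨fun _ => (hle F hF G hG).1, fun h => absurd hσn h.not_gt⟩, (hle F hF G hG).2⟩
  -- The low parts are paired with weight 0, so b' is traded for -b; this is free because low parts
  -- lie in every weighted space.
  · obtain ⟨C, hC, hle⟩ := exists_rawPairing_bound_of_lt hn h (b := b) (b' := -b) (σ := 0)
      (by ring) (by have : (1 : ℝ) ≤ n := (by exact_mod_cast hn); linarith)
    obtain ⟨L₁, hL₁, l₁⟩ := exists_toReal_fockN_lowPart_le n hp b b (σ / 2)
    obtain ⟨L₂, hL₂, l₂⟩ := exists_toReal_fockN_lowPart_le n h.ne_zero b' (-b) (σ / 2)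
    obtain ⟨H₁, hH₁, m₁⟩ := exists_toReal_fockN_highPart_le n hp b (σ / 2)
    obtain ⟨H₂, hH₂, m₂⟩ := exists_toReal_fockN_highPart_le n h.ne_zero b' (σ / 2)
    obtain ⟨E₁, hE₁, e₁⟩ := exists_highPart_le n hp b (σ / 2)
    obtain ⟨E₂, hE₂, e₂⟩ := exists_highPart_le n h.ne_zero b' (σ / 2)
    set K := ⌊|σ / 2|⌋₊ + 1 with hK
    have hKσ : σ / 2 < K := (le_abs_self _).trans_lt (by rw [hK]; exact_mod_cast Nat.lt_floor_add_one _)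
    obtain ⟨C', hC', hle'⟩ := exists_rawPairing_bound hn h hσ (κ := ((2 * K : ℕ) : ℝ)) (by
      have : (1 : ℝ) ≤ n := (by exact_mod_cast hn)
      push_cast
      linarith)
    refine ⟨C * (L₁ * L₂) + C' * (H₁ * H₂ + E₁ * E₂), by positivity, fun F hF G hG => ?_⟩
    set N := (fockN (ENNReal.ofReal p) b F).toReal with hN
    set M := (fockN q b' G).toReal with hM
    have hN0 : 0 ≤ N := ENNReal.toReal_nonneg
    have hM0 : 0 ≤ M := ENNReal.toReal_nonneg
    obtain ⟨i1, j1⟩ := hle _ (lowPart_mem_fockA hp b (σ / 2) hF.1) _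
      (lowPart_mem_fockA h.ne_zero (-b) (σ / 2) hG.1)
    obtain ⟨i2, j2⟩ := hle' _ (m₁ F hF).1 _ (m₂ G hG).1 (E₁ * N * (E₂ * M)) (by positivity)
      fun z hz => by
        rw [Real.rpow_natCast]
        calc _ ≤ (E₁ * N * ‖z‖ ^ K) * (E₂ * M * ‖z‖ ^ K) :=
              mul_le_mul (e₁ F hF z hz) (e₂ G hG z hz) (norm_nonneg _) (by positivity)
          _ = _ := by ring
    rw [fockPairing, if_neg hσn]
    refine ⟨⟨fun h => absurd h hσn, fun _ => ⟨i1, i2⟩⟩, (norm_add_le _ _).trans ?_⟩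
    have a1 := l₁ F hF
    have a2 := l₂ G hG
    have a3 := (m₁ F hF).2
    have a4 := (m₂ G hG).2
    calc _ ≤ C * (L₁ * N * (L₂ * M)) + C' * (H₁ * N * (H₂ * M) + E₁ * N * (E₂ * M)) := by
          refine add_le_add (j1.trans ?_) (j2.trans ?_)
          · gcongr
          · gcongr
      _ = _ := by ring

end Pairing

/-! ### Orthogonality of degrees and the pairing on each degree. -/

section Orthogonality

variable {n : ℕ}

/-- The measure is invariant under z ↦ e^{iθ}z. Averaging over θ with Fubini extracts from g its
k-th Fourier coefficient on circles, which is its part of degree k. -/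
theorem integral_mul_conj_homPart {φ : Cn n → ℂ} (hφ : Measurable φ) (k : ℕ)
    (hrot : ∀ e : ℂ, ‖e‖ = 1 → ∀ z, φ (e • z) = e ^ k * φ z) {g : Cn n → ℂ}
    (hg : Differentiable ℂ g) (hi : Integrable (fun z => φ z * conj (g z)) (fockV n)) :
    ∫ z, φ z * conj (g z) ∂(fockV n) = ∫ z, φ z * conj (homPart k g z) ∂(fockV n) := by
  set e : ℝ → ℂ := fun θ => Complex.exp (θ * Complex.I) with he
  have he1 : ∀ θ, ‖e θ‖ = 1 := fun θ => Complex.norm_exp_ofReal_mul_I θ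
  have hec : Continuous e := by fun_prop
  set H : Cn n → ℂ := fun z => φ z * conj (g z) with hH
  have hHm : Measurable H := hφ.mul (Complex.continuous_conj.comp hg.continuous).measurable
  set μ := (volume : Measure ℝ).restrict (Set.Ioc (0 : ℝ) (2 * Real.pi)) with hμ
  have hmeas : Measurable fun x : ℝ × Cn n => H (e x.1 • x.2) :=
    hHm.comp ((hec.comp continuous_fst).smul continuous_snd).measurable
  have hmp := fun θ => measurePreserving_rotation (n := n) (he1 θ)
  have hemb : ∀ θ, MeasurableEmbedding fun z : Cn n => e θ • z := fun θ =>
    (Homeomorph.smulOfNeZero (e θ) (by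
      intro h; have := he1 θ; rw [h] at this; simp at this)).measurableEmbedding
  have hprod : Integrable (Function.uncurry fun (θ : ℝ) (z : Cn n) => H (e θ • z))
      (μ.prod (fockV n)) := by
    refine (integrable_prod_iff hmeas.aestronglyMeasurable).2 ⟨.of_forall fun θ => ?_, ?_⟩
    · exact ((hmp θ).integrable_comp_emb (hemb θ)).2 hi
    · have : (fun θ => ∫ z, ‖H (e θ • z)‖ ∂(fockV n)) = fun _ => ∫ z, ‖H z‖ ∂(fockV n) := by
        funext θ
        exact (hmp θ).integral_comp (hemb θ) fun z => ‖H z‖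
      change Integrable (fun θ => ∫ z, ‖H (e θ • z)‖ ∂(fockV n)) μ
      rw [this]
      exact integrable_const _
  have hswap := integral_integral_swap hprod
  have hleft : ∫ θ, ∫ z, H (e θ • z) ∂(fockV n) ∂μ = (2 * Real.pi : ℝ) * ∫ z, H z ∂(fockV n) := by
    have : (fun θ => ∫ z, H (e θ • z) ∂(fockV n)) = fun _ => ∫ z, H z ∂(fockV n) := by
      funext θ
      exact (hmp θ).integral_comp (hemb θ) H
    rw [this, integral_const, hμ, measureReal_restrict_apply_univ, Real.volume_real_Ioc,
      sub_zero, max_eq_left Real.two_pi_pos.le, Complex.real_smul]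
  have hright : ∀ z, ∫ θ, H (e θ • z) ∂μ =
      (2 * Real.pi : ℝ) * (φ z * conj (homPart k g z)) := fun z => by
    rw [homPart_eq_circleIntegral hg k z one_pos,
      intervalIntegral.integral_of_le Real.two_pi_pos.le, ← hμ, map_mul, ← integral_conj,
      Complex.conj_ofReal]
    have h1 : ∀ θ : ℝ, H (e θ • z) = φ z *
        conj (((((1 : ℝ) : ℂ) * Complex.exp (θ * Complex.I)) ^ k)⁻¹ *
          g ((((1 : ℝ) : ℂ) * Complex.exp (θ * Complex.I)) • z)) := fun θ => by
      have h2 : conj ((e θ ^ k)⁻¹) = e θ ^ k := by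
        rw [← inv_pow, map_pow, ← Complex.inv_eq_conj (by rw [norm_inv, he1, inv_one]), inv_inv]
      simp only [Complex.ofReal_one, one_mul]
      rw [map_mul, h2, hH]
      simp only
      rw [hrot _ (he1 θ)]
      ring
    simp_rw [h1]
    rw [integral_const_mul]
    have hpi : ((2 * Real.pi : ℝ) : ℂ) * (((2 * Real.pi)⁻¹ : ℝ) : ℂ) = 1 := by
      rw [← Complex.ofReal_mul, mul_inv_cancel₀ Real.two_pi_pos.ne', Complex.ofReal_one]
    set J := ∫ θ, conj (((((1 : ℝ) : ℂ) * Complex.exp (θ * Complex.I)) ^ k)⁻¹ *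
          g ((((1 : ℝ) : ℂ) * Complex.exp (θ * Complex.I)) • z)) ∂μ
    calc φ z * J = (((2 * Real.pi : ℝ) : ℂ) * (((2 * Real.pi)⁻¹ : ℝ) : ℂ)) * (φ z * J) := by
          rw [hpi, one_mul]
      _ = _ := by ring
  simp_rw [hright] at hswap
  rw [hleft, integral_const_mul] at hswap
  exact mul_left_cancel₀ (by exact_mod_cast Real.two_pi_pos.ne') hswap

theorem rawPairing_homPart_right (σ : ℝ) {h g : Cn n → ℂ} (hh : Continuous h) (k : ℕ)
    (hrot : ∀ (e : ℂ) z, h (e • z) = e ^ k * h z) (hg : Differentiable ℂ g)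
    (hi : Integrable (pairInt h g) (fockW n σ)) :
    rawPairing σ h g = rawPairing σ h (homPart k g) := by
  set φ : Cn n → ℂ := fun z => ((1 / ‖z‖ ^ σ : ℝ) : ℂ) * (h z * ((Real.exp (-‖z‖ ^ 2) : ℝ) : ℂ))
    with hφ
  have hm : Measurable φ := by
    have := hh.measurable
    fun_prop
  have hr : ∀ g : Cn n → ℂ, (fun z => ((1 / ‖z‖ ^ σ : ℝ) : ℂ) * pairInt h g z) =
      fun z => φ z * conj (g z) := fun g => by
    funext z; simp only [hφ, pairInt]; ring
  rw [integrable_fockW_iff, hr] at hi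
  rw [rawPairing, rawPairing, integral_fockW, integral_fockW, hr, hr]
  refine integral_mul_conj_homPart hm k (fun e he z => ?_) hg hi
  simp only [hφ, norm_smul, he, one_mul, hrot]
  ring

/-- Polar coordinates: a radial factor times a positively homogeneous one splits into a sphere
integral and a radial integral. -/
theorem integral_radial_mul (hn : 1 ≤ n) (ρ : ℝ → ℝ) (m : ℕ) {U : Cn n → ℂ}
    (hU : ∀ (r : ℝ) z, 0 < r → U (r • z) = (r : ℂ) ^ m * U z) :
    ∫ z, (ρ ‖z‖ : ℂ) * U z ∂(fockV n) =
      (∫ x : Metric.sphere (0 : Cn n) 1, U x ∂(fockV n).toSphere) *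
        ((∫ y in Set.Ioi (0 : ℝ), y ^ (2 * n - 1) * (ρ y * y ^ m) : ℝ) : ℂ) := by
  have := nontrivial_Cn hn
  set μ := fockV n
  calc ∫ z, (ρ ‖z‖ : ℂ) * U z ∂μ
      = ∫ x : ({(0)}ᶜ : Set (Cn n)), (ρ ‖x.1‖ : ℂ) * U x.1 ∂(μ.comap (↑)) := by
        rw [integral_subtype_comap (measurableSet_singleton _).compl fun x => (ρ ‖x‖ : ℂ) * U x,
          restrict_compl_singleton]
    _ = ∫ x : Metric.sphere (0 : Cn n) 1 × Set.Ioi (0 : ℝ), U x.1 * ((ρ x.2 * x.2.1 ^ m : ℝ) : ℂ)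
          ∂μ.toSphere.prod (.volumeIoiPow (Module.finrank ℝ (Cn n) - 1)) := by
        rw [← μ.measurePreserving_homeomorphUnitSphereProd.integral_comp
          (Homeomorph.measurableEmbedding _)]
        refine integral_congr_ae (.of_forall fun x => ?_)
        have hx : 0 < ‖x.1‖ := norm_pos_iff.2 x.2
        have h1 := hU ‖x.1‖ (‖x.1‖⁻¹ • x.1) hx
        rw [smul_smul, mul_inv_cancel₀ hx.ne', one_smul] at h1
        simp only [homeomorphUnitSphereProd_apply_snd_coe, homeomorphUnitSphereProd_apply_fst_coe]
        rw [h1]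
        push_cast
        ring
    _ = (∫ x : Metric.sphere (0 : Cn n) 1, U x ∂μ.toSphere) *
          ∫ y : Set.Ioi (0 : ℝ), ((ρ y * y.1 ^ m : ℝ) : ℂ)
            ∂.volumeIoiPow (Module.finrank ℝ (Cn n) - 1) :=
        integral_prod_mul (fun x : Metric.sphere (0 : Cn n) 1 => U x)
          fun y : Set.Ioi (0 : ℝ) => ((ρ y * y.1 ^ m : ℝ) : ℂ)
    _ = _ := by
        rw [integral_complex_ofReal, finrank_real_Cn]
        congr 2
        simp only [Measure.volumeIoiPow, ENNReal.ofReal]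
        rw [integral_withDensity_eq_integral_smul,
          integral_subtype_comap measurableSet_Ioi
            fun a : ℝ => Real.toNNReal (a ^ (2 * n - 1)) • (ρ a * a ^ m),
          setIntegral_congr_fun measurableSet_Ioi fun x hx => ?_]
        · rw [NNReal.smul_def, Real.coe_toNNReal _ (pow_nonneg (Set.mem_Ioi.1 hx).le _),
            smul_eq_mul]
        · exact (measurable_subtype_coe.pow_const _).real_toNNReal

/-- The radial integral of r^{2n-1+2k-σ}e^{-r²} is Γ(n - σ/2 + k)/2. The sphere integral does not
depend on σ, so it cancels on comparison with σ = 0. -/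
theorem rawPairing_eq_gamma_mul (hn : 1 ≤ n) (σ : ℝ) (k : ℕ) (hk : 0 < n - σ / 2 + k)
    {h g : Cn n → ℂ} (hh : ∀ (c : ℂ) z, h (c • z) = c ^ k * h z)
    (hg : ∀ (c : ℂ) z, g (c • z) = c ^ k * g z) :
    rawPairing σ h g = (∫ x : Metric.sphere (0 : Cn n) 1, h x * conj (g x) ∂(fockV n).toSphere) *
      ((1 / 2 * Real.Gamma (n - σ / 2 + k) : ℝ) : ℂ) := by
  set U : Cn n → ℂ := fun z => h z * conj (g z) with hUdef
  have hU : ∀ (r : ℝ) z, 0 < r → U (r • z) = (r : ℂ) ^ (2 * k) * U z := fun r z _ => by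
    have : r • z = (r : ℂ) • z := by ext i; simp
    simp only [hUdef, this, hh, hg, map_mul, map_pow, Complex.conj_ofReal]
    ring
  rw [rawPairing, integral_fockW]
  have h1 := integral_radial_mul hn (fun r => 1 / r ^ σ * Real.exp (-r ^ 2)) (2 * k) hU
  have h2 : (fun z : Cn n => ((1 / ‖z‖ ^ σ : ℝ) : ℂ) * pairInt h g z) =
      fun z => ((1 / ‖z‖ ^ σ * Real.exp (-‖z‖ ^ 2) : ℝ) : ℂ) * U z := by
    funext z; simp only [hUdef, pairInt]; push_cast; ring
  rw [h2, h1]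
  congr 2
  have h3 := integral_rpow_mul_exp_neg_rpow (p := 2) (q := 2 * (n - σ / 2 + k) - 1) two_pos
    (by linarith)
  rw [show (2 * ((n : ℝ) - σ / 2 + k) - 1 + 1) / 2 = n - σ / 2 + k by ring] at h3
  rw [← h3]
  refine setIntegral_congr_fun measurableSet_Ioi fun r hr => ?_
  have hr0 : 0 < r := hr
  rw [one_div, ← Real.rpow_neg hr0.le, ← Real.rpow_natCast r (2 * n - 1),
    ← Real.rpow_natCast r (2 * k), Real.rpow_two]
  calc _ = r ^ (((2 * n - 1 : ℕ) : ℝ)) * r ^ (-σ) * r ^ (((2 * k : ℕ) : ℝ)) *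
        Real.exp (-r ^ 2) := by ring
    _ = _ := by
        rw [← Real.rpow_add hr0, ← Real.rpow_add hr0]
        congr 2
        rw [Nat.cast_sub (by omega)]
        push_cast
        ring

theorem rawPairing_eq_div_mul (hn : 1 ≤ n) (σ : ℝ) (k : ℕ) (hk : 0 < n - σ / 2 + k)
    {h g : Cn n → ℂ} (hh : ∀ (c : ℂ) z, h (c • z) = c ^ k * h z)
    (hg : ∀ (c : ℂ) z, g (c • z) = c ^ k * g z) :
    rawPairing σ h g =
      ((Real.Gamma (n - σ / 2 + k) / Real.Gamma (n + k) : ℝ) : ℂ) * rawPairing 0 h g := by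
  have hn' : (0 : ℝ) < n + k := by positivity
  rw [rawPairing_eq_gamma_mul hn σ k hk hh hg,
    rawPairing_eq_gamma_mul hn 0 k (by rw [zero_div, sub_zero]; exact hn') hh hg, zero_div, sub_zero]
  have h1 : ((Real.Gamma (n + k) : ℝ) : ℂ) ≠ 0 := by
    exact_mod_cast (Real.Gamma_pos_of_pos hn').ne'
  push_cast
  field_simp

theorem homPart_eq_homMul (k : ℕ) (f : Cn n → ℂ) :
    homPart k f = homMul (Pi.single k 1) f := by
  funext z
  rw [homMul, tsum_eq_single k]
  · simp
  · intro j hj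
    simp [hj]

theorem geomBdd_single (k : ℕ) : GeomBdd (Pi.single k 1) :=
  geomBdd_of_support (K := k + 1) fun j hj => by
    rw [Pi.single_apply, if_neg (by omega)]

theorem homPart_homPart (j k : ℕ) {f : Cn n → ℂ} (hf : Differentiable ℂ f) :
    homPart j (homPart k f) = if j = k then homPart k f else 0 := by
  funext z
  rw [homPart_eq_homMul k f, homPart_homMul (geomBdd_single k) hf, ← homPart_eq_homMul]
  split_ifs with h
  · subst h; simp
  · simp [h]

theorem homMul_homPart (m : ℕ → ℝ) (k : ℕ) {f : Cn n → ℂ} (hf : Differentiable ℂ f) :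
    homMul m (homPart k f) = (m k : ℂ) • homPart k f := by
  funext z
  rw [homMul, tsum_eq_single k]
  · rw [homPart_homPart k k hf, if_pos rfl]; rfl
  · intro j hj
    rw [homPart_homPart j k hf, if_neg hj]; simp

open Classical in
/-- The ratio of `⟨·, ·⟩_σ` to `⟨·, ·⟩_0` on homogeneous polynomials of degree `k`. -/
noncomputable def pairCoeff (n : ℕ) (σ : ℝ) (k : ℕ) : ℝ :=
  if σ < 2 * n ∨ σ / 2 < k then Real.Gamma (n - σ / 2 + k) / Real.Gamma (n + k) else 1

theorem pairCoeff_arg_pos {σ : ℝ} {k : ℕ} (h : σ < 2 * n ∨ σ / 2 < k) :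
    0 < (n : ℝ) - σ / 2 + k := by
  have h1 : (0 : ℝ) ≤ n := n.cast_nonneg
  have h2 : (0 : ℝ) ≤ k := k.cast_nonneg
  rcases h with h | h <;> linarith

theorem pairCoeff_pos (hn : 1 ≤ n) (σ : ℝ) (k : ℕ) : 0 < pairCoeff n σ k := by
  rw [pairCoeff]
  split_ifs with h
  · have h2 : (0 : ℝ) < n + k := by positivity
    exact div_pos (Real.Gamma_pos_of_pos (pairCoeff_arg_pos h)) (Real.Gamma_pos_of_pos h2)
  · exact one_pos

/-- This converts representing functions for the Gaussian pairing into ones for ⟨·,·⟩_σ: order σ/2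
sends the weight -b to -b - σ = b'. -/
theorem mulOrd_inv_pairCoeff (n : ℕ) (σ : ℝ) : MulOrd n (fun k => (pairCoeff n σ k)⁻¹) (σ / 2) := by
  have h := mulOrd_gamma_div n n (n - σ / 2)
  rw [show (n : ℝ) - (n - σ / 2) = σ / 2 by ring] at h
  refine h.congr (K := ⌊|σ / 2|⌋₊ + 1) fun k hk => ?_
  rw [pairCoeff, if_pos, inv_div]
  right
  have h1 := (le_abs_self (σ / 2)).trans_lt (Nat.lt_floor_add_one |σ / 2|)
  exact h1.trans_le (by exact_mod_cast hk)

theorem rawPairing_zero_left (σ : ℝ) (g : Cn n → ℂ) : rawPairing σ 0 g = 0 := by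
  have : pairInt 0 g = 0 := by funext z; simp [pairInt]
  simp [rawPairing, this]

/-- If σ ≥ 2n, a polynomial of degree k is either entirely low or entirely high, so one of the two
terms of the pairing vanishes. In the other, only the degree-k part of g is seen. -/
theorem fockPairing_homPart (hn : 1 ≤ n) (σ : ℝ) (k : ℕ) {f g : Cn n → ℂ}
    (hf : Differentiable ℂ f) (hg : Differentiable ℂ g)
    (hc : FockPairingConverges σ (homPart k f) g) :
    fockPairing σ (homPart k f) g =
      (pairCoeff n σ k : ℂ) * rawPairing 0 (homPart k f) (homPart k g) := by
  have hcf : Continuous (homPart k f) := (differentiable_homPart hf k).continuous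
  have hrf := fun c z => homPart_smul_arg hf k c z
  have hrg := fun c z => homPart_smul_arg hg k c z
  by_cases hσ : σ < 2 * n
  · rw [fockPairing, if_pos hσ, pairCoeff, if_pos (Or.inl hσ),
      rawPairing_homPart_right σ hcf k hrf hg (hc.1 hσ)]
    exact rawPairing_eq_div_mul hn σ k (pairCoeff_arg_pos (Or.inl hσ)) hrf hrg
  · rw [fockPairing, if_neg hσ]
    obtain ⟨i1, i2⟩ := hc.2 (not_lt.1 hσ)
    have hdf := differentiable_homPart hf k
    have hdl : Differentiable ℂ (lowPart (σ / 2) g) := by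
      rw [lowPart_eq_homMul]; exact differentiable_homMul (geomBdd_lowInd _) hg
    have hdh : Differentiable ℂ (highPart (σ / 2) g) := by
      rw [highPart_eq_homMul _ hg]; exact differentiable_homMul (geomBdd_highInd _) hg
    have hlf : lowPart (σ / 2) (homPart k f) = (lowInd (σ / 2) k : ℂ) • homPart k f := by
      rw [lowPart_eq_homMul, homMul_homPart _ k hf]
    have hhf : highPart (σ / 2) (homPart k f) = ((1 - lowInd (σ / 2) k : ℝ) : ℂ) • homPart k f := by
      rw [highPart_eq_homMul _ hdf, homMul_homPart _ k hf]; rfl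
    have hlg : homPart k (lowPart (σ / 2) g) = (lowInd (σ / 2) k : ℂ) • homPart k g := by
      funext z
      rw [lowPart_eq_homMul, homPart_homMul (geomBdd_lowInd _) hg]; rfl
    have hhg : homPart k (highPart (σ / 2) g) = ((1 - lowInd (σ / 2) k : ℝ) : ℂ) • homPart k g := by
      funext z
      rw [highPart_eq_homMul _ hg, homPart_homMul (geomBdd_highInd _) hg]; rfl
    have hσ0 : 0 ≤ σ / 2 := by
      have : (0 : ℝ) ≤ n := n.cast_nonneg
      linarith
    by_cases hk : σ / 2 < k
    · have hl : lowInd (σ / 2) k = 0 := by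
        rw [lowInd, if_neg]
        rw [lt_floor_abs_iff, abs_of_nonneg hσ0]
        exact not_le.2 hk
      rw [hl, sub_zero, Complex.ofReal_one, one_smul] at hhf hhg
      rw [hl, Complex.ofReal_zero, zero_smul] at hlf
      rw [hlf, rawPairing_zero_left, zero_add, hhf,
        rawPairing_homPart_right σ hcf k hrf hdh (by rwa [hhf] at i2), hhg, pairCoeff,
        if_pos (Or.inr hk)]
      exact rawPairing_eq_div_mul hn σ k (pairCoeff_arg_pos (Or.inr hk)) hrf hrg
    · have hl : lowInd (σ / 2) k = 1 := by
        rw [lowInd, if_pos]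
        rw [lt_floor_abs_iff, abs_of_nonneg hσ0]
        exact not_lt.1 hk
      rw [hl, Complex.ofReal_one, one_smul] at hlf hlg
      rw [hl, sub_self, Complex.ofReal_zero, zero_smul] at hhf
      rw [hhf, rawPairing_zero_left, add_zero, hlf,
        rawPairing_homPart_right 0 hcf k hrf hdl (by rwa [hlf] at i1), hlg, pairCoeff,
        if_neg (by tauto), Complex.ofReal_one, one_mul]

end Orthogonality

/-! ### Representing functionals through a weighted L² space. -/

section Representation

variable {n : ℕ}

theorem integrable_exp_sub_sq (n : ℕ) (L : ℝ) {ε : ℝ} (hε : 0 < ε) :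
    Integrable (fun z : Cn n => Real.exp (L * ‖z‖ - ε * ‖z‖ ^ 2)) (fockV n) := by
  obtain ⟨C, hC, hle⟩ := exists_rpow_mul_exp_le 0 (L + 1) hε
  have h1 : Integrable (fun z : Cn n => Real.exp (-1 * ‖z‖)) (fockV n) := by
    rw [← lintegral_ofReal_ne_top_iff_integrable (by fun_prop)
      (.of_forall fun z => (Real.exp_pos _).le)]
    exact lintegral_exp_neg_norm_ne_top n one_pos
  refine (h1.const_mul C).mono' (by fun_prop) (.of_forall fun z => ?_)
  rw [Real.norm_of_nonneg (Real.exp_pos _).le]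
  have h2 := hle ‖z‖ (norm_nonneg z)
  rw [Real.rpow_zero, one_mul] at h2
  calc Real.exp (L * ‖z‖ - ε * ‖z‖ ^ 2)
      = Real.exp ((L + 1) * ‖z‖) * Real.exp (-1 * ‖z‖ - ε * ‖z‖ ^ 2) := by
        rw [← Real.exp_add]; ring_nf
    _ ≤ C * Real.exp (ε * ‖z‖ ^ 2) * Real.exp (-1 * ‖z‖ - ε * ‖z‖ ^ 2) := by gcongr
    _ = _ := by rw [mul_assoc, ← Real.exp_add]; ring_nf

/-- The L² norm with a larger weight exponent controls f pointwise. The surplus (2n+1)/p makes the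
remaining factor (1+|z|)^{-(2n+1)} integrable after taking p-th powers. This brings functionals to a
Hilbert space even when p < 1. -/
theorem exists_fockN_le_fockN_two (n : ℕ) {p : ℝ} (hp : 0 < p) (b : ℝ) :
    ∃ (B : ℝ) (K : ℝ≥0∞), K ≠ ∞ ∧ ∀ f : Cn n → ℂ, Differentiable ℂ f →
      fockN (ENNReal.ofReal p) b f ≤ K * fockN 2 B f := by
  set B := b + (2 * n + 1) / p with hB
  obtain ⟨C, hC, hle⟩ := exists_enorm_fockWgt_mul_le n (p := 2) two_ne_zero B
  set E := ∫⁻ z : Cn n, ENNReal.ofReal ((1 + ‖z‖) ^ (-(2 * n + 1 : ℝ))) ∂(fockV n) with hE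
  have hEt : E ≠ ∞ := by
    refine (lintegral_ofReal_ne_top_iff_integrable
      (Measurable.aestronglyMeasurable (by fun_prop)) (.of_forall fun z => by positivity)).2 ?_
    refine integrable_one_add_norm ?_
    rw [finrank_real_Cn]
    push_cast
    linarith
  refine ⟨B, E ^ (1 / p) * C, ENNReal.mul_ne_top
    (ENNReal.rpow_ne_top_of_nonneg (by positivity) hEt) hC, fun f hf => ?_⟩
  have hpt : ∀ z, ‖(fockWgt b z : ℂ) * f z‖ₑ ^ p ≤
      ENNReal.ofReal ((1 + ‖z‖) ^ (-(2 * n + 1 : ℝ))) * (C * fockN 2 B f) ^ p := fun z => by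
    have h1 : (fockWgt b z : ℂ) * f z =
        (((1 + ‖z‖) ^ (-((2 * n + 1 : ℝ) / p)) : ℝ) : ℂ) * ((fockWgt B z : ℂ) * f z) := by
      rw [← mul_assoc, ← Complex.ofReal_mul]
      congr 2
      rw [fockWgt, fockWgt, hB, Real.rpow_add (by positivity), Real.rpow_neg (by positivity)]
      have : (1 + ‖z‖) ^ ((2 * n + 1 : ℝ) / p) ≠ 0 := by positivity
      field_simp
    have h2 : ‖(((1 + ‖z‖) ^ (-((2 * n + 1 : ℝ) / p)) : ℝ) : ℂ)‖ₑ ^ p =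
        ENNReal.ofReal ((1 + ‖z‖) ^ (-(2 * n + 1 : ℝ))) := by
      rw [← ofReal_norm, Complex.norm_real, Real.norm_of_nonneg (by positivity),
        ENNReal.ofReal_rpow_of_nonneg (by positivity) hp.le, ← Real.rpow_mul (by positivity)]
      congr 2
      field_simp
    rw [h1, enorm_mul, ENNReal.mul_rpow_of_nonneg _ _ hp.le, h2]
    gcongr
    exact hle f hf z
  rw [fockN_eq_lintegral hp]
  calc _ ≤ (∫⁻ z : Cn n, ENNReal.ofReal ((1 + ‖z‖) ^ (-(2 * n + 1 : ℝ))) *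
        (C * fockN 2 B f) ^ p ∂(fockV n)) ^ (1 / p) := by
        gcongr with z
        exact hpt z
    _ = (E * (C * fockN 2 B f) ^ p) ^ (1 / p) := by
        rw [lintegral_mul_const'' _ (Measurable.aemeasurable (by fun_prop))]
    _ = _ := by
        rw [ENNReal.mul_rpow_of_nonneg _ _ (by positivity), ← ENNReal.rpow_mul,
          mul_one_div_cancel hp.ne', ENNReal.rpow_one, mul_assoc]

/-- Multiplication by the weight embeds the space isometrically into L². Hahn–Banach extends the
functional from the image, and the Riesz theorem represents the extension. -/
theorem exists_L2_representation {B : ℝ} (ν : fockA n 2 B →ₗ[ℂ] ℂ) {D : ℝ}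
    (hν : ∀ f, ‖ν f‖ ≤ D * (fockN 2 B (f : Cn n → ℂ)).toReal) :
    ∃ ψ : Cn n → ℂ, MemLp ψ 2 (fockV n) ∧
      ∀ f, ν f = ∫ z, (fockWgt B z : ℂ) * (f : Cn n → ℂ) z * conj (ψ z) ∂(fockV n) := by
  have hmem : ∀ f : fockA n 2 B,
      MemLp (fun z => (fockWgt B z : ℂ) * (f : Cn n → ℂ) z) 2 (fockV n) := fun f =>
    ⟨(continuous_fockWgt_mul B f.2.1.continuous).aestronglyMeasurable, f.2.2.lt_top⟩
  let T : fockA n 2 B →ₗ[ℂ] Lp ℂ 2 (fockV n) :=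
    { toFun := fun f => (hmem f).toLp
      map_add' := fun f g => by
        rw [← MemLp.toLp_add]
        congr 1
        funext z
        simp only [Submodule.coe_add, Pi.add_apply]
        ring
      map_smul' := fun c f => by
        rw [RingHom.id_apply, ← MemLp.toLp_const_smul]
        congr 1
        funext z
        simp only [Submodule.coe_smul, Pi.smul_apply, smul_eq_mul]
        ring }
  have hTn : ∀ f, ‖T f‖ = (fockN 2 B (f : Cn n → ℂ)).toReal := fun f => Lp.norm_toLp _ (hmem f)
  have hT : Function.Injective T := by
    refine (injective_iff_map_eq_zero T).2 fun f hf => ?_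
    obtain ⟨C, -, hC⟩ := exists_fockWgt_mul_le n (p := 2) two_ne_zero B
    ext z
    have h1 := hC f f.2.1 f.2.2 z
    rw [← hTn, hf, norm_zero, mul_zero] at h1
    have h2 : ‖(f : Cn n → ℂ) z‖ ≤ 0 := by
      by_contra! h
      exact (mul_pos (fockWgt_pos B z) h).not_ge h1
    simpa using h2
  let e := LinearEquiv.ofInjective T hT
  let F : StrongDual ℂ (LinearMap.range T) :=
    (ν ∘ₗ e.symm.toLinearMap).mkContinuous D fun x => by
      have h1 := hν (e.symm x)
      rw [← hTn] at h1
      have h2 : T (e.symm x) = x := congrArg Subtype.val (e.apply_symm_apply x)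
      rw [h2] at h1
      exact h1
  obtain ⟨G, hG, -⟩ := exists_extension_norm_eq (LinearMap.range T) F
  set ψ := (InnerProductSpace.toDual ℂ (Lp ℂ 2 (fockV n))).symm G with hψ
  refine ⟨ψ, Lp.memLp ψ, fun f => ?_⟩
  have h1 : ν f = inner ℂ ψ (T f) := by
    rw [hψ, InnerProductSpace.toDual_symm_apply]
    have h2 := hG (e f)
    have h3 : F (e f) = ν f := by
      change ν (e.symm (e f)) = ν f
      rw [e.symm_apply_apply]
    rw [← h3, ← h2]
    rfl
  rw [h1, L2.inner_def]
  refine integral_congr_ae ?_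
  filter_upwards [(hmem f).coeFn_toLp] with z hz
  have h3 : (T f) z = (fockWgt B z : ℂ) * (f : Cn n → ℂ) z := hz
  rw [h3, RCLike.inner_apply]

/-- A bounded functional is given by integration against a function of moderate growth. -/
theorem exists_integral_representation {p : ℝ} (hp : 0 < p) {b : ℝ}
    (ν : fockA n (ENNReal.ofReal p) b →ₗ[ℂ] ℂ) {D : ℝ}
    (hν : ∀ f, ‖ν f‖ ≤ D * (fockN (ENNReal.ofReal p) b (f : Cn n → ℂ)).toReal) :
    ∃ Ψ : Cn n → ℂ, AEStronglyMeasurable Ψ (fockV n) ∧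
      (∀ ε < 1 / 2, Integrable (fun z => ‖Ψ z‖ * Real.exp (ε * ‖z‖ ^ 2)) (fockV n)) ∧
      ∀ (f : fockA n (ENNReal.ofReal p) b) (C ε : ℝ), ε < 1 / 2 → (∀ z, ‖(f : Cn n → ℂ) z‖ ≤ C * Real.exp (ε * ‖z‖ ^ 2)) →
        ν f = ∫ z, (f : Cn n → ℂ) z * conj (Ψ z) ∂(fockV n) := by
  obtain ⟨B, K, hK, hle⟩ := exists_fockN_le_fockN_two n hp b
  have hsub : fockA n 2 B ≤ fockA n (ENNReal.ofReal p) b := fun f hf =>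
    ⟨hf.1, ne_top_of_le_ne_top (ENNReal.mul_ne_top hK hf.2) (hle f hf.1)⟩
  obtain ⟨ψ, hψ, hrep⟩ := exists_L2_representation (ν ∘ₗ Submodule.inclusion hsub)
    (D := |D| * K.toReal) fun f => by
      have h1 := ENNReal.toReal_mono (ENNReal.mul_ne_top hK f.2.2) (hle f f.2.1)
      rw [ENNReal.toReal_mul] at h1
      refine (hν (Submodule.inclusion hsub f)).trans ?_
      calc _ ≤ |D| * (fockN (ENNReal.ofReal p) b (f : Cn n → ℂ)).toReal :=
            mul_le_mul_of_nonneg_right (le_abs_self D) ENNReal.toReal_nonneg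
        _ ≤ |D| * (K.toReal * (fockN 2 B (f : Cn n → ℂ)).toReal) := by gcongr
        _ = _ := by ring
  refine ⟨fun z => (fockWgt B z : ℂ) * ψ z,
    (Complex.continuous_ofReal.comp (continuous_fockWgt B)).aestronglyMeasurable.mul hψ.1,
    fun ε hε => ?_, fun f C ε hε hf => ?_⟩
  · set ε' := (1 / 2 - ε) / 2 with hε'
    have hpos : 0 < ε' := by rw [hε']; linarith
    obtain ⟨C₁, hC₁, h₁⟩ := exists_rpow_mul_exp_le B 0 hpos
    have hg : MemLp (fun z : Cn n => Real.exp (-ε' * ‖z‖ ^ 2)) 2 (fockV n) := by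
      refine (memLp_two_iff_integrable_sq (by fun_prop)).2 ?_
      refine (integrable_exp_sub_sq n 0 (ε := 2 * ε') (by linarith)).congr (.of_forall fun z => ?_)
      simp only
      rw [← Real.exp_nat_mul]
      congr 1
      push_cast
      ring
    refine ((hψ.norm.integrable_mul hg).const_mul C₁).mono' ?_ (.of_forall fun z => ?_)
    · have := hψ.1
      have h2 := (Complex.continuous_ofReal.comp (continuous_fockWgt (n := n) B))
      exact ((h2.aestronglyMeasurable.mul this).norm).mul (by fun_prop)
    · have h3 := h₁ ‖z‖ (norm_nonneg z)
      rw [zero_mul, Real.exp_zero, mul_one] at h3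
      rw [norm_fockWgt_mul, Real.norm_of_nonneg (mul_nonneg (mul_nonneg (fockWgt_pos _ _).le
        (norm_nonneg _)) (Real.exp_pos _).le), fockWgt, Pi.mul_apply]
      calc _ = (1 + ‖z‖) ^ B * (‖ψ z‖ * (Real.exp (-‖z‖ ^ 2 / 2) * Real.exp (ε * ‖z‖ ^ 2))) := by
            ring
        _ ≤ C₁ * Real.exp (ε' * ‖z‖ ^ 2) *
            (‖ψ z‖ * (Real.exp (-‖z‖ ^ 2 / 2) * Real.exp (ε * ‖z‖ ^ 2))) := by gcongr
        _ = C₁ * (‖ψ z‖ * (Real.exp (ε' * ‖z‖ ^ 2) * (Real.exp (-‖z‖ ^ 2 / 2) *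
            Real.exp (ε * ‖z‖ ^ 2)))) := by ring
        _ = _ := by
            rw [← Real.exp_add, ← Real.exp_add]
            congr 3
            rw [hε']
            ring
  · have hC : 0 ≤ C := by
      have := (norm_nonneg _).trans (hf 0)
      simpa using this
    obtain ⟨K', hK', h'⟩ := exists_fockN_le_of_growth n (p := 2) two_ne_zero B
      (ε := 1 / 2 - ε) (by linarith)
    have hmem : (f : Cn n → ℂ) ∈ fockA n 2 B := ⟨f.2.1, ne_top_of_le_ne_top
      (ENNReal.mul_ne_top hK' ENNReal.ofReal_ne_top) (h' f C hC fun z => by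
        rw [sub_sub_cancel]; exact hf z)⟩
    refine (hrep ⟨f, hmem⟩).trans (integral_congr_ae (.of_forall fun z => ?_))
    simp only [map_mul, Complex.conj_ofReal]
    ring

end Representation

/-! ### The kernel e^{⟨w,z⟩} and the Bargmann projection. -/

section Kernel

variable {n : ℕ}

theorem norm_exp_inner_le (w z : Cn n) :
    ‖Complex.exp (inner ℂ w z)‖ ≤ Real.exp (‖w‖ * ‖z‖) := by
  rw [Complex.norm_exp, Real.exp_le_exp]
  exact re_inner_le_norm (𝕜 := ℂ) w z

theorem continuous_exp_inner :
    Continuous fun x : Cn n × Cn n => Complex.exp (inner ℂ x.1 x.2) := by fun_prop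

theorem differentiable_exp_inner (w : Cn n) :
    Differentiable ℂ fun z : Cn n => Complex.exp (inner ℂ w z) :=
  (innerSL ℂ w).differentiable.cexp

theorem norm_exp_inner_mul_exp (w z : Cn n) :
    Real.exp (-‖z‖ ^ 2 / 2) * ‖Complex.exp (inner ℂ w z)‖ * Real.exp (-‖w‖ ^ 2 / 2) =
      Real.exp (-‖z - w‖ ^ 2 / 2) := by
  rw [Complex.norm_exp, ← Real.exp_add, ← Real.exp_add]
  congr 1
  have h := norm_sub_sq (𝕜 := ℂ) z w
  have h2 : RCLike.re (inner ℂ z w) = (inner ℂ w z).re := inner_re_symm z w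
  rw [h, h2]
  ring

/-- The Bargmann projection. -/
noncomputable def bargmannProj (φ : Cn n → ℂ) (z : Cn n) : ℂ :=
  ∫ w, (φ w * ((Real.exp (-‖w‖ ^ 2) : ℝ) : ℂ)) * Complex.exp (inner ℂ w z) ∂(fockV n)

/-- The constants matter: 1/3 < 1/2 keeps the resulting growth admissible for the representation of
functionals, and 3/4 + 1/8 < 1 keeps the projection of functions of growth e^{|w|²/8} convergent. -/
theorem mul_le_third_sq_add (x y : ℝ) : x * y ≤ 1 / 3 * y ^ 2 + 3 / 4 * x ^ 2 := by
  nlinarith [sq_nonneg (2 * y - 3 * x)]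

theorem norm_mul_exp_mul_exp_inner_le {φ : Cn n → ℂ} {C : ℝ}
    (hφ : ∀ w, ‖φ w‖ ≤ C * Real.exp (1 / 8 * ‖w‖ ^ 2)) (w z : Cn n) :
    ‖(φ w * ((Real.exp (-‖w‖ ^ 2) : ℝ) : ℂ)) * Complex.exp (inner ℂ w z)‖ ≤
      C * Real.exp (0 * ‖w‖ - 1 / 8 * ‖w‖ ^ 2) * Real.exp (1 / 3 * ‖z‖ ^ 2) := by
  have hC : 0 ≤ C := by
    have := (norm_nonneg _).trans (hφ 0)
    simpa using this
  rw [norm_mul, norm_mul, Complex.norm_real, Real.norm_of_nonneg (Real.exp_pos _).le]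
  calc _ ≤ C * Real.exp (1 / 8 * ‖w‖ ^ 2) * Real.exp (-‖w‖ ^ 2) *
        Real.exp (1 / 3 * ‖z‖ ^ 2 + 3 / 4 * ‖w‖ ^ 2) := by
        gcongr
        · exact hφ w
        · exact (norm_exp_inner_le w z).trans (Real.exp_le_exp.2 (mul_le_third_sq_add _ _))
    _ = C * (Real.exp (1 / 8 * ‖w‖ ^ 2) * Real.exp (-‖w‖ ^ 2) *
        Real.exp (1 / 3 * ‖z‖ ^ 2 + 3 / 4 * ‖w‖ ^ 2)) := by ring
    _ = _ := by
        rw [← Real.exp_add, ← Real.exp_add, mul_assoc, ← Real.exp_add]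
        congr 2
        ring

theorem norm_bargmannProj_le {φ : Cn n → ℂ} {C : ℝ}
    (hφ : ∀ w, ‖φ w‖ ≤ C * Real.exp (1 / 8 * ‖w‖ ^ 2)) (z : Cn n) :
    ‖bargmannProj φ z‖ ≤ C * (∫ w : Cn n, Real.exp (0 * ‖w‖ - 1 / 8 * ‖w‖ ^ 2) ∂(fockV n)) *
      Real.exp (1 / 3 * ‖z‖ ^ 2) := by
  refine (norm_integral_le_of_norm_le
    (((integrable_exp_sub_sq n 0 (by norm_num)).const_mul C).mul_const _)
    (.of_forall fun w => norm_mul_exp_mul_exp_inner_le hφ w z)).trans (le_of_eq ?_)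
  rw [integral_mul_const, integral_const_mul]

theorem differentiable_bargmannProj {φ : Cn n → ℂ} (hm : AEStronglyMeasurable φ (fockV n)) {C : ℝ}
    (hφ : ∀ w, ‖φ w‖ ≤ C * Real.exp (1 / 8 * ‖w‖ ^ 2)) : Differentiable ℂ (bargmannProj φ) := by
  have hC : 0 ≤ C := by
    have := (norm_nonneg _).trans (hφ 0)
    simpa using this
  refine differentiable_integral_of_dominated
    (e := fun w z => Complex.exp (inner ℂ w z))
    (hm.mul (Continuous.aestronglyMeasurable (by fun_prop))) continuous_exp_inner
    differentiable_exp_inner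
    (fun R w => C * Real.exp (R * ‖w‖ - 7 / 8 * ‖w‖ ^ 2))
    (fun R => (integrable_exp_sub_sq n R (by norm_num)).const_mul C) fun R w z hz => ?_
  rw [norm_mul, Complex.norm_real, Real.norm_of_nonneg (Real.exp_pos _).le]
  calc _ ≤ C * Real.exp (1 / 8 * ‖w‖ ^ 2) * Real.exp (-‖w‖ ^ 2) * Real.exp (‖w‖ * R) := by
        gcongr
        · exact hφ w
        · exact (norm_exp_inner_le w z).trans (by gcongr)
    _ = C * (Real.exp (1 / 8 * ‖w‖ ^ 2) * Real.exp (-‖w‖ ^ 2) * Real.exp (‖w‖ * R)) := by ring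
    _ = _ := by
        rw [← Real.exp_add, ← Real.exp_add]
        congr 2
        ring

/-- Translating the integration variable by z turns the integral into the Gaussian mean of the
entire function F(u) = f(z+u)e^{-⟨z,u⟩}. By rotation invariance this mean is F(0) = f(z). -/
theorem bargmannProj_eq_self {f : Cn n → ℂ} (hf : Differentiable ℂ f) {C : ℝ}
    (hfC : ∀ w, ‖f w‖ ≤ C * Real.exp (1 / 8 * ‖w‖ ^ 2)) : bargmannProj f = f := by
  funext z
  set H : Cn n → ℂ := fun w =>
    (f w * ((Real.exp (-‖w‖ ^ 2) : ℝ) : ℂ)) * Complex.exp (inner ℂ w z) with hH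
  have hHi : Integrable H (fockV n) := by
    refine (((integrable_exp_sub_sq n 0 (by norm_num)).const_mul C).mul_const _).mono' ?_
      (.of_forall fun w => norm_mul_exp_mul_exp_inner_le hfC w z)
    have := hf.continuous
    exact Continuous.aestronglyMeasurable (by fun_prop)
  set F : Cn n → ℂ := fun u => f (z + u) * Complex.exp (-inner ℂ z u) with hF
  have hFd : Differentiable ℂ F :=
    (hf.comp (differentiable_id.const_add z)).mul (innerSL ℂ z).differentiable.neg.cexp
  have hHF : ∀ u, H (z + u) = F u * ((Real.exp (-‖u‖ ^ 2) : ℝ) : ℂ) := fun u => by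
    simp only [hH, hF]
    have h1 : ((‖z + u‖ ^ 2 : ℝ) : ℂ) =
        ((‖z‖ ^ 2 : ℝ) : ℂ) + inner ℂ z u + inner ℂ u z + ((‖u‖ ^ 2 : ℝ) : ℂ) := by
      have h2 := inner_self_eq_norm_sq_to_K (𝕜 := ℂ) (z + u)
      have h3 := inner_self_eq_norm_sq_to_K (𝕜 := ℂ) z
      have h4 := inner_self_eq_norm_sq_to_K (𝕜 := ℂ) u
      rw [inner_add_add_self, h3, h4] at h2
      push_cast
      exact h2.symm
    have h5 : inner ℂ z z = ((‖z‖ ^ 2 : ℝ) : ℂ) := by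
      rw [inner_self_eq_norm_sq_to_K (𝕜 := ℂ) z]; push_cast; rfl
    rw [inner_add_left, h5, Complex.ofReal_exp, Complex.ofReal_exp, mul_assoc, mul_assoc,
      ← Complex.exp_add, ← Complex.exp_add, Complex.ofReal_neg, Complex.ofReal_neg, h1]
    congr 2
    ring
  have h1 : ∫ u, H (z + u) ∂(fockV n) = ∫ w, H w ∂(fockV n) := integral_add_left_eq_self H z
  have h2 : Integrable (fun u => H (z + u)) (fockV n) := hHi.comp_add_left z
  set E : Cn n → ℂ := fun u => ((Real.exp (-‖u‖ ^ 2) : ℝ) : ℂ) with hE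
  have h3 : (fun u => H (z + u)) = fun u => conj (E u * conj (F u)) := by
    funext u
    rw [hHF, map_mul, Complex.conj_conj, Complex.conj_ofReal, mul_comm]
  rw [h3] at h2
  have h4 : Integrable (fun u => E u * conj (F u)) (fockV n) := by
    simpa using Complex.conjCLE.toContinuousLinearMap.integrable_comp h2
  have h5 := integral_mul_conj_homPart (φ := E) (by fun_prop) 0 (fun e he z => by
    simp [hE, norm_smul, he]) hFd h4
  have h6 : ∀ u, homPart 0 F u = f z := fun u => by
    simp [homPart, hF]
  simp_rw [h6] at h5
  rw [integral_mul_const, integral_complex_ofReal, integral_gaussian_fockV, Complex.ofReal_one,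
    one_mul] at h5
  have h7 : bargmannProj f z = ∫ w, H w ∂(fockV n) := rfl
  rw [h7, ← h1, h3, integral_conj, h5, Complex.conj_conj]

end Kernel

/-! ### The symbol of a functional and bounds for the kernel. -/

section Symbol

variable {n : ℕ}

/-- The function `w ↦ ∫ Ψ(z) e^{⟨w, z⟩} dV(z)` representing the functional `f ↦ ∫ f conj(Ψ) dV`. -/
noncomputable def dualSymbol (Ψ : Cn n → ℂ) (w : Cn n) : ℂ :=
  ∫ z, Ψ z * Complex.exp (inner ℂ z w) ∂(fockV n)

theorem norm_exp_inner_le_third (w z : Cn n) :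
    ‖Complex.exp (inner ℂ w z)‖ ≤ Real.exp (3 / 4 * ‖w‖ ^ 2) * Real.exp (1 / 3 * ‖z‖ ^ 2) := by
  refine (norm_exp_inner_le w z).trans ?_
  rw [← Real.exp_add, Real.exp_le_exp]
  linarith [mul_le_third_sq_add ‖w‖ ‖z‖]

theorem differentiable_dualSymbol {Ψ : Cn n → ℂ} (hm : AEStronglyMeasurable Ψ (fockV n))
    (hi : Integrable (fun z => ‖Ψ z‖ * Real.exp (1 / 3 * ‖z‖ ^ 2)) (fockV n)) :
    Differentiable ℂ (dualSymbol Ψ) := by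
  refine differentiable_integral_of_dominated (e := fun z w => Complex.exp (inner ℂ z w)) hm
    continuous_exp_inner differentiable_exp_inner
    (fun R z => Real.exp (3 / 4 * R ^ 2) * (‖Ψ z‖ * Real.exp (1 / 3 * ‖z‖ ^ 2)))
    (fun R => hi.const_mul _) fun R z w hw => ?_
  have h1 : ‖Complex.exp (inner ℂ z w)‖ ≤
      Real.exp (3 / 4 * R ^ 2) * Real.exp (1 / 3 * ‖z‖ ^ 2) := by
    refine (norm_exp_inner_le z w).trans ?_
    rw [← Real.exp_add, Real.exp_le_exp]
    have h2 : ‖w‖ ^ 2 ≤ R ^ 2 := by gcongr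
    linarith [mul_le_third_sq_add ‖w‖ ‖z‖]
  calc _ ≤ ‖Ψ z‖ * (Real.exp (3 / 4 * R ^ 2) * Real.exp (1 / 3 * ‖z‖ ^ 2)) := by gcongr
    _ = _ := by ring

theorem conj_dualSymbol (Ψ : Cn n → ℂ) (w : Cn n) :
    conj (dualSymbol Ψ w) = ∫ z, Complex.exp (inner ℂ w z) * conj (Ψ z) ∂(fockV n) := by
  rw [dualSymbol, ← integral_conj]
  refine integral_congr_ae (.of_forall fun z => ?_)
  simp only [map_mul]
  rw [← Complex.exp_conj, inner_conj_symm, mul_comm]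

/-- Fubini: the Gaussian pairing of φ with the symbol is the functional evaluated at the Bargmann
projection of φ, where φ itself need not be holomorphic. -/
theorem integral_mul_conj_dualSymbol {Ψ : Cn n → ℂ} (hm : AEStronglyMeasurable Ψ (fockV n))
    (hi : Integrable (fun z => ‖Ψ z‖ * Real.exp (1 / 3 * ‖z‖ ^ 2)) (fockV n))
    {φ : Cn n → ℂ} (hφm : AEStronglyMeasurable φ (fockV n)) {C : ℝ}
    (hφ : ∀ w, ‖φ w‖ ≤ C * Real.exp (1 / 8 * ‖w‖ ^ 2)) :
    ∫ w, φ w * ((Real.exp (-‖w‖ ^ 2) : ℝ) : ℂ) * conj (dualSymbol Ψ w) ∂(fockV n) =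
      ∫ z, bargmannProj φ z * conj (Ψ z) ∂(fockV n) := by
  set F : Cn n → Cn n → ℂ := fun w z =>
    (φ w * ((Real.exp (-‖w‖ ^ 2) : ℝ) : ℂ)) * Complex.exp (inner ℂ w z) * conj (Ψ z) with hF
  have hFi : Integrable (Function.uncurry F) ((fockV n).prod (fockV n)) := by
    have h1 := ((integrable_exp_sub_sq n 0 (ε := 1 / 8) (by norm_num)).const_mul C).mul_prod hi
    refine h1.mono' ?_ (.of_forall fun x => ?_)
    · refine AEStronglyMeasurable.mul (AEStronglyMeasurable.mul ?_ ?_) ?_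
      · have hc : Continuous fun w : Cn n => ((Real.exp (-‖w‖ ^ 2) : ℝ) : ℂ) := by fun_prop
        exact (hφm.mul hc.aestronglyMeasurable).comp_fst
      · exact continuous_exp_inner.aestronglyMeasurable
      · exact (Complex.continuous_conj.comp_aestronglyMeasurable hm).comp_snd
    · simp only [Function.uncurry, hF]
      rw [norm_mul, RCLike.norm_conj]
      calc _ ≤ _ := mul_le_mul_of_nonneg_right (norm_mul_exp_mul_exp_inner_le hφ x.1 x.2)
            (norm_nonneg (Ψ x.2))
        _ = _ := by ring
  have h := integral_integral_swap hFi
  calc _ = ∫ w, ∫ z, F w z ∂(fockV n) ∂(fockV n) := by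
        refine integral_congr_ae (.of_forall fun w => ?_)
        simp only [hF]
        rw [conj_dualSymbol, ← integral_const_mul]
        simp only [mul_assoc]
    _ = ∫ z, ∫ w, F w z ∂(fockV n) ∂(fockV n) := h
    _ = _ := by
        refine integral_congr_ae (.of_forall fun z => ?_)
        simp only [hF]
        rw [integral_mul_const, bargmannProj]

theorem exists_norm_homPart_le_exp {f : Cn n → ℂ} (hf : Differentiable ℂ f) (k : ℕ) {ε : ℝ}
    (hε : 0 < ε) : ∃ C : ℝ, ∀ z, ‖homPart k f z‖ ≤ C * Real.exp (ε * ‖z‖ ^ 2) := by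
  obtain ⟨S, hS⟩ := (isCompact_closedBall (0 : Cn n) 1).exists_bound_of_continuousOn
    hf.continuous.continuousOn
  have hS' : ∀ w : Cn n, ‖w‖ ≤ 1 → ‖f w‖ ≤ S := fun w hw => hS w (by simpa using hw)
  have hS0 : 0 ≤ S := (norm_nonneg _).trans (hS' 0 (by simp))
  obtain ⟨D, hD, hle⟩ := exists_rpow_mul_exp_le k 0 hε
  refine ⟨S * D, fun z => ?_⟩
  have h1 := hle ‖z‖ (norm_nonneg z)
  rw [zero_mul, Real.exp_zero, mul_one, Real.rpow_natCast] at h1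
  calc ‖homPart k f z‖ ≤ S * (‖z‖ / 1) ^ k := norm_homPart_le_norm_pow hf one_pos hS' k z
    _ ≤ S * (D * Real.exp (ε * ‖z‖ ^ 2)) := by
        gcongr
        refine le_trans ?_ h1
        gcongr
        simp
    _ = _ := by ring

theorem rawPairing_zero (f g : Cn n → ℂ) :
    rawPairing 0 f g = ∫ z, f z * ((Real.exp (-‖z‖ ^ 2) : ℝ) : ℂ) * conj (g z) ∂(fockV n) := by
  rw [rawPairing, integral_fockW]
  refine integral_congr_ae (.of_forall fun z => ?_)
  simp only [Real.rpow_zero, pairInt]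
  push_cast
  ring

/-- Completing the square gives e^{-|z-w|²/2}, and Peetre's inequality moves the powers to
(1+|z-w|)^{|b|}. The weighted kernel is thus dominated by a convolution kernel. -/
theorem fockWgt_mul_norm_exp_inner_le (b : ℝ) (w z : Cn n) :
    fockWgt (-b) w * (fockWgt b z * ‖Complex.exp (inner ℂ w z)‖) ≤ fockWgt |b| (z - w) := by
  have h1 := one_add_rpow_le_mul b z w
  have h2 : (1 + ‖w‖) ^ (-b) * (1 + ‖z‖) ^ b ≤ (1 + ‖z - w‖) ^ |b| := by
    rw [Real.rpow_neg (by positivity), inv_mul_le_iff₀ (by positivity)]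
    exact h1
  simp only [fockWgt]
  rw [← norm_exp_inner_mul_exp w z]
  calc _ = Real.exp (-‖z‖ ^ 2 / 2) * ‖Complex.exp (inner ℂ w z)‖ * Real.exp (-‖w‖ ^ 2 / 2) *
        ((1 + ‖w‖) ^ (-b) * (1 + ‖z‖) ^ b) := by ring
    _ ≤ _ := by gcongr

theorem fockWgt_neg_mul_self (b : ℝ) (w : Cn n) :
    fockWgt (-b) w * fockWgt b w = Real.exp (-‖w‖ ^ 2) := by
  rw [fockWgt_mul_fockWgt, neg_add_cancel, Real.rpow_zero, mul_one]

theorem eLpNorm_fockWgt_ne_top (n : ℕ) {p : ℝ≥0∞} (hp : p ≠ 0) (b : ℝ) :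
    eLpNorm (fockWgt b : Cn n → ℝ) p (fockV n) ≠ ∞ := by
  obtain ⟨K, hK, h⟩ := exists_fockN_le_of_growth n hp b (ε := 1 / 2) (by norm_num)
  have h1 := h 1 1 zero_le_one fun z => by simp
  refine ne_top_of_le_ne_top (ENNReal.mul_ne_top hK ENNReal.ofReal_ne_top)
    (le_trans (le_of_eq ?_) h1)
  refine eLpNorm_congr_norm_ae (.of_forall fun z => ?_)
  rw [norm_fockWgt_mul]
  simp [abs_of_pos (fockWgt_pos b z)]

theorem fockN_exp_inner_le {p : ℝ≥0∞} (b : ℝ) (w : Cn n) :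
    fockN p b (fun z => Complex.exp (inner ℂ w z)) ≤
      ENNReal.ofReal (fockWgt (-b) w)⁻¹ * eLpNorm (fockWgt |b| : Cn n → ℝ) p (fockV n) := by
  have h1 : eLpNorm (fun z : Cn n => fockWgt |b| (z - w)) p (fockV n) =
      eLpNorm (fockWgt |b| : Cn n → ℝ) p (fockV n) :=
    eLpNorm_comp_measurePreserving (g := fockWgt |b|) (f := fun z : Cn n => z - w)
      (continuous_fockWgt |b|).aestronglyMeasurable (measurePreserving_sub_right (fockV n) w)
  have hpos := fockWgt_pos (-b) w
  have h2 : fockN p b (fun z => Complex.exp (inner ℂ w z)) ≤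
      eLpNorm ((fockWgt (-b) w)⁻¹ • fun z : Cn n => fockWgt |b| (z - w)) p (fockV n) := by
    refine eLpNorm_mono fun z => ?_
    refine (norm_fockWgt_mul b (fun z => Complex.exp (inner ℂ w z)) z).le.trans ?_
    rw [Pi.smul_apply, norm_smul, Real.norm_of_nonneg (inv_nonneg.2 hpos.le),
      Real.norm_of_nonneg (fockWgt_pos _ _).le, ← div_eq_inv_mul, le_div_iff₀ hpos, mul_comm]
    exact fockWgt_mul_norm_exp_inner_le b w z
  rwa [eLpNorm_const_smul, ← ofReal_norm, Real.norm_of_nonneg (inv_nonneg.2 hpos.le), h1] at h2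

/-- Young's inequality for convolution with an integrable function. -/
theorem lintegral_conv_rpow_le {p r : ℝ} (hpr : p.HolderConjugate r) {k Φ : Cn n → ℝ≥0∞}
    (hk : Measurable k) (hΦ : Measurable Φ) :
    ∫⁻ z, (∫⁻ w, k (z - w) * Φ w ∂(fockV n)) ^ p ∂(fockV n) ≤
      (∫⁻ u, k u ∂(fockV n)) ^ p * ∫⁻ w, Φ w ^ p ∂(fockV n) := by
  set I := ∫⁻ u, k u ∂(fockV n) with hI
  have hp := hpr.pos
  have hr := hpr.symm.pos
  have hmk : Measurable fun x : Cn n × Cn n => k (x.1 - x.2) := hk.comp (by fun_prop)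
  have hmk1 : ∀ z, Measurable fun w => k (z - w) := fun z => hk.comp (by fun_prop)
  have hpt : ∀ z, (∫⁻ w, k (z - w) * Φ w ∂(fockV n)) ^ p ≤
      I ^ (p / r) * ∫⁻ w, k (z - w) * Φ w ^ p ∂(fockV n) := fun z => by
    -- Hölder with the kernel split as k = k^{1/p}k^{1/r}.
    have h1 := ENNReal.lintegral_mul_le_Lp_mul_Lq (fockV n) hpr
      (f := fun w => k (z - w) ^ (1 / p) * Φ w) (g := fun w => k (z - w) ^ (1 / r))
      (((hmk1 z).pow_const _).mul hΦ).aemeasurable ((hmk1 z).pow_const _).aemeasurable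
    have e1 : ∀ w, ((fun w => k (z - w) ^ (1 / p) * Φ w) * fun w => k (z - w) ^ (1 / r)) w =
        k (z - w) * Φ w := fun w => by
      simp only [Pi.mul_apply]
      rw [mul_right_comm, ← ENNReal.rpow_add_of_nonneg _ _ (by positivity) (by positivity),
        one_div, one_div, hpr.inv_add_inv_eq_one, ENNReal.rpow_one]
    have e2 : ∀ w, (k (z - w) ^ (1 / p) * Φ w) ^ p = k (z - w) * Φ w ^ p := fun w => by
      rw [ENNReal.mul_rpow_of_nonneg _ _ hp.le, ← ENNReal.rpow_mul, one_div_mul_cancel hp.ne',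
        ENNReal.rpow_one]
    have e3 : ∀ w, (k (z - w) ^ (1 / r)) ^ r = k (z - w) := fun w => by
      rw [← ENNReal.rpow_mul, one_div_mul_cancel hr.ne', ENNReal.rpow_one]
    simp_rw [e1, e2, e3] at h1
    rw [lintegral_sub_left_eq_self k z, ← hI] at h1
    refine (ENNReal.rpow_le_rpow h1 hp.le).trans (le_of_eq ?_)
    rw [ENNReal.mul_rpow_of_nonneg _ _ hp.le, ← ENNReal.rpow_mul, ← ENNReal.rpow_mul,
      one_div_mul_cancel hp.ne', ENNReal.rpow_one, mul_comm]
    congr 2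
    ring
  calc _ ≤ ∫⁻ z, I ^ (p / r) * ∫⁻ w, k (z - w) * Φ w ^ p ∂(fockV n) ∂(fockV n) :=
        lintegral_mono hpt
    _ = I ^ (p / r) * ∫⁻ z, ∫⁻ w, k (z - w) * Φ w ^ p ∂(fockV n) ∂(fockV n) := by
        refine lintegral_const_mul _ ?_
        exact Measurable.lintegral_prod_right' (f := fun x : Cn n × Cn n =>
          k (x.1 - x.2) * Φ x.2 ^ p) (hmk.mul ((hΦ.comp measurable_snd).pow_const _))
    _ = I ^ (p / r) * ∫⁻ w, ∫⁻ z, k (z - w) * Φ w ^ p ∂(fockV n) ∂(fockV n) := by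
        rw [lintegral_lintegral_swap]
        exact (hmk.mul ((hΦ.comp measurable_snd).pow_const _)).aemeasurable
    _ = I ^ (p / r) * ∫⁻ w, I * Φ w ^ p ∂(fockV n) := by
        congr 1
        refine lintegral_congr fun w => ?_
        have hkw : Measurable fun z => k (z - w) := hk.comp (measurable_sub_const w)
        rw [lintegral_mul_const _ hkw, lintegral_sub_right_eq_self k w]
    _ = _ := by
        rw [lintegral_const_mul _ (hΦ.pow_const _), ← mul_assoc]
        congr 1
        nth_rewrite 2 [← ENNReal.rpow_one I]
        rw [← ENNReal.rpow_add_of_nonneg _ _ (by positivity) zero_le_one]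
        congr 1
        have := hpr.sub_one_mul_conj
        field_simp
        linarith

theorem fockN_bargmannProj_le {p r : ℝ} (hpr : p.HolderConjugate r) (b : ℝ) {φ : Cn n → ℂ}
    (hφ : Measurable φ) :
    fockN (ENNReal.ofReal p) b (bargmannProj φ) ≤
      eLpNorm (fockWgt |b| : Cn n → ℝ) 1 (fockV n) * fockN (ENNReal.ofReal p) b φ := by
  have hp := hpr.pos
  have hw : Measurable fun w => (fockWgt b w : ℂ) * φ w :=
    (Complex.continuous_ofReal.comp (continuous_fockWgt b)).measurable.mul hφ
  have hpt : ∀ z, ‖(fockWgt b z : ℂ) * bargmannProj φ z‖ₑ ≤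
      ∫⁻ w, ‖fockWgt |b| (z - w)‖ₑ * ‖(fockWgt b w : ℂ) * φ w‖ₑ ∂(fockV n) := fun z => by
    rw [bargmannProj, ← integral_const_mul]
    refine (enorm_integral_le_lintegral_enorm _).trans (lintegral_mono fun w => ?_)
    rw [← ofReal_norm, ← ofReal_norm, ← ofReal_norm, ← ENNReal.ofReal_mul (norm_nonneg _)]
    refine ENNReal.ofReal_le_ofReal ?_
    rw [norm_mul, norm_fockWgt_mul, Complex.norm_real, Real.norm_of_nonneg (fockWgt_pos _ _).le, Real.norm_of_nonneg (fockWgt_pos _ _).le, norm_mul,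
      norm_mul, Complex.norm_real, Real.norm_of_nonneg (Real.exp_pos _).le,
      ← fockWgt_neg_mul_self b w]
    calc _ = fockWgt (-b) w * (fockWgt b z * ‖Complex.exp (inner ℂ w z)‖) *
          (fockWgt b w * ‖φ w‖) := by ring
      _ ≤ _ := mul_le_mul_of_nonneg_right (fockWgt_mul_norm_exp_inner_le b w z)
          (mul_nonneg (fockWgt_pos _ _).le (norm_nonneg _))
  rw [← ENNReal.rpow_le_rpow_iff hp, ENNReal.mul_rpow_of_nonneg _ _ hp.le, fockN_rpow hp,
    fockN_rpow hp, eLpNorm_one_eq_lintegral_enorm]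
  exact (lintegral_mono fun z => ENNReal.rpow_le_rpow (hpt z) hp.le).trans
    (lintegral_conv_rpow_le hpr (continuous_fockWgt |b|).enorm.measurable hw.enorm)

end Symbol

/-! ### Norm bound for the symbol. -/

section DualBound

variable {n : ℕ}

/-- Division by J^{1/p}. Finiteness of J is essential, which is why the symbol is tested on balls
before passing to the whole space. -/
theorem le_of_le_mul_rpow {p r : ℝ} (hpr : p.HolderConjugate r) {J M : ℝ≥0∞} (hJ : J ≠ ∞)
    (h : J ≤ M * J ^ (1 / p)) : J ≤ M ^ r := by
  rcases eq_or_ne J 0 with rfl | h0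
  · exact zero_le
  have hr := hpr.symm.pos
  have h1 : J ^ (1 / p) ≠ 0 := by simp [ENNReal.rpow_eq_zero_iff, h0, hJ]
  have h2 : J ^ (1 / p) ≠ ∞ := ENNReal.rpow_ne_top_of_nonneg (by have := hpr.pos; positivity) hJ
  have h3 : J = J ^ (1 / r) * J ^ (1 / p) := by
    rw [← ENNReal.rpow_add _ _ h0 hJ, one_div, one_div, hpr.symm.inv_add_inv_eq_one,
      ENNReal.rpow_one]
  have h4 : J ^ (1 / r) ≤ M := by
    rw [h3] at h
    nth_rewrite 2 [← h3] at h
    exact (ENNReal.mul_le_mul_iff_left h1 h2).1 h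
  calc J = (J ^ (1 / r)) ^ r := by
        rw [← ENNReal.rpow_mul, one_div_mul_cancel hr.ne', ENNReal.rpow_one]
    _ ≤ M ^ r := ENNReal.rpow_le_rpow h4 hr.le

/-- The function that realizes the `L^r` norm of `g` on a set by duality. -/
noncomputable def testFun (b r : ℝ) (S : Set (Cn n)) (g : Cn n → ℂ) : Cn n → ℂ :=
  S.indicator fun w => g w / (‖g w‖ : ℂ) *
    (((fockWgt (-b) w * ‖g w‖) ^ (r - 1) / fockWgt b w : ℝ) : ℂ)

theorem measurable_testFun (b r : ℝ) {S : Set (Cn n)} (hS : MeasurableSet S) {g : Cn n → ℂ}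
    (hg : Continuous g) : Measurable (testFun b r S g) := by
  have h1 := (continuous_fockWgt (n := n) b).measurable
  have h2 := (continuous_fockWgt (n := n) (-b)).measurable
  have h3 := hg.measurable
  exact Measurable.indicator (by fun_prop) hS

theorem fockWgt_mul_norm_testFun {b r : ℝ} (hr : 1 < r) (S : Set (Cn n)) (g : Cn n → ℂ)
    (w : Cn n) : fockWgt b w * ‖testFun b r S g w‖ =
      S.indicator (fun w => (fockWgt (-b) w * ‖g w‖) ^ (r - 1)) w := by
  have hb := fockWgt_pos b w
  have hb' := fockWgt_pos (-b) w
  by_cases hw : w ∈ S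
  · rw [testFun, Set.indicator_of_mem hw, Set.indicator_of_mem hw]
    rcases eq_or_ne (g w) 0 with h0 | h0
    · rw [h0, norm_zero, mul_zero, Real.zero_rpow (by linarith)]
      simp
    · have h1 : ‖g w‖ ≠ 0 := norm_ne_zero_iff.2 h0
      rw [norm_mul, norm_div, Complex.norm_real, Complex.norm_real, norm_norm, div_self h1,
        one_mul, Real.norm_of_nonneg (by positivity)]
      field_simp
  · rw [testFun, Set.indicator_of_notMem hw, Set.indicator_of_notMem hw]
    simp

theorem testFun_mul_conj {b r : ℝ} (hr : 1 < r) (S : Set (Cn n)) (g : Cn n → ℂ) (w : Cn n) :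
    testFun b r S g w * ((Real.exp (-‖w‖ ^ 2) : ℝ) : ℂ) * conj (g w) =
      ((S.indicator (fun w => (fockWgt (-b) w * ‖g w‖) ^ r) w : ℝ) : ℂ) := by
  have hb := fockWgt_pos b w
  have hb' := fockWgt_pos (-b) w
  by_cases hw : w ∈ S
  · rw [testFun, Set.indicator_of_mem hw, Set.indicator_of_mem hw, ← fockWgt_neg_mul_self b w]
    rcases eq_or_ne (g w) 0 with h0 | h0
    · rw [h0, norm_zero, mul_zero, Real.zero_rpow (show r ≠ 0 by linarith)]
      simp
    · have h1 : (0 : ℝ) < ‖g w‖ := norm_pos_iff.2 h0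
      have h2 : (‖g w‖ : ℂ) ≠ 0 := by exact_mod_cast h1.ne'
      have h3 : (fockWgt b w : ℂ) ≠ 0 := by exact_mod_cast hb.ne'
      have h4 : (fockWgt (-b) w * ‖g w‖) ^ r =
          (fockWgt (-b) w * ‖g w‖) ^ (r - 1) * (fockWgt (-b) w * ‖g w‖) := by
        rw [← Real.rpow_add_one (by positivity), sub_add_cancel]
      have h5 : g w * conj (g w) = (‖g w‖ : ℂ) ^ 2 := Complex.mul_conj' _
      rw [h4]
      push_cast
      field_simp
      linear_combination (((fockWgt (-b) w * ‖g w‖) ^ (r - 1) : ℝ) : ℂ) * (fockWgt (-b) w : ℂ) * h5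
  · rw [testFun, Set.indicator_of_notMem hw, Set.indicator_of_notMem hw]
    simp

theorem fockN_testFun {p r : ℝ} (hpr : p.HolderConjugate r) (b : ℝ) {S : Set (Cn n)}
    (hS : MeasurableSet S) (g : Cn n → ℂ) :
    fockN (ENNReal.ofReal p) b (testFun b r S g) =
      (∫⁻ w in S, ‖(fockWgt (-b) w : ℂ) * g w‖ₑ ^ r ∂(fockV n)) ^ (1 / p) := by
  rw [fockN_eq_lintegral hpr.pos, ← lintegral_indicator hS]
  congr 1
  refine lintegral_congr fun w => ?_
  have hb' := fockWgt_pos (-b) w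
  rw [← ofReal_norm, norm_fockWgt_mul, fockWgt_mul_norm_testFun hpr.symm.lt]
  by_cases hw : w ∈ S
  · rw [Set.indicator_of_mem hw, Set.indicator_of_mem hw, ← ofReal_norm, norm_fockWgt_mul,
      ENNReal.ofReal_rpow_of_nonneg (by positivity) hpr.pos.le,
      ENNReal.ofReal_rpow_of_nonneg (by positivity) hpr.symm.pos.le,
      ← Real.rpow_mul (by positivity), hpr.symm.sub_one_mul_conj]
  · rw [Set.indicator_of_notMem hw, Set.indicator_of_notMem hw, ENNReal.ofReal_zero,
      ENNReal.zero_rpow_of_pos hpr.pos]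

theorem exists_norm_testFun_le {r : ℝ} (hr : 1 < r) (b R : ℝ) {g : Cn n → ℂ} (hg : Continuous g) :
    ∃ C : ℝ, ∀ w, ‖testFun b r (Metric.closedBall 0 R) g w‖ ≤ C * Real.exp (1 / 8 * ‖w‖ ^ 2) := by
  have hc : Continuous fun w => (fockWgt (-b) w * ‖g w‖) ^ (r - 1) / fockWgt b w :=
    (((continuous_fockWgt (-b)).mul hg.norm).rpow_const fun _ => Or.inr (by linarith)).div
      (continuous_fockWgt b) fun z => (fockWgt_pos b z).ne'
  obtain ⟨C, hC⟩ := (isCompact_closedBall (0 : Cn n) R).exists_bound_of_continuousOn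
    hc.continuousOn
  refine ⟨|C|, fun w => ?_⟩
  have hb := fockWgt_pos b w
  have h1 := fockWgt_mul_norm_testFun hr (Metric.closedBall 0 R) g w (b := b)
  have h2 : ‖testFun b r (Metric.closedBall 0 R) g w‖ ≤ |C| := by
    by_cases hw : w ∈ Metric.closedBall (0 : Cn n) R
    · rw [Set.indicator_of_mem hw] at h1
      have h3 := (le_abs_self _).trans ((hC w hw).trans (le_abs_self C))
      rwa [← h1, mul_div_cancel_left₀ _ hb.ne'] at h3
    · rw [testFun, Set.indicator_of_notMem hw, norm_zero]
      exact abs_nonneg C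
  refine h2.trans (le_mul_of_one_le_right (abs_nonneg C) (Real.one_le_exp (by positivity)))

/-- A functional bounded by the weighted `L^p` norm is represented on homogeneous polynomials by
an entire function in the dual Fock space, through the Gaussian pairing. -/
theorem exists_dual_representation (n : ℕ) {p : ℝ} {q : ℝ≥0∞} (h : DualExp p q) (b : ℝ) :
    ∃ A : ℝ≥0∞, A ≠ ∞ ∧ ∀ (ν : fockA n (ENNReal.ofReal p) b →ₗ[ℂ] ℂ) (D : ℝ), 0 ≤ D →
      (∀ f, ‖ν f‖ ≤ D * (fockN (ENNReal.ofReal p) b (f : Cn n → ℂ)).toReal) →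
      ∃ g : Cn n → ℂ, Differentiable ℂ g ∧ fockN q (-b) g ≤ ENNReal.ofReal D * A ∧
        ∀ (f : Cn n → ℂ), Differentiable ℂ f → ∀ k
          (hk : homPart k f ∈ fockA n (ENNReal.ofReal p) b),
          ν ⟨homPart k f, hk⟩ = rawPairing 0 (homPart k f) g := by
  have hp := h.pos
  have hp' : ENNReal.ofReal p ≠ 0 := by simpa using hp
  -- Exponent p for the quasi-norm of the kernels when p ≤ 1; exponent 1 for Young's inequality when
  -- p > 1.
  set A := eLpNorm (fockWgt |b| : Cn n → ℝ) (if p ≤ 1 then ENNReal.ofReal p else 1) (fockV n)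
    with hA
  refine ⟨A, eLpNorm_fockWgt_ne_top n (by split_ifs; exacts [hp', one_ne_zero]) _,
    fun ν D hD hν => ?_⟩
  obtain ⟨Ψ, hΨm, hΨi, hrep⟩ := exists_integral_representation hp ν hν
  have hi := hΨi (1 / 3) (by norm_num)
  set g := dualSymbol Ψ with hg
  have hgd : Differentiable ℂ g := differentiable_dualSymbol hΨm hi
  have hproj : ∀ (φ : Cn n → ℂ) (C : ℝ), AEStronglyMeasurable φ (fockV n) →
      (∀ w, ‖φ w‖ ≤ C * Real.exp (1 / 8 * ‖w‖ ^ 2)) →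
      ∀ hmem : bargmannProj φ ∈ fockA n (ENNReal.ofReal p) b,
      ν ⟨bargmannProj φ, hmem⟩ =
        ∫ w, φ w * ((Real.exp (-‖w‖ ^ 2) : ℝ) : ℂ) * conj (g w) ∂(fockV n) :=
    fun φ C hφm hφ hmem => by
      rw [integral_mul_conj_dualSymbol hΨm hi hφm hφ]
      exact hrep ⟨_, hmem⟩ _ (1 / 3) (by norm_num) (norm_bargmannProj_le hφ)
  refine ⟨g, hgd, ?_, fun f hf k hk => ?_⟩
  · have hνe : ∀ f, ‖ν f‖ₑ ≤ ENNReal.ofReal D * fockN (ENNReal.ofReal p) b (f : Cn n → ℂ) :=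
      fun f => by
        rw [← ofReal_norm, ← ENNReal.ofReal_toReal f.2.2, ← ENNReal.ofReal_mul hD]
        exact ENNReal.ofReal_le_ofReal (hν f)
    rcases h with ⟨r, hpr, rfl⟩ | ⟨-, hp1, rfl⟩
    · rw [if_neg hpr.lt.not_ge] at hA
      have hr := hpr.symm.pos
      -- With J the r-th power integral of the weighted symbol over the ball, ν applied to the
      -- projection of the extremal function equals J, while the norm of that projection is at most
      -- A J^{1/p}. Hence J ≤ D A J^{1/p}.
      have hball : ∀ R : ℝ, ∫⁻ w in Metric.closedBall 0 R,
          ‖(fockWgt (-b) w : ℂ) * g w‖ₑ ^ r ∂(fockV n) ≤ (ENNReal.ofReal D * A) ^ r := fun R => by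
        have hS : MeasurableSet (Metric.closedBall (0 : Cn n) R) :=
          Metric.isClosed_closedBall.measurableSet
        set S := Metric.closedBall (0 : Cn n) R
        set J := ∫⁻ w in S, ‖(fockWgt (-b) w : ℂ) * g w‖ₑ ^ r ∂(fockV n) with hJ
        set φ := testFun b r S g with hφ
        have hφm : Measurable φ := measurable_testFun b r hS hgd.continuous
        obtain ⟨C, hC⟩ := exists_norm_testFun_le hpr.symm.lt b R hgd.continuous
        have hG : Continuous fun w => (fockWgt (-b) w * ‖g w‖) ^ r :=
          ((continuous_fockWgt (-b)).mul hgd.continuous.norm).rpow_const fun _ => Or.inr hr.le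
        have hGi : IntegrableOn (fun w => (fockWgt (-b) w * ‖g w‖) ^ r) S (fockV n) :=
          hG.continuousOn.integrableOn_compact (isCompact_closedBall 0 R)
        have hG0 : ∀ w, 0 ≤ (fockWgt (-b) w * ‖g w‖) ^ r := fun w =>
          Real.rpow_nonneg (mul_nonneg (fockWgt_pos _ _).le (norm_nonneg _)) _
        have hJG : J = ENNReal.ofReal (∫ w in S, (fockWgt (-b) w * ‖g w‖) ^ r ∂(fockV n)) := by
          rw [ofReal_integral_eq_lintegral_ofReal hGi (.of_forall hG0)]
          refine lintegral_congr fun w => ?_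
          rw [← ofReal_norm, norm_fockWgt_mul, ENNReal.ofReal_rpow_of_nonneg
            (mul_nonneg (fockWgt_pos _ _).le (norm_nonneg _)) hr.le]
        have hJt : J ≠ ∞ := by rw [hJG]; exact ENNReal.ofReal_ne_top
        have hNφ : fockN (ENNReal.ofReal p) b φ = J ^ (1 / p) := fockN_testFun hpr b hS g
        have hPN := fockN_bargmannProj_le hpr b hφm
        rw [← hA, hNφ] at hPN
        have hmem : bargmannProj φ ∈ fockA n (ENNReal.ofReal p) b :=
          ⟨differentiable_bargmannProj hφm.aestronglyMeasurable hC, ne_top_of_le_ne_top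
            (ENNReal.mul_ne_top (eLpNorm_fockWgt_ne_top n one_ne_zero _)
              (ENNReal.rpow_ne_top_of_nonneg (by positivity) hJt)) (hA ▸ hPN)⟩
        have h1 := hproj φ C hφm.aestronglyMeasurable hC hmem
        simp_rw [hφ, testFun_mul_conj hpr.symm.lt] at h1
        rw [integral_complex_ofReal, integral_indicator hS] at h1
        have h2 := hνe ⟨bargmannProj φ, hmem⟩
        rw [h1, ← ofReal_norm, Complex.norm_real,
          Real.norm_of_nonneg (integral_nonneg hG0), ← hJG] at h2
        refine le_of_le_mul_rpow hpr hJt (h2.trans ?_)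
        rw [mul_assoc]
        exact mul_le_mul_right hPN _
      -- The bound on balls is uniform in R, so it passes to the limit R → ∞.
      rw [← ENNReal.rpow_le_rpow_iff hr, fockN_rpow hr]
      have hcov : AECover (fockV n) Filter.atTop fun R : ℝ => Metric.closedBall (0 : Cn n) R :=
        aecover_closedBall Filter.tendsto_id
      refine le_of_tendsto (hcov.lintegral_tendsto_of_countably_generated
        ((continuous_fockWgt_mul (-b) hgd.continuous).enorm.measurable.pow_const r).aemeasurable)
        (.of_forall hball)
    · rw [if_pos hp1] at hA
      rw [fockN, eLpNorm_exponent_top]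
      refine eLpNormEssSup_le_of_ae_enorm_bound (.of_forall fun w => ?_)
      -- For p ≤ 1 the kernel e^{⟨w,·⟩} itself is the test function: ν sends it to conj g(w), and
      -- its quasi-norm is at most A divided by the weight of exponent -b at w.
      have hgr := norm_exp_inner_le_third w
      have hmem : (fun z => Complex.exp (inner ℂ w z)) ∈ fockA n (ENNReal.ofReal p) b :=
        ⟨differentiable_exp_inner w, ne_top_of_le_ne_top (ENNReal.mul_ne_top ENNReal.ofReal_ne_top
          (eLpNorm_fockWgt_ne_top n hp' _)) (fockN_exp_inner_le b w)⟩
      have h1 := hrep ⟨_, hmem⟩ _ (1 / 3) (by norm_num) hgr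
      have h2 := hνe ⟨_, hmem⟩
      have h3 : ‖ν ⟨_, hmem⟩‖ₑ = ‖g w‖ₑ := by
        rw [h1, ← conj_dualSymbol, ← ofReal_norm, RCLike.norm_conj, ofReal_norm]
      rw [h3] at h2
      have hpos := fockWgt_pos (-b) w
      calc ‖(fockWgt (-b) w : ℂ) * g w‖ₑ = ENNReal.ofReal (fockWgt (-b) w) * ‖g w‖ₑ := by
            rw [enorm_mul, ← ofReal_norm, Complex.norm_real, Real.norm_of_nonneg hpos.le]
        _ ≤ ENNReal.ofReal (fockWgt (-b) w) *
            (ENNReal.ofReal D * (ENNReal.ofReal (fockWgt (-b) w)⁻¹ * A)) := by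
            refine mul_le_mul_right (h2.trans (mul_le_mul_right ?_ _)) _
            rw [hA]
            exact fockN_exp_inner_le b w
        _ = ENNReal.ofReal (fockWgt (-b) w) * ENNReal.ofReal (fockWgt (-b) w)⁻¹ *
            (ENNReal.ofReal D * A) := by ring
        _ = _ := by
            rw [← ENNReal.ofReal_mul hpos.le, mul_inv_cancel₀ hpos.ne', ENNReal.ofReal_one,
              one_mul]
  · obtain ⟨C, hC⟩ := exists_norm_homPart_le_exp hf k (ε := 1 / 8) (by norm_num)
    have hd := differentiable_homPart hf k
    have hself := bargmannProj_eq_self hd hC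
    have h1 := hproj (homPart k f) C hd.continuous.aestronglyMeasurable hC (by rwa [hself])
    rw [rawPairing_zero, ← h1]
    congr 1
    exact Subtype.ext hself.symm

end DualBound

/-! ### Existence, uniqueness and norm comparison for the duality. -/

section Duality

variable {n : ℕ}

theorem eq_zero_of_rawPairing_self {h : Cn n → ℂ} (hh : Continuous h)
    (hi : Integrable (fun z => pairInt h h z) (fockV n)) (h0 : rawPairing 0 h h = 0) : h = 0 := by
  have e1 : ∀ z, pairInt h h z = ((‖h z‖ ^ 2 * Real.exp (-‖z‖ ^ 2) : ℝ) : ℂ) := fun z => by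
    rw [pairInt, Complex.mul_conj']; push_cast; ring
  rw [rawPairing, integral_fockW] at h0
  simp only [Real.rpow_zero, div_one, Complex.ofReal_one, one_mul] at h0
  simp_rw [e1] at h0 hi
  rw [integral_complex_ofReal, Complex.ofReal_eq_zero] at h0
  have hi' : Integrable (fun z => ‖h z‖ ^ 2 * Real.exp (-‖z‖ ^ 2)) (fockV n) := hi.re
  have hnn : ∀ z, 0 ≤ ‖h z‖ ^ 2 * Real.exp (-‖z‖ ^ 2) := fun z => by positivity
  rw [integral_eq_zero_iff_of_nonneg hnn hi'] at h0
  have hc : Continuous fun z => ‖h z‖ ^ 2 * Real.exp (-‖z‖ ^ 2) := by fun_prop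
  have h1 := (hc.ae_eq_iff_eq (fockV n) continuous_const).1 h0
  funext z
  have h2 : ‖h z‖ ^ 2 * Real.exp (-‖z‖ ^ 2) = 0 := congrFun h1 z
  simpa using h2

theorem pairInt_add_left (f f' g : Cn n → ℂ) : pairInt (f + f') g = pairInt f g + pairInt f' g := by
  funext z; simp only [pairInt, Pi.add_apply]; ring

theorem pairInt_add_right (f g g' : Cn n → ℂ) :
    pairInt f (g + g') = pairInt f g + pairInt f g' := by
  funext z; simp only [pairInt, Pi.add_apply, map_add]; ring

theorem pairInt_smul_left (c : ℂ) (f g : Cn n → ℂ) : pairInt (c • f) g = c • pairInt f g := by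
  funext z; simp only [pairInt, Pi.smul_apply, smul_eq_mul]; ring

theorem pairInt_smul_right (c : ℂ) (f g : Cn n → ℂ) :
    pairInt f (c • g) = conj c • pairInt f g := by
  funext z; simp only [pairInt, Pi.smul_apply, smul_eq_mul, map_mul]; ring

theorem lowPart_add (s : ℝ) {f g : Cn n → ℂ} (hf : Differentiable ℂ f) (hg : Differentiable ℂ g) :
    lowPart s (f + g) = lowPart s f + lowPart s g := by
  rw [lowPart_eq_homMul, lowPart_eq_homMul, lowPart_eq_homMul, homMul_add (geomBdd_lowInd s) hf hg]

theorem lowPart_smul (s : ℝ) (c : ℂ) (f : Cn n → ℂ) : lowPart s (c • f) = c • lowPart s f := by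
  rw [lowPart_eq_homMul, lowPart_eq_homMul, homMul_const_smul]

theorem highPart_add (s : ℝ) {f g : Cn n → ℂ} (hf : Differentiable ℂ f)
    (hg : Differentiable ℂ g) : highPart s (f + g) = highPart s f + highPart s g := by
  funext z
  simp only [highPart, lowPart_add s hf hg, Pi.add_apply]
  ring

theorem highPart_smul (s : ℝ) (c : ℂ) (f : Cn n → ℂ) : highPart s (c • f) = c • highPart s f := by
  funext z
  simp only [highPart, lowPart_smul, Pi.smul_apply, smul_eq_mul]
  ring

theorem fockPairing_add_left {σ : ℝ} {f f' g : Cn n → ℂ} (hf : Differentiable ℂ f)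
    (hf' : Differentiable ℂ f') (h : FockPairingConverges σ f g)
    (h' : FockPairingConverges σ f' g) :
    fockPairing σ (f + f') g = fockPairing σ f g + fockPairing σ f' g := by
  by_cases hσ : σ < 2 * n
  · simp only [fockPairing, if_pos hσ, rawPairing, pairInt_add_left]
    exact integral_add (h.1 hσ) (h'.1 hσ)
  · obtain ⟨i1, i2⟩ := h.2 (not_lt.1 hσ)
    obtain ⟨j1, j2⟩ := h'.2 (not_lt.1 hσ)
    simp only [fockPairing, if_neg hσ, rawPairing, lowPart_add _ hf hf', highPart_add _ hf hf',
      pairInt_add_left]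
    rw [integral_add' i1 j1, integral_add' i2 j2]
    ring

theorem fockPairing_add_right {σ : ℝ} {f g g' : Cn n → ℂ} (hg : Differentiable ℂ g)
    (hg' : Differentiable ℂ g') (h : FockPairingConverges σ f g)
    (h' : FockPairingConverges σ f g') :
    fockPairing σ f (g + g') = fockPairing σ f g + fockPairing σ f g' := by
  by_cases hσ : σ < 2 * n
  · simp only [fockPairing, if_pos hσ, rawPairing, pairInt_add_right]
    exact integral_add (h.1 hσ) (h'.1 hσ)
  · obtain ⟨i1, i2⟩ := h.2 (not_lt.1 hσ)
    obtain ⟨j1, j2⟩ := h'.2 (not_lt.1 hσ)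
    simp only [fockPairing, if_neg hσ, rawPairing, lowPart_add _ hg hg', highPart_add _ hg hg',
      pairInt_add_right]
    rw [integral_add' i1 j1, integral_add' i2 j2]
    ring

theorem rawPairing_smul_left (σ : ℝ) (c : ℂ) (f g : Cn n → ℂ) :
    rawPairing σ (c • f) g = c * rawPairing σ f g := by
  rw [rawPairing, pairInt_smul_left, rawPairing]
  exact integral_const_mul c _

theorem rawPairing_smul_right (σ : ℝ) (c : ℂ) (f g : Cn n → ℂ) :
    rawPairing σ f (c • g) = conj c * rawPairing σ f g := by
  rw [rawPairing, pairInt_smul_right, rawPairing]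
  exact integral_const_mul (conj c) _

theorem fockPairing_smul_left (σ : ℝ) (c : ℂ) (f g : Cn n → ℂ) :
    fockPairing σ (c • f) g = c * fockPairing σ f g := by
  simp only [fockPairing, lowPart_smul, highPart_smul, rawPairing_smul_left]
  split_ifs
  · rfl
  · ring

theorem fockPairing_smul_right (σ : ℝ) (c : ℂ) (f g : Cn n → ℂ) :
    fockPairing σ f (c • g) = conj c * fockPairing σ f g := by
  simp only [fockPairing, lowPart_smul, highPart_smul, rawPairing_smul_right]
  split_ifs
  · rfl
  · ring

/-- The functional `⟨·, g⟩_σ`. -/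
noncomputable def pairingFunctional (hn : 1 ≤ n) {p : ℝ} {q : ℝ≥0∞} (h : DualExp p q) {b b' σ : ℝ}
    (hσ : σ = -(b + b')) (g : fockA n q b') : fockA n (ENNReal.ofReal p) b →ₗ[ℂ] ℂ where
  toFun f := fockPairing σ (f : Cn n → ℂ) (g : Cn n → ℂ)
  map_add' f f' := by
    obtain ⟨C, -, hC⟩ := exists_fockPairing_bound hn h hσ
    exact fockPairing_add_left f.2.1 f'.2.1 (hC f f.2 g g.2).1 (hC f' f'.2 g g.2).1
  map_smul' c f := fockPairing_smul_left σ c (f : Cn n → ℂ) (g : Cn n → ℂ)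

/-- Divide each degree of the Gaussian representing function by `pairCoeff`. The two functionals
then agree on all homogeneous parts, and both are bounded, so they agree by density. -/
theorem exists_fockPairing_representation (hn : 1 ≤ n) {p : ℝ} {q : ℝ≥0∞} (h : DualExp p q)
    {b b' σ : ℝ} (hσ : σ = -(b + b')) :
    ∃ A : ℝ, 0 ≤ A ∧ ∀ (ν : fockA n (ENNReal.ofReal p) b →ₗ[ℂ] ℂ) (D : ℝ), 0 ≤ D →
      (∀ f, ‖ν f‖ ≤ D * (fockN (ENNReal.ofReal p) b (f : Cn n → ℂ)).toReal) →
      ∃ g : fockA n q b', (fockN q b' (g : Cn n → ℂ)).toReal ≤ A * D ∧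
        ∀ f, ν f = fockPairing σ (f : Cn n → ℂ) (g : Cn n → ℂ) := by
  have hp' : ENNReal.ofReal p ≠ 0 := by simpa using h.pos
  obtain ⟨A, hA, hrep⟩ := exists_dual_representation n h b
  have hm := mulOrd_inv_pairCoeff n σ
  obtain ⟨K, hK, hle⟩ := hm.exists_fockN_le h.ne_zero (-b)
  obtain ⟨C, hC, hpair⟩ := exists_fockPairing_bound hn h hσ
  obtain ⟨C₀, hC₀, hpair₀⟩ := exists_rawPairing_bound_of_lt hn h (b := b) (b' := -b) (σ := 0)
      (by ring) (by have : (1 : ℝ) ≤ n := (by exact_mod_cast hn); linarith)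
  refine ⟨(K * A).toReal, ENNReal.toReal_nonneg, fun ν D hD hν => ?_⟩
  obtain ⟨g₀, hg₀d, hg₀N, hg₀⟩ := hrep ν D hD hν
  set g := homMul (fun k => (pairCoeff n σ k)⁻¹) g₀ with hg
  have hgd : Differentiable ℂ g := differentiable_homMul hm.1 hg₀d
  have hgN : fockN q b' g ≤ K * (ENNReal.ofReal D * A) := by
    have h1 := hle g₀ hg₀d
    rw [show -b - 2 * (σ / 2) = b' by rw [hσ]; ring] at h1
    exact h1.trans (mul_le_mul_right hg₀N _)
  have hfin : K * (ENNReal.ofReal D * A) ≠ ∞ :=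
    ENNReal.mul_ne_top hK (ENNReal.mul_ne_top ENNReal.ofReal_ne_top hA)
  let G : fockA n q b' := ⟨g, hgd, ne_top_of_le_ne_top hfin hgN⟩
  refine ⟨G, ?_, fun f => ?_⟩
  · refine (ENNReal.toReal_mono hfin hgN).trans (le_of_eq ?_)
    rw [ENNReal.toReal_mul, ENNReal.toReal_mul, ENNReal.toReal_mul, ENNReal.toReal_ofReal hD]
    ring
  · have hg₀A : g₀ ∈ fockA n q (-b) := ⟨hg₀d, ne_top_of_le_ne_top
      (ENNReal.mul_ne_top ENNReal.ofReal_ne_top hA) hg₀N⟩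
    have hzero : ν - pairingFunctional hn h hσ G = 0 := by
      refine eq_zero_of_homPart h.pos _ (C := D + C * (fockN q b' g).toReal) (fun f => ?_)
        fun f k hk => ?_
      · rw [LinearMap.sub_apply]
        refine (norm_sub_le _ _).trans ((add_le_add (hν f) (hpair f f.2 G G.2).2).trans
          (le_of_eq ?_))
        change _ + C * (_ * (fockN q b' g).toReal) = _
        ring
      · have hd := f.2.1
        have hcoef := pairCoeff_pos hn σ k
        have h1 : pairingFunctional hn h hσ G ⟨homPart k f, hk⟩ =
            (pairCoeff n σ k : ℂ) * rawPairing 0 (homPart k f) (homPart k g) :=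
          fockPairing_homPart hn σ k hd hgd (hpair _ hk G G.2).1
        have h2 : homPart k g = ((pairCoeff n σ k)⁻¹ : ℂ) • homPart k g₀ := by
          funext z
          rw [hg, homPart_homMul hm.1 hg₀d]
          simp
        have h3 : ((pairCoeff n σ k : ℝ) : ℂ) ≠ 0 := by exact_mod_cast hcoef.ne'
        rw [LinearMap.sub_apply, hg₀ f hd k hk, h1, h2, rawPairing_smul_right, map_inv₀,
          Complex.conj_ofReal, ← mul_assoc, mul_inv_cancel₀ h3, one_mul, sub_eq_zero]
        exact rawPairing_homPart_right 0 (differentiable_homPart hd k).continuous k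
          (fun c z => homPart_smul_arg hd k c z) hg₀d (hpair₀ _ hk _ hg₀A).1
    have h4 := LinearMap.congr_fun hzero f
    rw [LinearMap.sub_apply, LinearMap.zero_apply, sub_eq_zero] at h4
    exact h4

/-- Test against f = g_k: the pairing is a positive multiple of the Gaussian L² norm squared of g_k,
so every homogeneous part of g vanishes. -/
theorem eq_of_fockPairing_eq (hn : 1 ≤ n) {p : ℝ} {q : ℝ≥0∞} (h : DualExp p q) {b b' σ : ℝ}
    (hσ : σ = -(b + b')) {g : Cn n → ℂ} (hg : g ∈ fockA n q b')
    (h0 : ∀ f ∈ fockA n (ENNReal.ofReal p) b, fockPairing σ f g = 0) : g = 0 := by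
  have hp' : ENNReal.ofReal p ≠ 0 := by simpa using h.pos
  obtain ⟨C, hC, hpair⟩ := exists_fockPairing_bound hn h hσ
  obtain ⟨C₀, hC₀, hpair₀⟩ := exists_rawPairing_bound_of_lt hn h (b := b) (b' := -b) (σ := 0)
      (by ring) (by have : (1 : ℝ) ≤ n := (by exact_mod_cast hn); linarith)
  have hk : ∀ k, homPart k g = 0 := fun k => by
    have hmem := homPart_mem_fockA hp' b hg.1 k
    have h1 := h0 _ hmem
    rw [fockPairing_homPart hn σ k hg.1 hg.1 (hpair _ hmem g hg).1] at h1
    have h3 : ((pairCoeff n σ k : ℝ) : ℂ) ≠ 0 := by exact_mod_cast (pairCoeff_pos hn σ k).ne'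
    refine eq_zero_of_rawPairing_self (differentiable_homPart hg.1 k).continuous ?_
      ((mul_eq_zero.1 h1).resolve_left h3)
    have h4 := (hpair₀ _ hmem _ (homPart_mem_fockA h.ne_zero (-b) hg.1 k)).1
    rw [integrable_fockW_iff] at h4
    simpa using h4
  funext z
  rw [← (hasSum_homPart hg.1 z).tsum_eq]
  simp [hk]

/-- Boundedness of the pairing gives the upper norm bound, and the quantitative representation gives
surjectivity and the lower one. The norms are arbitrary up to equivalence, so the result transfers
directly to the Fock–Sobolev norms. -/
theorem isDualUnderPairing_fockA (hn : 1 ≤ n) {p : ℝ} {q : ℝ≥0∞} (h : DualExp p q) {b b' σ : ℝ}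
    (hσ : σ = -(b + b')) {NF NG : (Cn n → ℂ) → ℝ} {c d : ℝ} (hc : 0 < c) (hd : 0 < d)
    (hNF : ∀ f ∈ fockA n (ENNReal.ofReal p) b,
      (fockN (ENNReal.ofReal p) b f).toReal ≤ c * NF f ∧
        NF f ≤ c * (fockN (ENNReal.ofReal p) b f).toReal)
    (hNG : ∀ g ∈ fockA n q b',
      (fockN q b' g).toReal ≤ d * NG g ∧ NG g ≤ d * (fockN q b' g).toReal) :
    IsDualUnderPairing σ (fockA n (ENNReal.ofReal p) b) (fockA n q b') NF NG := by
  obtain ⟨C, hC, hpair⟩ := exists_fockPairing_bound hn h hσ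
  obtain ⟨A, hA, hrep⟩ := exists_fockPairing_representation hn h hσ
  have hNF0 : ∀ f ∈ fockA n (ENNReal.ofReal p) b, 0 ≤ NF f := fun f hf =>
    nonneg_of_mul_nonneg_right (ENNReal.toReal_nonneg.trans (hNF f hf).1) hc
  have hNG0 : ∀ g ∈ fockA n q b', 0 ≤ NG g := fun g hg =>
    nonneg_of_mul_nonneg_right (ENNReal.toReal_nonneg.trans (hNG g hg).1) hd
  have hbound : ∀ (g : fockA n q b') (f : fockA n (ENNReal.ofReal p) b),
      ‖pairingFunctional hn h hσ g f‖ ≤ C * c * d * NG g * NF f := fun g f => by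
    refine (hpair f f.2 g g.2).2.trans ?_
    calc _ ≤ C * ((c * NF f) * (d * NG g)) := by
          have h1 := (hNF f f.2).1
          have h2 := (hNG g g.2).1
          have h3 := hNF0 f f.2
          gcongr
      _ = _ := by ring
  let Φ : fockA n q b' →ₛₗ[starRingEnd ℂ] boundedDual (fockA n (ENNReal.ofReal p) b) NF :=
    { toFun := fun g => ⟨pairingFunctional hn h hσ g, _, hbound g⟩
      map_add' := fun g g' => by
        ext f
        exact fockPairing_add_right g.2.1 g'.2.1 (hpair f f.2 g g.2).1 (hpair f f.2 g' g'.2).1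
      map_smul' := fun a g => by
        ext f
        exact fockPairing_smul_right σ a (f : Cn n → ℂ) (g : Cn n → ℂ) }
  have hinj : Function.Injective Φ := by
    refine (injective_iff_map_eq_zero Φ).2 fun g hg => ?_
    refine Subtype.ext (eq_of_fockPairing_eq hn h hσ g.2 fun f hf => ?_)
    have h1 := congrArg Subtype.val hg
    exact LinearMap.congr_fun h1 ⟨f, hf⟩
  have hsurj : Function.Surjective Φ := by
    rintro ⟨ν, D, hD⟩
    obtain ⟨g, -, hg⟩ := hrep ν (|D| * c) (by positivity) fun f => by
      refine (hD f).trans ?_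
      calc D * NF f ≤ |D| * NF f := mul_le_mul_of_nonneg_right (le_abs_self D) (hNF0 f f.2)
        _ ≤ |D| * (c * (fockN (ENNReal.ofReal p) b (f : Cn n → ℂ)).toReal) := by
            gcongr
            exact (hNF f f.2).2
        _ = _ := by ring
    exact ⟨g, Subtype.ext (LinearMap.ext fun f => (hg f).symm)⟩
  refine ⟨fun f hf g hg => (hpair f hf g hg).1, LinearEquiv.ofBijective Φ ⟨hinj, hsurj⟩,
    fun g f => rfl, C * c * d + d * A * c + 1, by positivity, fun g => ?_⟩
  set M := C * c * d + d * A * c + 1 with hM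
  have hM0 : 0 < M := by positivity
  change M⁻¹ * NG g ≤ dualNorm NF (pairingFunctional hn h hσ g) ∧
    dualNorm NF (pairingFunctional hn h hσ g) ≤ M * NG g
  have hbdd : BddBelow {D : ℝ | 0 ≤ D ∧ ∀ f : fockA n (ENNReal.ofReal p) b,
      ‖pairingFunctional hn h hσ g f‖ ≤ D * NF f} := ⟨0, fun D hD => hD.1⟩
  have hg0 := hNG0 g g.2
  have hmem : C * c * d * NG g ∈ {D : ℝ | 0 ≤ D ∧ ∀ f : fockA n (ENNReal.ofReal p) b,
      ‖pairingFunctional hn h hσ g f‖ ≤ D * NF f} := ⟨by positivity, hbound g⟩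
  constructor
  -- Any admissible bound D yields a representing function of norm at most a constant times D; by
  -- uniqueness it is g itself.
  · refine le_csInf ⟨_, hmem⟩ fun D hD => ?_
    obtain ⟨g', hg', hg'f⟩ := hrep (pairingFunctional hn h hσ g) (D * c)
      (mul_nonneg hD.1 hc.le) fun f => by
        refine (hD.2 f).trans ?_
        rw [mul_assoc]
        exact mul_le_mul_of_nonneg_left (hNF f f.2).2 hD.1
    have hgg : g' = g := hinj (Subtype.ext (LinearMap.ext fun f => (hg'f f).symm))
    rw [hgg] at hg'
    rw [inv_mul_le_iff₀ hM0]
    have hD0 := hD.1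
    calc NG g ≤ d * (A * (D * c)) := (hNG g g.2).2.trans (by gcongr)
      _ = d * A * c * D := by ring
      _ ≤ M * D := by
          gcongr
          have : 0 ≤ C * c * d := by positivity
          rw [hM]
          linarith
  · refine (csInf_le hbdd hmem).trans ?_
    gcongr
    have : 0 ≤ d * A * c := by positivity
    rw [hM]
    linarith

end Duality

/-! ### Conclusion. -/

theorem corollary5p9 (n : ℕ) (hn : 1 ≤ n) (s t α β : ℝ) :
    (∀ p q : ℝ, 1 < p → 1 / p + 1 / q = 1 →
      IsDualUnderPairing (α / p + β / q - s - t)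
        (fockSobolev n (ENNReal.ofReal p) α s) (fockSobolev n (ENNReal.ofReal q) β t)
        (fockSobolevNorm (ENNReal.ofReal p) α s) (fockSobolevNorm (ENNReal.ofReal q) β t)) ∧
    (∀ p : ℝ, 0 < p → p ≤ 1 →
      IsDualUnderPairing (α / p + β - s)
        (fockSobolev n (ENNReal.ofReal p) α s) (fockSpace n ∞ β)
        (fockSobolevNorm (ENNReal.ofReal p) α s) (normLw ∞ β)) := by
  refine ⟨fun p q hp hpq => ?_, fun p hp hp1 => ?_⟩
  · have hpq' : p.HolderConjugate q :=
      Real.holderConjugate_iff.2 ⟨hp, by rwa [one_div, one_div] at hpq⟩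
    obtain ⟨c, hc, hNF⟩ := exists_fockSobolevNorm_equiv hn hpq'.pos α s
    obtain ⟨d, hd, hNG⟩ := exists_fockSobolevNorm_equiv hn hpq'.symm.pos β t
    -- The weights are b = s - α/p and b' = t - β/q, whose sum is -σ.
    rw [fockSobolev_eq hn hpq'.pos, fockSobolev_eq hn hpq'.symm.pos]
    exact isDualUnderPairing_fockA hn (Or.inl ⟨q, hpq', rfl⟩) (by ring) hc hd hNF hNG
  · obtain ⟨c, hc, hNF⟩ := exists_fockSobolevNorm_equiv hn hp α s
    rw [fockSobolev_eq hn hp, fockSpace_top_eq]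
    refine isDualUnderPairing_fockA hn (Or.inr ⟨hp, hp1, rfl⟩) (by ring) hc one_pos hNF
      fun g _ => ?_
    rw [normLw_top_eq, one_mul]
    exact ⟨le_rfl, le_rfl⟩
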